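/- Let $V$ be a finite-dimensional real vector space with an increasing filtration $W$, nondegenerate bilinear forms $\langle\,,\rangle_w$ of parity $(-1)^w$ on $Gr^W_w$, and Hodge numbers $h^{p,q}$. Let $\mathcal M$ be the classifying space of the decreasing filtrations $F$ of $V_{\mathbb C}$ for which $(F,W)$ is a mixed Hodge structure with these Hodge numbers whose graded pieces are polarized by the $\langle\,,\rangle_w$. Let $G_{\mathbb C}$ be the group of automorphisms of $V_{\mathbb C}$ that preserve $W$ and induce isometries of $Gr^W$, let $G_{\mathbb R}$ be its subgroup of real elements, and let $\mathfrak g_{\mathbb C},\mathfrak g_{\mathbb R}$ be their Lie algebras; $\mathcal M$ is an open subset of a homogeneous space of $G_{\mathbb C}$. Let $\mathcal M_{\mathbb R}\subseteq\mathcal M$ be the locus of points that are split over $\mathbb R$, i.e. whose Deligne bigrading $V_{\mathbb C}=\bigoplus I^{p,q}$ satisfies $\overline{I^{p,q}}=I^{q,p}$. For $F\in\mathcal M$, the mixed Hodge metric $h_F$ is the hermitian inner product on $V_{\mathbb C}$ for which the $I^{p,q}$ are mutually orthogonal and $h_F(u,v)=i^{p-q}\langle u,\bar v\rangle_{p+q}$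 for $u,v\in I^{p,q}$. It induces the norm $\|\alpha\|=\mathrm{Tr}(\alpha\alpha^*)^{1/2}$ on $\mathrm{End}(V_{\mathbb C})$. An endomorphism has type $(p,q)$ if it maps each $I^{a,b}$ to $I^{a+p,b+q}$. Let $\delta=\delta(F,W)$ be the unique real element of $\Lambda^{-1,-1}=\bigoplus_{r,s<0}\mathrm{End}(V_{\mathbb C})^{r,s}$ for which $(e^{-i\delta}.F,W)$ is split over $\mathbb R$. Let $\zeta$ be the real element given by the universal Lie polynomials of Cattani, Kaplan and Schmid in the Hodge components of $\delta$ with respect to $(e^{-i\delta}.F,W)$. Explicitly, $\zeta$ is determined by the relation $e^{i\delta}=e^{\zeta}\sum_{k\ge 0}P_k$ with real $\zeta,\eta\in\Lambda^{-1,-1}$, where $P_0=1$, $P_k=-\frac1k\sum_{j=1}^kP_{k-j}C_{j+1}$, $C_{l+1}=i\sum_{p,q\ge1}b^{l-1}_{p-1,q-1}\eta^{-p,-q}$ and $(1-x)^p(1+x)^q=\sum_l b^l_{p,q}x^l$. Let $\epsilon\in\Lambda^{-1,-1}$ be defined by $e^{\epsilon}=e^{i\delta}e^{-\zeta}$, so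 that $(e^{-\epsilon}.F,W)$ is the $SL_2$-splitting of $(F,W)$, and set $$\tau(F)=1+\sum_{p,q<0}\|\epsilon^{p,q}\|^{-\frac{2}{p+q}},$$ with Hodge components and norm taken with respect to $(F,W)$. The twisted metric is obtained from the metric $\mathrm{Tr}(\alpha\beta^*)$ on $T_F\mathcal M\cong\bigoplus_{p<0,\,p+q\le 0}\mathfrak g_{\mathbb C}^{p,q}$ by rescaling the norm on type $(p,q)$ by $\tau(F)^{(p+q)/2}$, the types remaining orthogonal. Let $d_\tau$ be its Riemannian distance. A subset $U\subseteq\mathcal M$ is geodesically convex if any two of its points are joined by a unique shortest geodesic in $\mathcal M$ for the twisted metric, and this geodesic lies in $U$. Let $r\ge1$, let $H_1,\dots,H_r\in\mathfrak g_{\mathbb R}$ be the semisimple elements of commuting representations of $sl_2(\mathbb R)$ on $V$, let $Y_0$ be a real grading of $W$ that commutes with $H_1,\dots,H_r$, and let $t(y)=y_1^{-Y_0/2}\prod_{j=1}^r y_j^{-H_j/2}$ for $y\in(0,\infty)^r$, with inverse $t^{-1}(y)$. Theorem. Let $C\subset\mathcal M$ be a compact set with $C\cap\mathcal M_{\mathbb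 R}=\emptyset$. Then there is a constant $K$ such that $$d_\tau(F_1,F_2)\le K\,d_\tau\big(t^{-1}(y).F_1,\;t^{-1}(y).F_2\big)$$ for all $y\in(0,\infty)^r$ and all $F_1,F_2\in\mathcal M$ for which $t^{-1}(y).F_1$ and $t^{-1}(y).F_2$ are contained in a geodesically convex set $U\subseteq C$. In particular, if $t^{-1}(y).F_1$ and $t^{-1}(y).F_2$ lie in such a set $U$ for all sufficiently large $y_1,\dots,y_r$, then the inequality holds with the same $K$ for all sufficiently large $y_1,\dots,y_r$. -/

import Mathlib

open scoped NNReal ENNReal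

noncomputable section

namespace MixedHodge

/-- The discrete data of a classifying space of graded-polarized mixed Hodge structures.
`E` is the complexification of a real vector space, given through its complex conjugation `conj`
(the real vector space is the set of fixed points).  `W` is the (complexified) weight filtration.
The bilinear form on `Gr^W_w = W w / W (w - 1)` is written as a bilinear form `S w` of which only
the restriction to `W w` is used: that restriction has radical exactly `W (w - 1)`, that is, it is a
nondegenerate form on `Gr^W_w`.  `h p q` are the Hodge numbers of `Gr^W_{p+q}`. -/
structure Datum (E : Type*) [NormedAddCommGroup E] [NormedSpace ℂ E] where
  conj : E →ₛₗ[starRingEnd ℂ] E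
  conj_conj : ∀ v, conj (conj v) = v
  W : ℤ → Submodule ℂ E
  W_mono : Monotone W
  W_bot : ∃ k, W k = ⊥
  W_top : ∃ k, W k = ⊤
  W_real : ∀ k, ∀ v ∈ W k, conj v ∈ W k
  S : ℤ → E →ₗ[ℂ] E →ₗ[ℂ] ℂ
  S_symm : ∀ w, ∀ u ∈ W w, ∀ v ∈ W w, S w u v = (-1 : ℂ) ^ w * S w v u
  S_real : ∀ w, ∀ u ∈ W w, ∀ v ∈ W w, S w (conj u) (conj v) = starRingEnd ℂ (S w u v)
  S_nondeg : ∀ w, ∀ u ∈ W w, (∀ v ∈ W w, S w u v = 0) ↔ u ∈ W (w - 1)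
  h : ℤ → ℤ → ℕ
  h_symm : ∀ p q, h p q = h q p
  h_finite : ∀ w, (Function.support fun p => h p (w - p)).Finite
  h_dim : ∀ w, Module.finrank ℂ (W w) = Module.finrank ℂ (W (w - 1)) + ∑ᶠ p, h p (w - p)

variable {E : Type*} [NormedAddCommGroup E] [NormedSpace ℂ E]

/-- The action of endomorphisms of `E` on filtrations of `E`. -/
def act (g : E →L[ℂ] E) (F : ℤ → Submodule ℂ E) : ℤ → Submodule ℂ E :=
  fun p => (F p).map (g : E →ₗ[ℂ] E)

/-- The real power `y ^ X = exp (log y • X)` of a positive number, for an endomorphism `X`. -/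
def powEnd (y : ℝ) (X : E →L[ℂ] E) : E →L[ℂ] E :=
  NormedSpace.exp ((Real.log y : ℂ) • X)

/-- The adjoint of `b` with respect to a form `h` on `E`. It exists and is unique if `h` is a
hermitian inner product and `E` is finite-dimensional. -/
def adjointWrt (h : E → E → ℂ) (b : E →L[ℂ] E) : E →L[ℂ] E :=
  Classical.epsilon fun b' : E →L[ℂ] E => ∀ u v, h (b u) v = h u (b' v)

namespace Datum

variable (D : Datum E)

/-- An endomorphism is real if it commutes with complex conjugation. -/
def IsReal (X : E →L[ℂ] E) : Prop := ∀ v, X (D.conj v) = D.conj (X v)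

/-- The complex conjugate of a subspace (`conj` is an involution). -/
def conjSub (P : Submodule ℂ E) : Submodule ℂ E := P.comap D.conj

/-- The group `G_ℂ` of automorphisms of `E` that preserve `W` and act on each `Gr^W_w` as an
isometry. -/
def GC : Set (E →L[ℂ] E) :=
  {g | IsUnit g ∧ (∀ k, (D.W k).map (g : E →ₗ[ℂ] E) = D.W k) ∧
    ∀ w, ∀ u ∈ D.W w, ∀ v ∈ D.W w, D.S w (g u) (g v) = D.S w u v}

/-- The real Lie algebra `𝔤_ℝ` of `G_ℝ`. -/
def gR : Set (E →L[ℂ] E) :=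
  {X | D.IsReal X ∧ (∀ k, ∀ v ∈ D.W k, X v ∈ D.W k) ∧
    ∀ w, ∀ u ∈ D.W w, ∀ v ∈ D.W w, D.S w (X u) v + D.S w u (X v) = 0}

/-- The preimage in `W w` of `F^p Gr^W_w`. -/
def grFil (F : ℤ → Submodule ℂ E) (w p : ℤ) : Submodule ℂ E := (F p ⊓ D.W w) ⊔ D.W (w - 1)

/-- The preimage in `W (p + q)` of the Hodge component `H^{p,q}` of `Gr^W_{p+q}`. -/
def grHodge (F : ℤ → Submodule ℂ E) (p q : ℤ) : Submodule ℂ E :=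
  D.grFil F (p + q) p ⊓ D.conjSub (D.grFil F (p + q) q)

/-- `(F, W)` is a mixed Hodge structure such that every `(Gr^W_w, F Gr^W_w, S w)` is a polarized
Hodge structure of weight `w` with the given Hodge numbers. -/
structure IsGradedPolarizedMHS (F : ℤ → Submodule ℂ E) : Prop where
  anti : Antitone F
  eq_top : ∃ p, F p = ⊤
  eq_bot : ∃ p, F p = ⊥
  sup_eq : ∀ w p, D.grFil F w p ⊔ D.conjSub (D.grFil F w (w - p + 1)) = D.W w
  inf_eq : ∀ w p, D.grFil F w p ⊓ D.conjSub (D.grFil F w (w - p + 1)) = D.W (w - 1)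
  orth : ∀ w p q, w < p + q → ∀ u ∈ D.grFil F w p, ∀ v ∈ D.grFil F w q, D.S w u v = 0
  pos : ∀ p q, ∀ u ∈ D.grHodge F p q, u ∉ D.W (p + q - 1) →
    0 < (Complex.I ^ (p - q) * D.S (p + q) u (D.conj u)).re
  hodge_number : ∀ p q,
    Module.finrank ℂ (D.grHodge F p q) = Module.finrank ℂ (D.W (p + q - 1)) + D.h p q

/-- The classifying space `𝓜`. -/
@[ext]
structure ClassifyingSpace where
  fil : ℤ → Submodule ℂ E
  prop : D.IsGradedPolarizedMHS fil

/-- The orbit map of a point `F ∈ 𝓜`, on the set of those `g ∈ G_ℂ` for which `g.F ∈ 𝓜`. -/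
def orbitMap (F : D.ClassifyingSpace) :
    {g : E →L[ℂ] E // g ∈ D.GC ∧ D.IsGradedPolarizedMHS (act g F.fil)} → D.ClassifyingSpace :=
  fun g => ⟨act g.1 F.fil, g.2.2⟩

/-- The topology of `𝓜` as an open subset of a homogeneous space of `G_ℂ`: a set is open if and only
if its preimages under the orbit maps are. -/
instance : TopologicalSpace D.ClassifyingSpace :=
  ⨆ F : D.ClassifyingSpace, TopologicalSpace.coinduced (D.orbitMap F) inferInstance

/-! ### The Deligne bigrading -/

/-- The Deligne bigrading `I^{p,q}` of `(F, W)`: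
`I^{p,q} = F^p ∩ W_{p+q} ∩ (conj F^q ∩ W_{p+q} + ∑_{j ≥ 1} conj F^{q-j} ∩ W_{p+q-j-1})`. -/
def bigr (F : ℤ → Submodule ℂ E) (p q : ℤ) : Submodule ℂ E :=
  F p ⊓ D.W (p + q) ⊓
    ((D.conjSub (F q) ⊓ D.W (p + q)) ⊔
      ⨆ j : ℕ, D.conjSub (F (q - (j + 1))) ⊓ D.W (p + q - (j + 1) - 1))

/-- `(F, W)` is split over `ℝ`. -/
def IsSplit (F : ℤ → Submodule ℂ E) : Prop := ∀ p q, D.bigr F p q = D.conjSub (D.bigr F q p)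

/-- The locus `𝓜_ℝ` of split mixed Hodge structures. -/
def splitLocus : Set D.ClassifyingSpace := {F | D.IsSplit F.fil}

/-- `Λ^{-1,-1} = ⨁_{r, s < 0} gl(E)^{r,s}`: the endomorphisms that map each `I^{p,q}` into the sum
of all `I^{a,b}` with `a < p` and `b < q`.  They act as zero on `Gr^W`, so they lie in the Lie algebra
of `G_ℂ`. -/
def Lam (F : ℤ → Submodule ℂ E) : Set (E →L[ℂ] E) :=
  {X | ∀ p q, ∀ v ∈ D.bigr F p q, X v ∈ ⨆ (a : ℤ) (b : ℤ) (_ : a < p ∧ b < q), D.bigr F a b}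

variable [FiniteDimensional ℂ E]

open Classical in
/-- The projection of `E = ⨁ I^{a,b}` onto `I^{p,q}` (zero if this is not a direct sum). -/
def proj (F : ℤ → Submodule ℂ E) (p q : ℤ) : E →L[ℂ] E :=
  if hc : IsCompl (D.bigr F p q)
      (⨆ (a : ℤ) (b : ℤ) (_ : (a, b) ≠ (p, q)), D.bigr F a b) then
    LinearMap.toContinuousLinearMap (Submodule.projection _ _ hc)
  else 0

/-- The component `X^{p,q}` of an endomorphism `X`, the sum of the parts of `X` that map `I^{a,b}`
to `I^{a+p,b+q}`. -/
def comp (F : ℤ → Submodule ℂ E) (X : E →L[ℂ] E) (p q : ℤ) : E →L[ℂ] E :=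
  ∑ᶠ x : ℤ × ℤ, D.proj F (x.1 + p) (x.2 + q) * X * D.proj F x.1 x.2

/-! ### The mixed Hodge metric and the induced metric on endomorphisms -/

/-- The hermitian form on `E` for which the `I^{p,q}` are orthogonal and which on `I^{p,q}` is
`s ^ (p + q)` times `i ^ (p - q) S_{p+q}(u, conj v)`, so that the norm on `I^{p,q}` is scaled by
`s ^ ((p + q) / 2)`. For `s = 1` this is the mixed Hodge metric. -/
def hodgeForm (s : ℝ) (F : ℤ → Submodule ℂ E) (u v : E) : ℂ :=
  ∑ᶠ x : ℤ × ℤ, ((s : ℂ) ^ (x.1 + x.2)) *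
    (Complex.I ^ (x.1 - x.2) *
      D.S (x.1 + x.2) (D.proj F x.1 x.2 u) (D.conj (D.proj F x.1 x.2 v)))

/-- The induced form `Tr (α β*)` on endomorphisms. -/
def endForm (s : ℝ) (F : ℤ → Submodule ℂ E) (α β : E →L[ℂ] E) : ℂ :=
  LinearMap.trace ℂ E ((α * adjointWrt (D.hodgeForm s F) β : E →L[ℂ] E) : E →ₗ[ℂ] E)

/-- The norm on endomorphisms for the scaled metric; `s = 1` is the standard metric. -/
def endNorm (s : ℝ) (F : ℤ → Submodule ℂ E) (α : E →L[ℂ] E) : ℝ :=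
  Real.sqrt (D.endForm s F α α).re

/-! ### Deligne's `δ`, the elements `ζ`, `ε` of the `SL₂`-splitting, and the twisting function -/

/-- `δ` is Deligne's element of `(F, W)`: the real element of `Λ^{-1,-1}` for which
`(e^{-iδ}.F, W)` is split over `ℝ`. -/
def IsDelta (F : ℤ → Submodule ℂ E) (δ : E →L[ℂ] E) : Prop :=
  δ ∈ D.Lam F ∧ D.IsReal δ ∧ D.IsSplit (act (NormedSpace.exp (-(Complex.I • δ))) F)

/-- `slC F η l` is `C_{l+2} = i ∑_{p, q ≥ 1} b^l_{p-1,q-1} η^{-p,-q}`, where the integers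
`b^l_{m,n}` are defined by `(1 - x)^m (1 + x)^n = ∑_l b^l_{m,n} x^l`. -/
def slC (F : ℤ → Submodule ℂ E) (η : E →L[ℂ] E) (l : ℕ) : E →L[ℂ] E :=
  Complex.I • ∑ᶠ x : ℕ × ℕ,
    (((1 - Polynomial.X) ^ x.1 * (1 + Polynomial.X) ^ x.2 : Polynomial ℤ).coeff l : ℂ) •
      D.comp F η (-((x.1 : ℤ) + 1)) (-((x.2 : ℤ) + 1))

/-- The noncommutative polynomials `P_0 = 1`, `P_k = -(1/k) ∑_{j=1}^{k} P_{k-j} C_{j+1}`. -/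
def slP (F : ℤ → Submodule ℂ E) (η : E →L[ℂ] E) : ℕ → (E →L[ℂ] E)
  | 0 => 1
  | k + 1 => (-(1 / ((k : ℂ) + 1))) •
      ∑ j : Fin (k + 1), slP F η (k - (j : ℕ)) * D.slC F η (j : ℕ)
  termination_by k => k
  decreasing_by omega

/-- `ζ` is attached to `(F, W)` with Deligne element `δ` by the universal Lie polynomials of
Cattani, Kaplan and Schmid in the Hodge components of `δ` with respect to the split mixed Hodge
structure `(e^{-iδ}.F, W)`.  These are the solution in real `ζ, η ∈ Λ^{-1,-1}` of
`e^{iδ} = e^ζ (1 + ∑_{k ≥ 1} P_k(C_2, …, C_{k+1}))`. -/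
def IsZeta (F : ℤ → Submodule ℂ E) (δ ζ : E →L[ℂ] E) : Prop :=
  ζ ∈ D.Lam F ∧ D.IsReal ζ ∧ ∃ η ∈ D.Lam F, D.IsReal η ∧
    NormedSpace.exp (Complex.I • δ) = NormedSpace.exp ζ *
      ∑ᶠ k : ℕ, D.slP (act (NormedSpace.exp (-(Complex.I • δ))) F) η k

/-- `ε` is the element of `Λ^{-1,-1}` with `e^ε = e^{iδ} e^{-ζ}`. -/
def IsEps (F : ℤ → Submodule ℂ E) (ε : E →L[ℂ] E) : Prop :=
  ε ∈ D.Lam F ∧ ∃ δ ζ, D.IsDelta F δ ∧ D.IsZeta F δ ζ ∧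
    NormedSpace.exp ε = NormedSpace.exp (Complex.I • δ) * NormedSpace.exp (-ζ)

/-- The element `ε(F, W)`; it exists and is unique for every mixed Hodge structure. -/
def eps (F : ℤ → Submodule ℂ E) : E →L[ℂ] E := Classical.epsilon (D.IsEps F)

/-- The twisting function `τ(F) = 1 + ∑_{p, q < 0} ‖ε^{p,q}‖ ^ (-2 / (p + q))`. -/
def tau (F : ℤ → Submodule ℂ E) : ℝ :=
  1 + ∑ᶠ (x : ℤ × ℤ) (_ : x.1 < 0 ∧ x.2 < 0),
    D.endNorm 1 F (D.comp F (D.eps F) x.1 x.2) ^ (-2 / ((x.1 : ℝ) + (x.2 : ℝ)))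

/-! ### The twisted metric on the classifying space, its distance and its geodesics -/

/-- The projection of `𝔤_ℂ` onto `q_F = ⨁_{p < 0, p + q ≤ 0} 𝔤^{p,q} ≅ T_F 𝓜`, with kernel the Lie
algebra of the stabilizer of `F`. -/
def qPart (F : ℤ → Submodule ℂ E) (α : E →L[ℂ] E) : E →L[ℂ] E :=
  ∑ᶠ (x : ℤ × ℤ) (_ : x.1 < 0 ∧ x.1 + x.2 ≤ 0), D.comp F α x.1 x.2

/-- The twisted norm of the tangent vector `d/dt e^{tα}.F |_{t = 0}` of `𝓜` at `F`. -/
def twistedNorm (F : ℤ → Submodule ℂ E) (α : E →L[ℂ] E) : ℝ :=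
  D.endNorm (D.tau F) F (D.qPart F α)

/-- `γ` is a `C¹` curve on `[0, 1]` in `𝓜`, with `C¹` lift `g` to `G_ℂ`, that is,
`γ t = g t . γ 0`. -/
def IsLift (γ : ℝ → D.ClassifyingSpace) (g : ℝ → E →L[ℂ] E) : Prop :=
  ContDiffOn ℝ 1 g (Set.Icc 0 1) ∧
    ∀ t ∈ Set.Icc (0 : ℝ) 1, g t ∈ D.GC ∧ (γ t).fil = act (g t) (γ 0).fil

/-- The speed of `γ` at time `t` for the twisted metric, computed from a lift `g` of `γ`: the velocity
is the tangent vector represented by `g'(t) g(t)⁻¹ ∈ 𝔤_ℂ`. -/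
def speed (γ : ℝ → D.ClassifyingSpace) (g : ℝ → E →L[ℂ] E) (t : ℝ) : ℝ≥0∞ :=
  ENNReal.ofReal
    (D.twistedNorm (γ t).fil (derivWithin g (Set.Icc 0 1) t * Ring.inverse (g t)))

/-- The Riemannian distance `d_τ` of the twisted metric: the infimum of the lengths of the `C¹` curves
in `𝓜` between two points (infinite if there are none). -/
def twistedDist (P Q : D.ClassifyingSpace) : ℝ≥0∞ :=
  ⨅ (γ : ℝ → D.ClassifyingSpace) (g : ℝ → E →L[ℂ] E)
    (_ : D.IsLift γ g ∧ γ 0 = P ∧ γ 1 = Q), ∫⁻ t in Set.Icc (0 : ℝ) 1, D.speed γ g t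

/-- `γ` is a shortest geodesic from `P` to `Q` in `𝓜`, parametrized on `[0, 1]` proportionally to arc
length: a `C¹` curve with constant speed `d_τ(P, Q)`. -/
def IsShortestGeodesic (γ : ℝ → D.ClassifyingSpace) (P Q : D.ClassifyingSpace) : Prop :=
  γ 0 = P ∧ γ 1 = Q ∧
    ∃ g, D.IsLift γ g ∧ ∀ t ∈ Set.Icc (0 : ℝ) 1, D.speed γ g t = D.twistedDist P Q

/-- `U` is geodesically convex: any two of its points are joined by a unique shortest geodesic in `𝓜`,
and this geodesic lies in `U`. -/
def GeodesicallyConvex (U : Set D.ClassifyingSpace) : Prop :=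
  ∀ P ∈ U, ∀ Q ∈ U, ∃ γ : ℝ → D.ClassifyingSpace, D.IsShortestGeodesic γ P Q ∧
    (∀ t ∈ Set.Icc (0 : ℝ) 1, γ t ∈ U) ∧
    ∀ γ', D.IsShortestGeodesic γ' P Q → Set.EqOn γ' γ (Set.Icc 0 1)

/-! ### The family of automorphisms `t(y)` -/

/-- `Y` is a grading of `W` defined over `ℝ`: a real semisimple endomorphism such that `W k` is the
direct sum of `W (k - 1)` and the `k`-eigenspace of `Y`. -/
structure IsRealGrading (Y : E →L[ℂ] E) : Prop where
  real : D.IsReal Y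
  semisimple : Module.End.IsSemisimple (Y : E →ₗ[ℂ] E)
  sup_eq : ∀ k : ℤ,
    D.W (k - 1) ⊔ Module.End.eigenspace (Y : E →ₗ[ℂ] E) (k : ℂ) = D.W k
  inf_eq : ∀ k : ℤ,
    D.W (k - 1) ⊓ Module.End.eigenspace (Y : E →ₗ[ℂ] E) (k : ℂ) = ⊥

/-- Semisimple elements `H_1, …, H_r ∈ 𝔤_ℝ` of commuting representations of `sl₂(ℝ)`, given by the
triples `(N_j, H_j, N_j⁺)`, with a real grading `Y_0` of `W` that commutes with them. -/
structure TwistDatum (r : ℕ) where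
  N : Fin r → E →L[ℂ] E
  H : Fin r → E →L[ℂ] E
  Np : Fin r → E →L[ℂ] E
  Y₀ : E →L[ℂ] E
  N_real : ∀ j, D.IsReal (N j)
  Np_real : ∀ j, D.IsReal (Np j)
  H_mem : ∀ j, H j ∈ D.gR
  lie_H_N : ∀ j, H j * N j - N j * H j = -((2 : ℂ) • N j)
  lie_H_Np : ∀ j, H j * Np j - Np j * H j = (2 : ℂ) • Np j
  lie_Np_N : ∀ j, Np j * N j - N j * Np j = H j
  comm_N : ∀ i j, i ≠ j → Commute (N i) (N j)
  comm_Np : ∀ i j, i ≠ j → Commute (Np i) (Np j)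
  comm_N_Np : ∀ i j, i ≠ j → Commute (N i) (Np j)
  grading : D.IsRealGrading Y₀
  comm_Y₀ : ∀ j, Commute Y₀ (H j)

/-- `t(y) = y_1^{-Y_0/2} ∏_j y_j^{-H_j/2}`. -/
def TwistDatum.t {D : Datum E} {r : ℕ} [NeZero r] (T : D.TwistDatum r) (y : Fin r → ℝ) :
    E →L[ℂ] E :=
  powEnd (y 0) (-((1 / 2 : ℂ) • T.Y₀)) *
    (List.ofFn fun j => powEnd (y j) (-((1 / 2 : ℂ) • T.H j))).prod

end Datum

end MixedHodge

end

/-!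
The element `t(y)` is real, preserves `W` and multiplies the form on `Gr^W_w` by `y₁^{-w}`: it is a
similitude. Everything attached to `F` (bigrading, `δ`, `ζ`, `ε`) is equivariant under a real
similitude `t` with multiplier `c`, except that `t` rescales the Hodge metric, by `c^{p+q}` on
`I^{p,q}`. As `‖ε^{p,q}‖` enters `τ` with exponent `-2/(p+q)`, the rescaling amounts to
`c τ(t.F) = c + (τ(F) - 1)`, and the twisted norm at `t.F` becomes the norm at `F` with the factor
`τ(F)` replaced by `c + (τ(F) - 1)`. Only non-positive powers of `τ` occur on `T_F M`, so where
`τ - 1 ≥ c₀` the norm grows by a factor at most `(1 + 1/c₀)^M`, uniformly in `c`, with `M` depending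
only on the length of `W`. Integrating along the geodesic from `t⁻¹.F₁` to `t⁻¹.F₂`, which stays in
`C`, gives the estimate.

It remains to bound `τ - 1` below on `C`. If `τ(Fₙ) → 1` along a convergent sequence `Fₙ → F`, then
all Hodge components of `ε(Fₙ)` tend to `0`, as the Hodge metrics stay uniformly nondegenerate, so
`e^{-ε(Fₙ)}.Fₙ → F`. The left side is split over `ℝ`, a condition which is closed because the
bigrading depends continuously on the filtration, so `F` is split.
-/

noncomputable section

namespace MixedHodge

/-! ### Gradings by orthogonal idempotents -/

section Idempotents

variable {𝕜 ι κ A B : Type*} [CommRing 𝕜] [Ring A] [Algebra 𝕜 A] [Ring B] [Algebra 𝕜 B]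

/-- A family of orthogonal idempotents, all but finitely many of them zero, with sum `1`: the
projections of a finite direct sum decomposition indexed by `ι`. -/
structure IsGradingFamily (π : ι → A) : Prop extends OrthogonalIdempotents π where
  finite_support : (Function.support π).Finite
  finsum_eq_one : ∑ᶠ x, π x = 1

/-- The operation on elements of `A` that multiplies the block `π x * X * π y` by `m (x - y)`. The
Hodge components of an endomorphism, and linear combinations of them, are of this form. -/
def multiplier [Sub ι] (π : ι → A) (m : ι → 𝕜) (X : A) : A :=
  ∑ᶠ z : ι × ι, m (z.1 - z.2) • (π z.1 * X * π z.2)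

variable (𝕜) in
/-- The elements all of whose blocks lower both indices by at least `n`. For the projections of a
Deligne bigrading this is `Λ^{-n,-n}`; these spaces form a finite multiplicative filtration. -/
def lowering (π : ℤ × ℤ → A) (n : ℕ) : Submodule 𝕜 A where
  carrier := {X | ∀ x y : ℤ × ℤ, ¬ (x.1 + n ≤ y.1 ∧ x.2 + n ≤ y.2) → π x * X * π y = 0}
  add_mem' hX hY x y h := by rw [mul_add, add_mul, hX x y h, hY x y h, add_zero]
  zero_mem' x y _ := by rw [mul_zero, zero_mul]
  smul_mem' c X hX x y h := by rw [mul_smul_comm, smul_mul_assoc, hX x y h, smul_zero]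

theorem mem_lowering {π : ℤ × ℤ → A} {n : ℕ} {X : A} : X ∈ lowering 𝕜 π n ↔
    ∀ x y : ℤ × ℤ, ¬ (x.1 + n ≤ y.1 ∧ x.2 + n ≤ y.2) → π x * X * π y = 0 := Iff.rfl

theorem mem_lowering_one {π : ℤ × ℤ → A} {X : A} : X ∈ lowering 𝕜 π 1 ↔
    ∀ x y : ℤ × ℤ, ¬ (x.1 < y.1 ∧ x.2 < y.2) → π x * X * π y = 0 := Iff.rfl

theorem lowering_antitone (π : ℤ × ℤ → A) : Antitone (lowering 𝕜 π) :=
  fun _ _ hmn _ hX x y h => hX x y fun h' => h (by omega)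

theorem lowering_comp_swap (π : ℤ × ℤ → A) (n : ℕ) :
    lowering 𝕜 (fun x => π x.swap) n = lowering 𝕜 π n := by
  ext X
  exact ⟨fun h x y hxy => h x.swap y.swap fun h' => hxy h'.symm,
    fun h x y hxy => h x.swap y.swap fun h' => hxy h'.symm⟩

theorem map_mem_lowering_iff {π : ℤ × ℤ → A} {f : A →+* B} (hf : Function.Injective f) {n : ℕ}
    {X : A} : f X ∈ lowering 𝕜 (fun x => f (π x)) n ↔ X ∈ lowering 𝕜 π n := by
  simp only [mem_lowering, ← map_mul, map_eq_zero_iff f hf]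

theorem conj_mem_lowering_conj_iff {π : ℤ × ℤ → A} (u : Aˣ) {n : ℕ} {X : A} :
    ↑u * X * ↑u⁻¹ ∈ lowering 𝕜 (fun x => ↑u * π x * ↑u⁻¹) n ↔ X ∈ lowering 𝕜 π n :=
  map_mem_lowering_iff (f := MulSemiringAction.toRingHom (ConjAct Aˣ) A (ConjAct.toConjAct u))
    (MulAction.injective (ConjAct.toConjAct u))

namespace IsGradingFamily

section Index

variable {π : ι → A} (hπ : IsGradingFamily π)
include hπ

theorem sum_toFinset_eq_one : ∑ x ∈ hπ.finite_support.toFinset, π x = 1 := by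
  rw [← hπ.finsum_eq_one, finsum_eq_sum _ hπ.finite_support]

theorem map (f : A →+* B) : IsGradingFamily fun x => f (π x) where
  toOrthogonalIdempotents := hπ.toOrthogonalIdempotents.map f
  finite_support := hπ.finite_support.subset (Function.support_comp_subset f.map_zero π)
  finsum_eq_one := by
    rw [← f.map_one, ← hπ.finsum_eq_one]
    exact (f.toAddMonoidHom.map_finsum hπ.finite_support).symm

theorem comp_equiv (e : κ ≃ ι) : IsGradingFamily fun x => π (e x) where
  toOrthogonalIdempotents := (OrthogonalIdempotents.equiv e).2 hπ.toOrthogonalIdempotents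
  finite_support := hπ.finite_support.preimage e.injective.injOn
  finsum_eq_one := (finsum_comp_equiv e).trans hπ.finsum_eq_one

theorem ext_left {X Y : A} (h : ∀ x, π x * X = π x * Y) : X = Y := by
  rw [← one_mul X, ← one_mul Y, ← hπ.sum_toFinset_eq_one, Finset.sum_mul, Finset.sum_mul]
  exact Finset.sum_congr rfl fun x _ => h x

theorem ext_right {X Y : A} (h : ∀ x, X * π x = Y * π x) : X = Y := by
  rw [← mul_one X, ← mul_one Y, ← hπ.sum_toFinset_eq_one, Finset.mul_sum, Finset.mul_sum]
  exact Finset.sum_congr rfl fun x _ => h x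

theorem ext_blocks {X Y : A} (h : ∀ x y, π x * X * π y = π x * Y * π y) : X = Y :=
  hπ.ext_left fun x => hπ.ext_right fun y => h x y

theorem block_mul (X Y : A) (x y : ι) : π x * (X * Y) * π y =
    ∑ z ∈ hπ.finite_support.toFinset, (π x * X * π z) * (π z * Y * π y) := by
  have hz : ∀ z, (π x * X * π z) * (π z * Y * π y) = π x * X * π z * (Y * π y) := fun z => by
    rw [mul_assoc (π z), ← mul_assoc _ (π z), mul_assoc _ (π z) (π z), (hπ.idem z).eq]
  simp only [hz]
  rw [← Finset.sum_mul, ← Finset.mul_sum, hπ.sum_toFinset_eq_one, mul_one]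
  simp only [mul_assoc]

theorem block_block [DecidableEq ι] (X : A) (x y a b : ι) :
    π x * (π a * X * π b) * π y = if x = a ∧ y = b then π x * X * π y else 0 := by
  rw [show π x * (π a * X * π b) * π y = (π x * π a) * X * (π b * π y) by noncomm_ring,
    hπ.mul_eq, hπ.mul_eq, ite_and]
  split_ifs <;> simp_all

end Index

section Multiplier

variable [AddGroup ι] {π : ι → A} (hπ : IsGradingFamily π)
include hπ

theorem multiplier_eq_sum (m : ι → 𝕜) (X : A) : multiplier π m X =
    ∑ z ∈ hπ.finite_support.toFinset ×ˢ hπ.finite_support.toFinset,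
      m (z.1 - z.2) • (π z.1 * X * π z.2) := by
  refine finsum_eq_sum_of_support_subset _ fun z hz => ?_
  simp only [Finset.coe_product, Set.Finite.coe_toFinset]
  refine ⟨fun h => hz ?_, fun h => hz ?_⟩ <;> simp [h]

theorem block_multiplier (m : ι → 𝕜) (X : A) (x y : ι) :
    π x * multiplier π m X * π y = m (x - y) • (π x * X * π y) := by
  classical
  rw [hπ.multiplier_eq_sum, Finset.mul_sum, Finset.sum_mul, Finset.sum_eq_single (x, y)]
  · rw [mul_smul_comm, smul_mul_assoc, hπ.block_block, if_pos ⟨rfl, rfl⟩]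
  · intro z _ hz
    rw [mul_smul_comm, smul_mul_assoc, hπ.block_block, if_neg, smul_zero]
    exact fun h => hz (Prod.ext h.1.symm h.2.symm)
  · intro h
    rw [Finset.mem_product, not_and_or] at h
    rcases h with h | h <;> simp only [Set.Finite.mem_toFinset, Function.notMem_support] at h <;>
      simp [h]

theorem eq_multiplier {m : ι → 𝕜} {X Y : A}
    (h : ∀ x y, π x * Y * π y = m (x - y) • (π x * X * π y)) : Y = multiplier π m X :=
  hπ.ext_blocks fun x y => by rw [h, hπ.block_multiplier]

theorem multiplier_one (X : A) : multiplier π (fun _ => (1 : 𝕜)) X = X :=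
  (hπ.eq_multiplier fun x y => by rw [one_smul]).symm

theorem multiplier_add (m : ι → 𝕜) (X Y : A) :
    multiplier π m (X + Y) = multiplier π m X + multiplier π m Y :=
  (hπ.eq_multiplier fun x y => by
    simp only [mul_add, add_mul, hπ.block_multiplier, smul_add]).symm

theorem multiplier_sub (m : ι → 𝕜) (X Y : A) :
    multiplier π m (X - Y) = multiplier π m X - multiplier π m Y :=
  (hπ.eq_multiplier fun x y => by
    simp only [mul_sub, sub_mul, hπ.block_multiplier, smul_sub]).symm

theorem multiplier_multiplier (m m' : ι → 𝕜) (X : A) :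
    multiplier π m (multiplier π m' X) = multiplier π (fun d => m d * m' d) X :=
  hπ.eq_multiplier fun x y => by rw [hπ.block_multiplier, hπ.block_multiplier, smul_smul]

theorem map_multiplier (f : A →+* B) {σ : 𝕜 → 𝕜} (hf : ∀ c X, f (c • X) = σ c • f X)
    (m : ι → 𝕜) (X : A) :
    f (multiplier π m X) = multiplier (fun x => f (π x)) (fun d => σ (m d)) (f X) :=
  (hπ.map f).eq_multiplier fun x y => by
    simp only [← map_mul, hπ.block_multiplier, hf]

theorem multiplier_conj (u : Aˣ) (m : ι → 𝕜) (X : A) :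
    multiplier (fun x => ↑u * π x * ↑u⁻¹) m (↑u * X * ↑u⁻¹) = ↑u * multiplier π m X * ↑u⁻¹ :=
  (hπ.map_multiplier (MulSemiringAction.toRingHom (ConjAct Aˣ) A (ConjAct.toConjAct u))
    (fun c X => smul_comm _ c X) m X).symm

variable [DecidableEq ι]

theorem finite_support_multiplier_single (X : A) :
    (Function.support fun d => multiplier π (Pi.single d (1 : 𝕜)) X).Finite := by
  refine ((hπ.finite_support.prod hπ.finite_support).image fun z => z.1 - z.2).subset
    fun d hd => ?_
  by_contra hne
  refine hd ((hπ.multiplier_eq_sum _ X).trans (Finset.sum_eq_zero fun z hz => ?_))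
  rw [Pi.single_eq_of_ne fun h => hne ⟨z, by simpa using hz, h⟩, zero_smul]

theorem finsum_smul_multiplier_single {f : κ → ι} (hf : Function.Injective f) (c : κ → 𝕜)
    (X : A) : ∑ᶠ i, c i • multiplier π (Pi.single (f i) (1 : 𝕜)) X =
      multiplier π (Function.extend f c 0) X := by
  have hfin : (Function.support fun i => c i • multiplier π (Pi.single (f i) (1 : 𝕜)) X).Finite :=
    ((hπ.finite_support_multiplier_single X).preimage hf.injOn).subset fun i hi h =>
      hi ((congrArg (c i • ·) h).trans (smul_zero _))
  refine hπ.eq_multiplier fun x y => ?_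
  have hentry : π x * (∑ᶠ i, c i • multiplier π (Pi.single (f i) (1 : 𝕜)) X) * π y =
      ∑ᶠ i, (c i * Pi.single (M := fun _ => 𝕜) (f i) 1 (x - y)) • (π x * X * π y) := by
    refine (((AddMonoidHom.mulRight (π y)).comp (AddMonoidHom.mulLeft (π x))).map_finsum
      hfin).trans (finsum_congr fun i => ?_)
    simp only [AddMonoidHom.coe_comp, Function.comp_apply, AddMonoidHom.coe_mulRight,
      AddMonoidHom.coe_mulLeft, mul_smul_comm, smul_mul_assoc, hπ.block_multiplier, smul_smul]
  rw [hentry]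
  by_cases hr : ∃ i, f i = x - y
  · obtain ⟨i, hi⟩ := hr
    rw [finsum_eq_single _ i, ← hi, hf.extend_apply, Pi.single_eq_same, mul_one]
    intro j hj
    rw [← hi, Pi.single_eq_of_ne fun h => hj (hf h).symm, mul_zero, zero_smul]
  · rw [Function.extend_apply' _ _ _ hr, Pi.zero_apply, zero_smul]
    refine finsum_eq_zero_of_forall_eq_zero fun i => ?_
    rw [Pi.single_eq_of_ne fun h => hr ⟨i, h.symm⟩, mul_zero, zero_smul]

end Multiplier

section Field

variable {𝕜 : Type*} [Field 𝕜] [Algebra 𝕜 A] [AddGroup ι] {π : ι → A}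

theorem multiplier_inv_multiplier (hπ : IsGradingFamily π) {m : ι → 𝕜} (hm : ∀ d, m d ≠ 0)
    (X : A) : multiplier π (fun d => (m d)⁻¹) (multiplier π m X) = X := by
  simp only [hπ.multiplier_multiplier, inv_mul_cancel₀ (hm _), hπ.multiplier_one]

theorem multiplier_eq_zero_iff (hπ : IsGradingFamily π) {m : ι → 𝕜} (hm : ∀ d, m d ≠ 0) {X : A} :
    multiplier π m X = 0 ↔ X = 0 := by
  refine ⟨fun h => ?_, fun h => (hπ.eq_multiplier fun x y => by simp [h]).symm⟩
  rw [← hπ.multiplier_inv_multiplier hm X, h]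
  exact (hπ.eq_multiplier fun x y => by simp).symm

end Field

section Lowering

variable {π : ℤ × ℤ → A} (hπ : IsGradingFamily π)
include hπ

theorem multiplier_mem_lowering (m : ℤ × ℤ → 𝕜) {n : ℕ} {X : A} (hX : X ∈ lowering 𝕜 π n) :
    multiplier π m X ∈ lowering 𝕜 π n :=
  fun x y h => by rw [hπ.block_multiplier, hX x y h, smul_zero]

theorem mul_mem_lowering {m n : ℕ} {X Y : A} (hX : X ∈ lowering 𝕜 π m)
    (hY : Y ∈ lowering 𝕜 π n) : X * Y ∈ lowering 𝕜 π (m + n) := by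
  intro x y h
  rw [hπ.block_mul]
  refine Finset.sum_eq_zero fun z _ => ?_
  by_cases hxz : x.1 + m ≤ z.1 ∧ x.2 + m ≤ z.2
  · rw [hY z y fun hzy => h ⟨by push_cast; omega, by push_cast; omega⟩, mul_zero]
  · rw [hX x z hxz, zero_mul]

theorem mul_mem_lowering_of_left {n : ℕ} {X Y : A} (hX : X ∈ lowering 𝕜 π 1)
    (hY : Y ∈ lowering 𝕜 π n) : X * Y ∈ lowering 𝕜 π n :=
  lowering_antitone π (Nat.le_add_left n 1) (hπ.mul_mem_lowering hX hY)

theorem mul_mem_lowering_of_right {n : ℕ} {X Y : A} (hX : X ∈ lowering 𝕜 π n)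
    (hY : Y ∈ lowering 𝕜 π 1) : X * Y ∈ lowering 𝕜 π n :=
  lowering_antitone π n.le_succ (hπ.mul_mem_lowering hX hY)

theorem exists_index_le_add : ∃ N : ℕ, ∀ x y, π x ≠ 0 → π y ≠ 0 →
    y.1 ≤ x.1 + N ∧ y.2 ≤ x.2 + N := by
  obtain ⟨a, ha⟩ := ((hπ.finite_support.prod hπ.finite_support).image
    fun z => z.2.1 - z.1.1).bddAbove
  obtain ⟨b, hb⟩ := ((hπ.finite_support.prod hπ.finite_support).image
    fun z => z.2.2 - z.1.2).bddAbove
  refine ⟨(max a b).toNat, fun x y hx hy => ?_⟩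
  have hxa : y.1 - x.1 ≤ a := ha ⟨(x, y), ⟨hx, hy⟩, rfl⟩
  have hxb : y.2 - x.2 ≤ b := hb ⟨(x, y), ⟨hx, hy⟩, rfl⟩
  omega

variable (𝕜) in
theorem exists_lowering_eq_bot : ∃ N, lowering 𝕜 π N = ⊥ := by
  obtain ⟨N, hN⟩ := hπ.exists_index_le_add
  refine ⟨N + 1, (Submodule.eq_bot_iff _).2 fun X hX => hπ.ext_blocks fun x y => ?_⟩
  rw [mul_zero, zero_mul]
  by_cases hx : π x = 0
  · rw [hx, zero_mul, zero_mul]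
  by_cases hy : π y = 0
  · rw [hy, mul_zero]
  refine hX x y fun h => ?_
  have hxy := (hN x y hx hy).1
  omega

theorem pow_succ_mem_lowering {X : A} (hX : X ∈ lowering 𝕜 π 1) (k : ℕ) :
    X ^ (k + 1) ∈ lowering 𝕜 π 1 := by
  induction k with
  | zero => rwa [zero_add, pow_one]
  | succ k ih => rw [pow_succ]; exact hπ.mul_mem_lowering_of_left ih hX

theorem pow_sub_pow_mem_lowering {n : ℕ} {X Y : A} (hX : X ∈ lowering 𝕜 π 1)
    (hY : Y ∈ lowering 𝕜 π 1) (h : X - Y ∈ lowering 𝕜 π n) (k : ℕ) :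
    X ^ (k + 2) - Y ^ (k + 2) ∈ lowering 𝕜 π (n + 1) := by
  have telescope (k : ℕ) : X ^ (k + 2) - Y ^ (k + 2) =
      X ^ (k + 1) * (X - Y) + (X ^ (k + 1) - Y ^ (k + 1)) * Y := by
    rw [pow_succ X (k + 1), pow_succ Y (k + 1)]
    noncomm_ring
  have step (k : ℕ) (hk : X ^ (k + 1) - Y ^ (k + 1) ∈ lowering 𝕜 π n) :
      X ^ (k + 2) - Y ^ (k + 2) ∈ lowering 𝕜 π (n + 1) := by
    rw [telescope, add_comm n 1]
    exact add_mem (hπ.mul_mem_lowering (hπ.pow_succ_mem_lowering hX k) h)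
      (add_comm n 1 ▸ hπ.mul_mem_lowering hk hY)
  refine step k ?_
  induction k with
  | zero => rwa [zero_add, pow_one, pow_one]
  | succ k ih => exact lowering_antitone π n.le_succ (step k ih)

theorem mul_sub_one_mem_lowering {u v : A} (hu : u - 1 ∈ lowering 𝕜 π 1)
    (hv : v - 1 ∈ lowering 𝕜 π 1) : u * v - 1 ∈ lowering 𝕜 π 1 := by
  rw [show u * v - 1 = (u - 1) * (v - 1) + (u - 1) + (v - 1) by noncomm_ring]
  exact add_mem (add_mem (hπ.mul_mem_lowering_of_left hu hv) hu) hv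

theorem conj_mem_lowering {u v X : A} {n : ℕ} (hu : u - 1 ∈ lowering 𝕜 π 1)
    (hv : v - 1 ∈ lowering 𝕜 π 1) (hX : X ∈ lowering 𝕜 π n) : u * X * v ∈ lowering 𝕜 π n := by
  have huX : u * X ∈ lowering 𝕜 π n := by
    rw [show u * X = (u - 1) * X + X by noncomm_ring]
    exact add_mem (hπ.mul_mem_lowering_of_left hu hX) hX
  rw [show u * X * v = u * X * (v - 1) + u * X by noncomm_ring]
  exact add_mem (hπ.mul_mem_lowering_of_right huX hv) huX

theorem lowering_conj {u : Aˣ} (hu : (u : A) - 1 ∈ lowering 𝕜 π 1)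
    (hu' : ((u⁻¹ : Aˣ) : A) - 1 ∈ lowering 𝕜 π 1) (n : ℕ) :
    lowering 𝕜 (fun x => ↑u * π x * ↑u⁻¹) n = lowering 𝕜 π n := by
  ext X
  rw [show X = ↑u * (↑u⁻¹ * X * ↑u) * ↑u⁻¹ by simp [mul_assoc], conj_mem_lowering_conj_iff]
  exact ⟨hπ.conj_mem_lowering hu hu', fun h => by
    simpa [mul_assoc] using hπ.conj_mem_lowering hu' hu h⟩

theorem eq_one_of_commute {u : A} (hu : u - 1 ∈ lowering 𝕜 π 1) (hc : ∀ x, Commute u (π x)) :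
    u = 1 := by
  refine sub_eq_zero.1 (hπ.ext_blocks fun x y => ?_)
  rw [mul_zero, zero_mul]
  obtain rfl | hne := eq_or_ne x y
  · exact mem_lowering_one.1 hu x x fun h => lt_irrefl _ h.1
  · rw [mul_assoc, sub_mul, (hc y).eq, one_mul, mul_sub, ← mul_assoc, hπ.ortho hne, zero_mul,
      sub_zero]

end Lowering

end IsGradingFamily

theorem existsUnique_fixedPoint_of_contracting {G : Type*} [AddGroup G] {L : ℕ → AddSubgroup G}
    {N : ℕ} (hN : L N = ⊥) {S : Set G} (hS : S.Nonempty)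
    (hS₀ : ∀ X ∈ S, ∀ Y ∈ S, X - Y ∈ L 0) {f : G → G} (hf : Set.MapsTo f S S)
    (hc : ∀ n, ∀ X ∈ S, ∀ Y ∈ S, X - Y ∈ L n → f X - f Y ∈ L (n + 1)) :
    ∃! X, X ∈ S ∧ f X = X := by
  have hdiff (n : ℕ) : ∀ X ∈ S, ∀ Y ∈ S, f^[n] X - f^[n] Y ∈ L n := by
    induction n with
    | zero => exact hS₀
    | succ n ih =>
      intro X hX Y hY
      rw [Function.iterate_succ_apply', Function.iterate_succ_apply']
      exact hc n _ (hf.iterate n hX) _ (hf.iterate n hY) (ih X hX Y hY)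
  have heq : ∀ X ∈ S, ∀ Y ∈ S, f^[N] X = f^[N] Y := fun X hX Y hY => by
    simpa only [hN, AddSubgroup.mem_bot, sub_eq_zero] using hdiff N X hX Y hY
  obtain ⟨Z, hZ⟩ := hS
  refine ⟨f^[N] Z, ⟨hf.iterate N hZ, ?_⟩, fun Y hY => ?_⟩
  · rw [← Function.iterate_succ_apply' f N Z, Function.iterate_succ_apply]
    exact heq _ (hf hZ) _ hZ
  · rw [heq Z hZ Y hY.1, Function.iterate_fixed hY.2]

theorem IsGradingFamily.existsUnique_fixedPoint {π : ℤ × ℤ → A} (hπ : IsGradingFamily π)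
    {S : Set A} (hS : S.Nonempty) (hS₁ : S ⊆ lowering 𝕜 π 1) {f : A → A} (hf : Set.MapsTo f S S)
    (hc : ∀ n, ∀ X ∈ S, ∀ Y ∈ S, X - Y ∈ lowering 𝕜 π n → f X - f Y ∈ lowering 𝕜 π (n + 1)) :
    ∃! X, X ∈ S ∧ f X = X := by
  obtain ⟨N, hN⟩ := hπ.exists_lowering_eq_bot 𝕜
  refine existsUnique_fixedPoint_of_contracting
    (L := fun n => (lowering 𝕜 π (n + 1)).toAddSubgroup) (N := N) ?_ hS
    (fun X hX Y hY => sub_mem (hS₁ hX) (hS₁ hY)) hf fun n => hc (n + 1)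
  have hbot : lowering 𝕜 π (N + 1) = ⊥ := le_bot_iff.1 (hN ▸ lowering_antitone π N.le_succ)
  rw [hbot, Submodule.bot_toAddSubgroup]

end Idempotents

section Exp

variable {𝕜 A : Type*} [RCLike 𝕜] [NormedRing A] [NormedAlgebra 𝕜 A]

theorem isClosed_lowering (π : ℤ × ℤ → A) (n : ℕ) : IsClosed (lowering 𝕜 π n : Set A) := by
  have hinter : (lowering 𝕜 π n : Set A) = ⋂ (x : ℤ × ℤ) (y : ℤ × ℤ)
      (_ : ¬ (x.1 + n ≤ y.1 ∧ x.2 + n ≤ y.2)), {X | π x * X * π y = 0} := by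
    ext X
    simp only [Set.mem_iInter, SetLike.mem_coe, mem_lowering, Set.mem_ofPred_eq]
  rw [hinter]
  exact isClosed_iInter fun x => isClosed_iInter fun y => isClosed_iInter fun _ =>
    isClosed_eq (by fun_prop) continuous_const

variable [CompleteSpace A]

variable (𝕜) in
/-- The exponential of `X` as a unit with inverse `exp (-X)`. -/
@[simps]
def expUnit (X : A) : Aˣ where
  val := NormedSpace.exp X
  inv := NormedSpace.exp (-X)
  val_inv := by
    let _ := NormedAlgebra.restrictScalars ℚ 𝕜 A
    rw [← NormedSpace.exp_add_of_commute (Commute.refl X).neg_right, add_neg_cancel,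
      NormedSpace.exp_zero]
  inv_val := by
    let _ := NormedAlgebra.restrictScalars ℚ 𝕜 A
    rw [← NormedSpace.exp_add_of_commute (Commute.refl X).neg_left, neg_add_cancel,
      NormedSpace.exp_zero]

theorem expUnit_inv (X : A) : (expUnit 𝕜 X)⁻¹ = expUnit 𝕜 (-X) :=
  Units.ext rfl

theorem expUnit_add_of_commute {X Y : A} (h : Commute X Y) :
    expUnit 𝕜 (X + Y) = expUnit 𝕜 X * expUnit 𝕜 Y := by
  let _ := NormedAlgebra.restrictScalars ℚ 𝕜 A
  exact Units.ext (NormedSpace.exp_add_of_commute h)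

theorem map_exp {B : Type*} [NormedRing B] [NormedAlgebra 𝕜 B] (f : A →+* B) (hf : Continuous f)
    (X : A) : f (NormedSpace.exp X) = NormedSpace.exp (f X) := by
  let _ := NormedAlgebra.restrictScalars ℚ 𝕜 A
  let _ := NormedAlgebra.restrictScalars ℚ 𝕜 B
  exact NormedSpace.map_exp f hf X

namespace IsGradingFamily

variable {π : ℤ × ℤ → A} (hπ : IsGradingFamily π)
include hπ

theorem exp_sub_exp_mem_lowering {n : ℕ} {X Y : A} (hX : X ∈ lowering 𝕜 π 1)
    (hY : Y ∈ lowering 𝕜 π 1) (h : X - Y ∈ lowering 𝕜 π n) :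
    NormedSpace.exp X - NormedSpace.exp Y - (X - Y) ∈ lowering 𝕜 π (n + 1) := by
  have hasSum_tail (Z : A) : HasSum (fun k : ℕ => ((k + 2).factorial⁻¹ : 𝕜) • Z ^ (k + 2))
      (NormedSpace.exp Z - 1 - Z) := by
    simpa [Finset.sum_range_succ, sub_sub] using
      (hasSum_nat_add_iff' 2).2 (NormedSpace.exp_series_hasSum_exp' (𝕂 := 𝕜) Z)
  rw [show NormedSpace.exp X - NormedSpace.exp Y - (X - Y) =
    NormedSpace.exp X - 1 - X - (NormedSpace.exp Y - 1 - Y) by abel]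
  refine (isClosed_lowering π (n + 1)).mem_of_tendsto ((hasSum_tail X).sub (hasSum_tail Y))
    (.of_forall fun s => sum_mem fun k _ => ?_)
  rw [← smul_sub]
  exact Submodule.smul_mem _ _ (hπ.pow_sub_pow_mem_lowering hX hY h k)

theorem exp_sub_one_mem_lowering {X : A} (hX : X ∈ lowering 𝕜 π 1) :
    NormedSpace.exp X - 1 ∈ lowering 𝕜 π 1 := by
  have hmem := hπ.exp_sub_exp_mem_lowering hX (zero_mem _) (n := 1) (by simpa using hX)
  rw [NormedSpace.exp_zero, sub_zero] at hmem
  simpa using add_mem (lowering_antitone π one_le_two hmem) hX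

theorem existsUnique_log {u : A} (hu : u - 1 ∈ lowering 𝕜 π 1) :
    ∃! X, X ∈ lowering 𝕜 π 1 ∧ NormedSpace.exp X = u := by
  have hlog := hπ.existsUnique_fixedPoint (S := lowering 𝕜 π 1) ⟨0, zero_mem _⟩ subset_rfl
    (f := fun X => X + (u - NormedSpace.exp X))
    (fun X hX => by
      have hmem := sub_mem hu (hπ.exp_sub_one_mem_lowering hX)
      rw [sub_sub_sub_cancel_right] at hmem
      exact add_mem hX hmem)
    (fun n X hX Y hY h => by
      have hmem := neg_mem (hπ.exp_sub_exp_mem_lowering hX hY h)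
      convert hmem using 1
      abel)
  simpa [sub_eq_zero, eq_comm] using hlog

variable (𝕜) in
theorem exp_injOn : Set.InjOn NormedSpace.exp (lowering 𝕜 π 1 : Set A) := fun _ hX _ hY h =>
  (hπ.existsUnique_log (hπ.exp_sub_one_mem_lowering hY)).unique ⟨hX, h⟩ ⟨hY, rfl⟩

theorem lowering_exp_conj {X : A} (hX : X ∈ lowering 𝕜 π 1) (n : ℕ) :
    lowering 𝕜 (fun x => NormedSpace.exp X * π x * NormedSpace.exp (-X)) n = lowering 𝕜 π n :=
  hπ.lowering_conj (u := expUnit 𝕜 X) (hπ.exp_sub_one_mem_lowering hX)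
    (hπ.exp_sub_one_mem_lowering (neg_mem hX)) n

theorem eq_of_exp_conj_eq {X Y : A} (hX : X ∈ lowering 𝕜 π 1) (hY : Y ∈ lowering 𝕜 π 1)
    (h : ∀ x, NormedSpace.exp X * π x * NormedSpace.exp (-X) =
      NormedSpace.exp Y * π x * NormedSpace.exp (-Y)) : X = Y := by
  refine hπ.exp_injOn 𝕜 hX hY
    (Units.inv_mul_eq_one (u := expUnit 𝕜 Y) (a := NormedSpace.exp X).1 ?_).symm
  refine hπ.eq_one_of_commute (hπ.mul_sub_one_mem_lowering
    (hπ.exp_sub_one_mem_lowering (neg_mem hY)) (hπ.exp_sub_one_mem_lowering hX)) fun x => ?_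
  have hx : ↑(expUnit 𝕜 X) * π x = ↑(expUnit 𝕜 Y) * π x * ↑(expUnit 𝕜 Y)⁻¹ * ↑(expUnit 𝕜 X) :=
    Units.mul_inv_eq_iff_eq_mul _ |>.1 (h x)
  change ↑(expUnit 𝕜 Y)⁻¹ * ↑(expUnit 𝕜 X) * π x = π x * (↑(expUnit 𝕜 Y)⁻¹ * ↑(expUnit 𝕜 X))
  rw [mul_assoc, hx]
  simp only [mul_assoc, Units.inv_mul_cancel_left]

variable {π' : ℤ × ℤ → A}

omit [CompleteSpace A] in
theorem self_mul_mul_self_of_triangular (hπ' : IsGradingFamily π')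
    (h : ∀ x y, x ≠ y → ¬ (x.1 < y.1 ∧ x.2 < y.2) → π x * π' y = 0)
    (h' : ∀ x y, x ≠ y → ¬ (x.1 < y.1 ∧ x.2 < y.2) → π' x * π y = 0) (x : ℤ × ℤ) :
    π x * (π' x * π x) = π x := by
  have hsum : π x * (∑ z ∈ hπ'.finite_support.toFinset, π' z) * π x = π x * (π' x * π x) := by
    rw [Finset.mul_sum, Finset.sum_mul, Finset.sum_eq_single x, mul_assoc]
    · intro z _ hz
      by_cases hxz : x.1 < z.1 ∧ x.2 < z.2
      · rw [mul_assoc, h' z x hz fun hzx => hxz.1.asymm hzx.1, mul_zero]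
      · rw [h x z hz.symm hxz, zero_mul]
    · intro hx
      rw [Set.Finite.mem_toFinset, Function.notMem_support] at hx
      rw [hx, mul_zero, zero_mul]
  rw [← hsum, hπ'.sum_toFinset_eq_one, mul_one, (hπ.idem x).eq]

/- The conjugating element is the exponential of the logarithm of `∑ π' x * π x`. -/
theorem existsUnique_exp_conj_eq (hπ' : IsGradingFamily π')
    (h : ∀ x y, x ≠ y → ¬ (x.1 < y.1 ∧ x.2 < y.2) → π x * π' y = 0)
    (h' : ∀ x y, x ≠ y → ¬ (x.1 < y.1 ∧ x.2 < y.2) → π' x * π y = 0) :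
    ∃! X, X ∈ lowering 𝕜 π 1 ∧
      ∀ x, NormedSpace.exp X * π x * NormedSpace.exp (-X) = π' x := by
  set u := ∑ x ∈ hπ.finite_support.toFinset, π' x * π x with hu
  have mul_u (x : ℤ × ℤ) : π' x * u = π' x * π x := by
    rw [hu, Finset.mul_sum, Finset.sum_eq_single x, ← mul_assoc, (hπ'.idem x).eq]
    · intro y _ hy
      rw [← mul_assoc, hπ'.ortho hy.symm, zero_mul]
    · intro hx
      rw [Set.Finite.mem_toFinset, Function.notMem_support] at hx
      rw [hx, mul_zero, mul_zero]
  have u_mul (x : ℤ × ℤ) : u * π x = π' x * π x := by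
    rw [hu, Finset.sum_mul, Finset.sum_eq_single x, mul_assoc, (hπ.idem x).eq]
    · intro y _ hy
      rw [mul_assoc, hπ.ortho hy, mul_zero]
    · intro hx
      rw [Set.Finite.mem_toFinset, Function.notMem_support] at hx
      rw [hx, mul_zero]
  have u_sub_one_mem : u - 1 ∈ lowering 𝕜 π 1 := by
    refine mem_lowering_one.2 fun x y hxy => ?_
    rw [mul_sub, mul_one, sub_mul, mul_assoc, u_mul]
    obtain rfl | hne := eq_or_ne x y
    · rw [hπ.self_mul_mul_self_of_triangular hπ' h h', (hπ.idem x).eq, sub_self]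
    · rw [← mul_assoc, h x y hne hxy, zero_mul, hπ.ortho hne, sub_zero]
  obtain ⟨X, ⟨hX, hXu⟩, -⟩ := hπ.existsUnique_log u_sub_one_mem
  have hconj (x : ℤ × ℤ) : NormedSpace.exp X * π x * NormedSpace.exp (-X) = π' x :=
    (Units.mul_inv_eq_iff_eq_mul (expUnit 𝕜 X)).2 (by
      rw [val_expUnit, hXu, u_mul, mul_u])
  exact ⟨X, ⟨hX, hconj⟩, fun Y hY => hπ.eq_of_exp_conj_eq hY.1 hX fun x => by
    rw [hY.2, hconj]⟩

end IsGradingFamily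

end Exp

/-! ### The Deligne splitting -/

section DeligneSplitting

theorem iSupIndep_of_disjoint_lt {ι R M : Type*} [LinearOrder ι] [Ring R] [AddCommGroup M]
    [Module R M] (I : ι → Submodule R M) (h : ∀ i, Disjoint (I i) (⨆ (j) (_ : j < i), I j)) :
    iSupIndep I := by
  classical
  rw [iSupIndep_iff_finsetSum_eq_zero_imp_eq_zero]
  intro s v hv hsum i₀ hi₀
  by_contra hne
  have hne' : (s.filter fun i => v i ≠ 0).Nonempty := ⟨i₀, by simp [hi₀, hne]⟩
  set i := (s.filter fun i => v i ≠ 0).max' hne' with hi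
  obtain ⟨his, hvi⟩ := Finset.mem_filter.1 (Finset.max'_mem _ hne')
  rw [← hi] at his hvi
  rw [← Finset.add_sum_erase _ _ his, add_eq_zero_iff_eq_neg] at hsum
  refine hvi (Submodule.disjoint_def.1 (h i) _ (hv i his) ?_)
  rw [hsum]
  refine neg_mem (sum_mem fun j hj => ?_)
  by_cases hvj : v j = 0
  · rw [hvj]
    exact zero_mem _
  have hjs := Finset.mem_of_mem_erase hj
  have hlt : j < i := lt_of_le_of_ne (Finset.le_max' _ _ (by simp [hjs, hvj]))
    (Finset.ne_of_mem_erase hj)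
  exact Submodule.mem_iSup_of_mem j (Submodule.mem_iSup_of_mem hlt (hv j hjs))

variable {E : Type*} [NormedAddCommGroup E] [NormedSpace ℂ E]

namespace Datum

variable (D : Datum E)

theorem mem_conjSub {P : Submodule ℂ E} {v : E} : v ∈ D.conjSub P ↔ D.conj v ∈ P := Iff.rfl

theorem conjSub_mono {P Q : Submodule ℂ E} (h : P ≤ Q) : D.conjSub P ≤ D.conjSub Q :=
  fun _ hv => h hv

theorem conj_mem_W {k : ℤ} {v : E} : D.conj v ∈ D.W k ↔ v ∈ D.W k :=
  ⟨fun h => by simpa [D.conj_conj] using D.W_real k _ h, D.W_real k v⟩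

/-- The sum of the `conj F^{k - p + 1} ∩ W k` with `k ≤ w`. For a mixed Hodge structure it is a
complement of `F^p ∩ W w` in `W w`, which is how the Deligne bigrading is constructed. -/
def oppFil (F : ℤ → Submodule ℂ E) (p w : ℤ) : Submodule ℂ E :=
  ⨆ (k : ℤ) (_ : k ≤ w), D.conjSub (F (k - p + 1)) ⊓ D.W k

variable {D} {F : ℤ → Submodule ℂ E}

theorem le_oppFil {p w k : ℤ} (h : k ≤ w) :
    D.conjSub (F (k - p + 1)) ⊓ D.W k ≤ D.oppFil F p w :=
  le_iSup₂_of_le k h le_rfl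

theorem oppFil_le_W (p w : ℤ) : D.oppFil F p w ≤ D.W w :=
  iSup₂_le fun _ hk => inf_le_right.trans (D.W_mono hk)

theorem oppFil_mono_right (p : ℤ) {w w' : ℤ} (h : w ≤ w') :
    D.oppFil F p w ≤ D.oppFil F p w' :=
  iSup₂_le fun _ hk => le_oppFil (hk.trans h)

theorem oppFil_eq (p w : ℤ) :
    D.oppFil F p w = D.conjSub (F (w - p + 1)) ⊓ D.W w ⊔ D.oppFil F p (w - 1) := by
  refine le_antisymm (iSup₂_le fun k hk => ?_)
    (sup_le (le_oppFil le_rfl) (oppFil_mono_right p (by omega)))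
  rcases hk.eq_or_lt with rfl | hk
  · exact le_sup_left
  · exact (le_oppFil (w := w - 1) (by omega)).trans le_sup_right

/-- The subspace of `W (p + q)` whose intersection with `F p` is `I^{p,q}`. For a mixed Hodge
structure it is the sum of `I^{p,q}` and of all `I^{a,b}` with `a < p` and `a + b ≤ p + q`. -/
def bigrCover (D : Datum E) (F : ℤ → Submodule ℂ E) (p q : ℤ) : Submodule ℂ E :=
  D.conjSub (F q) ⊓ D.W (p + q) ⊔ D.oppFil F p (p + q - 1)

theorem bigrCover_le_W (p q : ℤ) : D.bigrCover F p q ≤ D.W (p + q) :=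
  sup_le inf_le_right ((oppFil_le_W _ _).trans (D.W_mono (by omega)))

theorem bigr_eq_inf (p q : ℤ) : D.bigr F p q = F p ⊓ D.bigrCover F p q := by
  have hshift : (⨆ j : ℕ, D.conjSub (F (q - (j + 1))) ⊓ D.W (p + q - (j + 1) - 1)) =
      D.oppFil F p (p + q - 1 - 1) := by
    refine le_antisymm (iSup_le fun j => ?_) (iSup₂_le fun k hk => ?_)
    · rw [show q - (j + 1 : ℤ) = (p + q - (j + 1) - 1) - p + 1 by ring]
      exact le_oppFil (by omega)
    · refine le_iSup_of_le (p + q - 2 - k).toNat ?_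
      rw [Int.toNat_of_nonneg (by omega : 0 ≤ p + q - 2 - k),
        show q - (p + q - 2 - k + 1) = k - p + 1 by ring,
        show p + q - (p + q - 2 - k + 1) - 1 = k by ring]
  have hcover : D.bigrCover F p q =
      D.conjSub (F q) ⊓ D.W (p + q) ⊔ D.oppFil F p (p + q - 1 - 1) := by
    rw [bigrCover, oppFil_eq, show p + q - 1 - p + 1 = q by ring, ← sup_assoc,
      sup_eq_left.2 (inf_le_inf_left (D.conjSub (F q))
        (D.W_mono (show p + q - 1 ≤ p + q by omega)))]
  rw [bigr, hshift, ← hcover, inf_assoc, inf_eq_right.2 (bigrCover_le_W p q)]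

theorem bigr_le_F (p q : ℤ) : D.bigr F p q ≤ F p :=
  (bigr_eq_inf p q).trans_le inf_le_left

theorem bigr_le_bigrCover (p q : ℤ) : D.bigr F p q ≤ D.bigrCover F p q :=
  (bigr_eq_inf p q).trans_le inf_le_right

theorem bigr_le_W (p q : ℤ) : D.bigr F p q ≤ D.W (p + q) :=
  (bigr_le_bigrCover p q).trans (bigrCover_le_W p q)

theorem W_induction {P : ℤ → Prop} (h0 : ∀ w, D.W w = ⊥ → P w) (h1 : ∀ w, P (w - 1) → P w)
    (w : ℤ) : P w := by
  obtain ⟨k, hk⟩ := D.W_bot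
  rcases le_total w k with h | h
  · exact h0 w (eq_bot_iff.2 (hk ▸ D.W_mono h))
  · induction w, h using Int.leInduction with
    | base => exact h0 k hk
    | succ n _ ih => exact h1 _ (by simpa using ih)

namespace IsGradedPolarizedMHS

variable (hF : D.IsGradedPolarizedMHS F)
include hF

theorem oppFil_anti {p p' : ℤ} (w : ℤ) (h : p ≤ p') : D.oppFil F p w ≤ D.oppFil F p' w :=
  iSup₂_le fun k hk => le_trans (inf_le_inf_right _ (D.conjSub_mono (hF.anti (by omega))))
    (le_oppFil hk)

theorem sup_oppFil (p w : ℤ) : F p ⊓ D.W w ⊔ D.oppFil F p w = D.W w := by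
  refine le_antisymm (sup_le inf_le_right (oppFil_le_W p w)) ?_
  revert w
  refine W_induction (D := D) (fun w hw => by simp [hw]) fun w ih => ?_
  have hW : D.W (w - 1) ≤ F p ⊓ D.W w ⊔ D.oppFil F p w := ih.trans
    (sup_le_sup (inf_le_inf_left _ (D.W_mono (by omega))) (oppFil_mono_right p (by omega)))
  conv_lhs => rw [← hF.sup_eq w p]
  refine sup_le (sup_le le_sup_left hW) fun v hv => ?_
  obtain ⟨a, ha, b, hb, hab⟩ := Submodule.mem_sup.1 (D.mem_conjSub.1 hv)
  rw [← D.conj_conj v, ← hab, map_add]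
  refine add_mem (le_sup_right (a := F p ⊓ D.W w) (le_oppFil le_rfl ⟨?_, D.W_real _ _ ha.2⟩))
    (hW (D.W_real _ _ hb))
  rw [SetLike.mem_coe, mem_conjSub, D.conj_conj]
  exact ha.1

theorem disjoint_oppFil (p w : ℤ) : Disjoint (F p) (D.oppFil F p w) := by
  rw [disjoint_iff_inf_le]
  revert w
  refine W_induction (D := D) (fun w hw => ?_) fun w ih => ?_
  · exact inf_le_right.trans (hw ▸ oppFil_le_W p w)
  · rintro v ⟨hv, hv'⟩
    have hvW := oppFil_le_W p w hv'
    rw [oppFil_eq] at hv'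
    obtain ⟨a, ha, b, hb, rfl⟩ := Submodule.mem_sup.1 hv'
    have hbW := oppFil_le_W p _ hb
    have hlow : a + b ∈ D.W (w - 1) := by
      rw [← hF.inf_eq w p]
      refine ⟨le_sup_left (a := F p ⊓ D.W w) ⟨hv, hvW⟩, ?_⟩
      rw [SetLike.mem_coe, mem_conjSub, map_add]
      exact Submodule.add_mem_sup ⟨ha.1, D.W_real _ _ ha.2⟩ (D.W_real _ _ hbW)
    refine ih ⟨hv, add_mem ?_ hb⟩
    refine le_oppFil le_rfl ⟨D.conjSub_mono (hF.anti (by omega)) ha.1, ?_⟩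
    simpa using sub_mem hlow hbW

theorem exists_add_of_mem_W {w : ℤ} (p : ℤ) {v : E} (hv : v ∈ D.W w) :
    ∃ f ∈ F p, f ∈ D.W w ∧ ∃ l ∈ D.oppFil F p w, f + l = v := by
  rw [← hF.sup_oppFil p w] at hv
  obtain ⟨f, hf, l, hl, h⟩ := Submodule.mem_sup.1 hv
  exact ⟨f, hf.1, hf.2, l, hl, h⟩

theorem eq_zero_of_mem_oppFil {p w : ℤ} {v : E} (h : v ∈ F p) (h' : v ∈ D.oppFil F p w) :
    v = 0 :=
  Submodule.disjoint_def.1 (hF.disjoint_oppFil p w) v h h'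

theorem mem_oppFil_of_mem_W {p w w' : ℤ} {v : E} (h : v ∈ D.oppFil F p w') (hv : v ∈ D.W w) :
    v ∈ D.oppFil F p w := by
  obtain ⟨f, hf, -, l, hl, rfl⟩ := hF.exists_add_of_mem_W p hv
  have hsum : f + l ∈ D.oppFil F p (max w w') := oppFil_mono_right p (le_max_right _ _) h
  have hl' : l ∈ D.oppFil F p (max w w') := oppFil_mono_right p (le_max_left _ _) hl
  rwa [hF.eq_zero_of_mem_oppFil hf (by simpa using sub_mem hsum hl'), zero_add]

end IsGradedPolarizedMHS

/-- The sum of the `I^x` for `x` in a set of indices. -/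
def bigrSum (D : Datum E) (F : ℤ → Submodule ℂ E) (s : Set (ℤ × ℤ)) : Submodule ℂ E :=
  ⨆ (x : ℤ × ℤ) (_ : x ∈ s), D.bigr F x.1 x.2

theorem bigrSum_mono {s t : Set (ℤ × ℤ)} (h : s ⊆ t) : D.bigrSum F s ≤ D.bigrSum F t :=
  iSup₂_le fun x hx => le_iSup₂_of_le x (h hx) le_rfl

theorem bigr_le_bigrSum {s : Set (ℤ × ℤ)} {p q : ℤ} (h : (p, q) ∈ s) :
    D.bigr F p q ≤ D.bigrSum F s := le_iSup₂_of_le (p, q) h le_rfl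

theorem bigrSum_le_iff {s : Set (ℤ × ℤ)} {P : Submodule ℂ E} :
    D.bigrSum F s ≤ P ↔ ∀ p q, (p, q) ∈ s → D.bigr F p q ≤ P := by
  rw [bigrSum, iSup₂_le_iff, Prod.forall]

namespace IsGradedPolarizedMHS

variable (hF : D.IsGradedPolarizedMHS F)
include hF

theorem inf_oppFil_le_bigrSum (p w : ℤ) :
    F p ⊓ D.oppFil F (p + 1) w ≤ D.bigrSum F {x | x.1 = p ∧ x.1 + x.2 ≤ w} := by
  revert w
  refine W_induction (D := D) (fun w hw => ?_) fun w ih => ?_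
  · exact (inf_le_right.trans (hw ▸ oppFil_le_W _ w)).trans bot_le
  · rintro v ⟨hv, hv'⟩
    rw [SetLike.mem_coe, oppFil_eq] at hv'
    obtain ⟨a, ha, b, hb, rfl⟩ := Submodule.mem_sup.1 hv'
    obtain ⟨f, hf, hfW, l, hl, rfl⟩ := hF.exists_add_of_mem_W p (oppFil_le_W _ _ hb)
    rw [show a + (f + l) = (a + l) + f by abel]
    refine add_mem (bigr_le_bigrSum (p := p) (q := w - p) (by simp) ?_)
      (bigrSum_mono ?_ (ih ⟨hf, ?_⟩))
    · rw [bigr_eq_inf]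
      refine ⟨by simpa [add_assoc, add_sub_assoc, add_comm f l] using sub_mem hv hf, ?_⟩
      rw [SetLike.mem_coe, bigrCover, show p + (w - p) = w by ring]
      rw [show w - (p + 1) + 1 = w - p by ring] at ha
      exact Submodule.add_mem_sup ha hl
    · rintro x ⟨h1, h2⟩
      exact ⟨h1, by omega⟩
    · simpa using sub_mem hb (hF.oppFil_anti _ (by omega) hl)

theorem F_inf_W_le_bigrSum (p w : ℤ) :
    F p ⊓ D.W w ≤ D.bigrSum F {x | p ≤ x.1 ∧ x.1 + x.2 ≤ w} := by
  obtain ⟨m, hm⟩ := hF.eq_bot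
  rcases le_total m p with h | h
  · exact (inf_le_left.trans (hm ▸ hF.anti h)).trans bot_le
  · induction p, h using Int.leInductionDown with
    | base => exact (inf_le_left.trans hm.le).trans bot_le
    | pred n _ ih =>
      rintro v ⟨hv, hvW⟩
      obtain ⟨f, hf, hfW, l, hl, rfl⟩ := hF.exists_add_of_mem_W n hvW
      refine add_mem (bigrSum_mono ?_ (ih ⟨hf, hfW⟩)) (bigrSum_mono ?_
        (hF.inf_oppFil_le_bigrSum (n - 1) w ⟨?_, by simpa using hl⟩))
      · rintro x ⟨h1, h2⟩
        exact ⟨by omega, h2⟩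
      · rintro x ⟨h1, h2⟩
        exact ⟨h1.ge, h2⟩
      · simpa using sub_mem hv (hF.anti (by omega : n - 1 ≤ n) hf)

theorem oppFil_le_bigrSum (p w : ℤ) :
    D.oppFil F p w ≤ D.bigrSum F {x | x.1 < p ∧ x.1 + x.2 ≤ w} := by
  obtain ⟨m, hm⟩ := hF.eq_top
  have eq_bot : ∀ p ≤ m, D.oppFil F p w = ⊥ := fun p hp => by
    simpa only [top_unique (hm ▸ hF.anti hp : ⊤ ≤ F p), top_disjoint] using
      hF.disjoint_oppFil p w
  rcases le_total p m with h | h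
  · exact (eq_bot p h).le.trans bot_le
  · induction p, h using Int.leInduction with
    | base => exact (eq_bot m le_rfl).le.trans bot_le
    | succ n _ ih =>
      intro v hv
      obtain ⟨f, hf, -, l, hl, rfl⟩ := hF.exists_add_of_mem_W n (oppFil_le_W _ _ hv)
      refine add_mem (bigrSum_mono ?_ (hF.inf_oppFil_le_bigrSum n w ⟨hf, ?_⟩))
        (bigrSum_mono ?_ (ih hl))
      · rintro x ⟨h1, h2⟩
        exact ⟨by omega, h2⟩
      · simpa using sub_mem hv (hF.oppFil_anti w (by omega : n ≤ n + 1) hl)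
      · rintro x ⟨h1, h2⟩
        exact ⟨by omega, h2⟩

theorem bigr_le_oppFil {a b p w : ℤ} (h : a < p) (hw : a + b ≤ w) :
    D.bigr F a b ≤ D.oppFil F p w := by
  refine (bigr_le_bigrCover a b).trans (sup_le ?_ ?_)
  · refine le_trans ?_ (hF.oppFil_anti w (by omega : a + 1 ≤ p))
    refine le_trans ?_ (le_oppFil hw)
    rw [show a + b - (a + 1) + 1 = b by ring]
  · exact (hF.oppFil_anti _ h.le).trans (oppFil_mono_right _ (by omega))

theorem F_inf_W_eq_bigrSum (p w : ℤ) :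
    F p ⊓ D.W w = D.bigrSum F {x | p ≤ x.1 ∧ x.1 + x.2 ≤ w} :=
  le_antisymm (hF.F_inf_W_le_bigrSum p w) (bigrSum_le_iff.2 fun _ _ h =>
    le_inf ((bigr_le_F _ _).trans (hF.anti h.1)) ((bigr_le_W _ _).trans (D.W_mono h.2)))

theorem W_eq_bigrSum (w : ℤ) : D.W w = D.bigrSum F {x | x.1 + x.2 ≤ w} := by
  refine le_antisymm ?_ (bigrSum_le_iff.2 fun _ _ h => (bigr_le_W _ _).trans (D.W_mono h))
  obtain ⟨m, hm⟩ := hF.eq_top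
  have hle := hF.F_inf_W_le_bigrSum m w
  rw [hm, top_inf_eq] at hle
  exact hle.trans (bigrSum_mono fun x hx => hx.2)

theorem F_eq_bigrSum (p : ℤ) : F p = D.bigrSum F {x | p ≤ x.1} := by
  refine le_antisymm ?_ (bigrSum_le_iff.2 fun _ _ h => (bigr_le_F _ _).trans (hF.anti h))
  obtain ⟨m, hm⟩ := D.W_top
  have hle := hF.F_inf_W_le_bigrSum p m
  rw [hm, inf_top_eq] at hle
  exact hle.trans (bigrSum_mono fun x hx => hx.1)

theorem eq_zero_of_mem_bigr_of_mem_W {p q : ℤ} {v : E} (hv : v ∈ D.bigr F p q)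
    (hW : v ∈ D.W (p + q - 1)) : v = 0 := by
  obtain ⟨a, ha, b, hb, rfl⟩ := Submodule.mem_sup.1 (bigr_le_bigrCover p q hv)
  refine hF.eq_zero_of_mem_oppFil (p := p) (w := p + q - 1) (bigr_le_F p q hv) (add_mem ?_ hb)
  have hle := le_oppFil (D := D) (F := F) (p := p) (le_refl (p + q - 1))
  rw [show p + q - 1 - p + 1 = q by ring] at hle
  exact hle ⟨ha.1, by simpa using sub_mem hW (oppFil_le_W _ _ hb)⟩

theorem bigrCover_eq_bigrSum (p q : ℤ) : D.bigrCover F p q =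
    D.bigrSum F {x | x = (p, q) ∨ x.1 < p ∧ x.1 + x.2 ≤ p + q} := by
  have hle : D.oppFil F p (p + q) ≤ D.bigrCover F p q := by
    rw [oppFil_eq, bigrCover]
    refine sup_le_sup_right (inf_le_inf_right _ (D.conjSub_mono (hF.anti (by omega)))) _
  refine le_antisymm (sup_le ?_ ?_) (bigrSum_le_iff.2 ?_)
  · intro v hv
    have hpre : v ∈ D.bigrCover F p q := le_sup_left (a := D.conjSub (F q) ⊓ D.W (p + q)) hv
    obtain ⟨f, hf, -, l, hl, rfl⟩ := hF.exists_add_of_mem_W p hv.2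
    refine add_mem (bigr_le_bigrSum (p := p) (q := q) (Or.inl rfl) ?_)
      (bigrSum_mono (fun x hx => Or.inr hx) (hF.oppFil_le_bigrSum _ _ hl))
    rw [bigr_eq_inf]
    exact ⟨hf, by simpa using sub_mem hpre (hle hl)⟩
  · exact (hF.oppFil_le_bigrSum _ _).trans
      (bigrSum_mono fun x hx => Or.inr ⟨hx.1, by have := hx.2; omega⟩)
  · rintro a b (h | h)
    · cases h
      exact bigr_le_bigrCover p q
    · exact (hF.bigr_le_oppFil h.1 h.2).trans hle

theorem bigr_le_oppFil_of_W_eq_top {k : ℤ} (hk : D.W k = ⊤) {a b p : ℤ} (h : a < p) :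
    D.bigr F a b ≤ D.oppFil F p k :=
  (hF.bigr_le_oppFil h le_rfl).trans fun _ hv =>
    hF.mem_oppFil_of_mem_W hv (hk ▸ Submodule.mem_top)

/- In the lexicographic order, the earlier `I^{a,b}` have either `a < p`, and lie in the complement
of `F p`, or `a = p`, and lie in `F p ∩ W (p + q - 1)`. -/
theorem iSupIndep_bigr : iSupIndep fun x : ℤ × ℤ => D.bigr F x.1 x.2 := by
  obtain ⟨k, hk⟩ := D.W_top
  have hle (x : ℤ ×ₗ ℤ) : (⨆ (j : ℤ ×ₗ ℤ) (_ : j < x), D.bigr F (ofLex j).1 (ofLex j).2) ≤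
      D.oppFil F (ofLex x).1 k ⊔ F (ofLex x).1 ⊓ D.W ((ofLex x).1 + (ofLex x).2 - 1) := by
    refine iSup₂_le fun j hj => ?_
    rcases Prod.Lex.lt_iff.1 hj with hfst | ⟨hfst, hsnd⟩
    · exact (hF.bigr_le_oppFil_of_W_eq_top hk hfst).trans le_sup_left
    · exact (le_inf (hfst ▸ bigr_le_F _ _)
        ((bigr_le_W _ _).trans (D.W_mono (by omega)))).trans le_sup_right
  refine (iSupIndep_of_disjoint_lt (fun x : ℤ ×ₗ ℤ => D.bigr F (ofLex x).1 (ofLex x).2)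
    fun x => Submodule.disjoint_def.2 fun v hv hv' => ?_).comp toLex.injective
  obtain ⟨l, hl, s, hs, rfl⟩ := Submodule.mem_sup.1 (hle x hv')
  have hl0 : l = 0 := hF.eq_zero_of_mem_oppFil (p := (ofLex x).1)
    (by simpa using sub_mem (bigr_le_F _ _ hv) hs.1) hl
  rw [hl0, zero_add] at hv ⊢
  exact hF.eq_zero_of_mem_bigr_of_mem_W hv hs.2

theorem iSup_bigr : ⨆ x : ℤ × ℤ, D.bigr F x.1 x.2 = ⊤ := by
  obtain ⟨k, hk⟩ := D.W_top
  rw [eq_top_iff, ← hk, hF.W_eq_bigrSum k]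
  exact iSup₂_le fun x _ => le_iSup (fun x : ℤ × ℤ => D.bigr F x.1 x.2) x

end IsGradedPolarizedMHS

end Datum

end DeligneSplitting

/-! ### Complex conjugation and the projections of the Deligne bigrading -/

section Conjugation

variable {E : Type*} [NormedAddCommGroup E] [NormedSpace ℂ E]

namespace Datum

section Bar

variable [FiniteDimensional ℂ E] (D : Datum E)

theorem continuous_conj : Continuous D.conj := by
  let f : E →ₗ[ℝ] E :=
    { toFun := D.conj
      map_add' := map_add D.conj
      map_smul' := fun r v => by
        rw [← Complex.coe_smul, LinearMap.map_smulₛₗ, Complex.conj_ofReal, Complex.coe_smul]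
        rfl }
  exact f.continuous_of_finiteDimensional

/-- The complex conjugate `conj ∘ X ∘ conj` of an endomorphism `X`. -/
def bar : (E →L[ℂ] E) →+* (E →L[ℂ] E) where
  toFun X :=
    { toFun := fun v => D.conj (X (D.conj v))
      map_add' := fun u v => by simp
      map_smul' := fun c v => by simp
      cont := D.continuous_conj.comp (X.continuous.comp D.continuous_conj) }
  map_one' := by ext v; exact D.conj_conj v
  map_mul' X Y := by ext v; simp [D.conj_conj]
  map_zero' := by ext v; simp
  map_add' X Y := by ext v; simp

theorem bar_apply (X : E →L[ℂ] E) (v : E) : D.bar X v = D.conj (X (D.conj v)) := rfl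

theorem bar_apply_conj (X : E →L[ℂ] E) (v : E) : D.bar X (D.conj v) = D.conj (X v) := by
  rw [bar_apply, D.conj_conj]

theorem bar_bar (X : E →L[ℂ] E) : D.bar (D.bar X) = X := by
  ext v
  simp only [bar_apply, D.conj_conj]

theorem bar_injective : Function.Injective D.bar :=
  Function.LeftInverse.injective D.bar_bar

theorem bar_smul (c : ℂ) (X : E →L[ℂ] E) : D.bar (c • X) = starRingEnd ℂ c • D.bar X := by
  ext v
  simp [bar_apply]

theorem continuous_bar : Continuous D.bar := by
  let f : (E →L[ℂ] E) →ₗ[ℝ] (E →L[ℂ] E) :=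
    { toFun := D.bar
      map_add' := map_add D.bar
      map_smul' := fun r v => by
        rw [← Complex.coe_smul, bar_smul, Complex.conj_ofReal, Complex.coe_smul]
        rfl }
  exact f.continuous_of_finiteDimensional

theorem isReal_iff {X : E →L[ℂ] E} : D.IsReal X ↔ D.bar X = X := by
  refine ⟨fun h => ?_, fun h v => ?_⟩
  · ext v
    rw [bar_apply, ← h, D.conj_conj]
  · rw [← bar_apply_conj, h]

theorem bar_exp (X : E →L[ℂ] E) : D.bar (NormedSpace.exp X) = NormedSpace.exp (D.bar X) :=
  map_exp (𝕜 := ℂ) D.bar D.continuous_bar X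

end Bar

variable (D : Datum E)

/-- `E` is the direct sum of the `I^{p,q}`. This is weaker than being a mixed Hodge structure, and
independent of the polarizations. -/
def Decomposes (F : ℤ → Submodule ℂ E) : Prop :=
  iSupIndep (fun x : ℤ × ℤ => D.bigr F x.1 x.2) ∧ ⨆ x : ℤ × ℤ, D.bigr F x.1 x.2 = ⊤

variable {D} {F : ℤ → Submodule ℂ E}

theorem IsGradedPolarizedMHS.decomposes (hF : D.IsGradedPolarizedMHS F) : D.Decomposes F :=
  ⟨hF.iSupIndep_bigr, hF.iSup_bigr⟩

namespace Decomposes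

variable (hF : D.Decomposes F)
include hF

theorem isCompl (p q : ℤ) : IsCompl (D.bigr F p q)
    (⨆ (a : ℤ) (b : ℤ) (_ : (a, b) ≠ (p, q)), D.bigr F a b) := by
  have hprod : (⨆ (a : ℤ) (b : ℤ) (_ : (a, b) ≠ (p, q)), D.bigr F a b) =
      ⨆ (x : ℤ × ℤ) (_ : x ≠ (p, q)), D.bigr F x.1 x.2 := by rw [iSup_prod]
  rw [hprod]
  refine ⟨hF.1 (p, q), codisjoint_iff_le_sup.2 ?_⟩
  rw [← hF.2]
  refine iSup_le fun x => ?_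
  obtain rfl | hx := eq_or_ne x (p, q)
  · exact le_sup_left
  · exact le_trans (le_iSup₂_of_le (f := fun (x : ℤ × ℤ) (_ : x ≠ (p, q)) => D.bigr F x.1 x.2)
      x hx le_rfl) le_sup_right

theorem ext {X Y : E →L[ℂ] E} (h : ∀ x : ℤ × ℤ, ∀ v ∈ D.bigr F x.1 x.2, X v = Y v) : X = Y := by
  ext v
  have hv : v ∈ ⨆ x : ℤ × ℤ, D.bigr F x.1 x.2 := hF.2 ▸ Submodule.mem_top
  induction hv using Submodule.iSup_induction' with
  | mem x v hv => exact h x v hv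
  | zero => simp
  | add u v _ _ hu hv => rw [map_add, map_add, hu, hv]

end Decomposes

variable [FiniteDimensional ℂ E]

variable (D) in
/-- The projections onto the `I^{p,q}`, as a family indexed by pairs. -/
def pr (F : ℤ → Submodule ℂ E) (x : ℤ × ℤ) : E →L[ℂ] E := D.proj F x.1 x.2

variable (D) in
/-- The projections onto the conjugate subspaces `conj I^{q,p}`. -/
def prBar (F : ℤ → Submodule ℂ E) (x : ℤ × ℤ) : E →L[ℂ] E := D.bar (D.pr F x.swap)

namespace Decomposes

variable (hF : D.Decomposes F)
include hF

theorem pr_mem (x : ℤ × ℤ) (v : E) : D.pr F x v ∈ D.bigr F x.1 x.2 := by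
  rw [pr, proj, dif_pos (hF.isCompl x.1 x.2)]
  exact Submodule.projection_apply_mem _ _

theorem pr_of_mem {x : ℤ × ℤ} {v : E} (hv : v ∈ D.bigr F x.1 x.2) : D.pr F x v = v := by
  rw [pr, proj, dif_pos (hF.isCompl x.1 x.2)]
  exact Submodule.projection_apply_of_mem_left _ hv

theorem pr_of_mem_ne {x y : ℤ × ℤ} (h : y ≠ x) {v : E} (hv : v ∈ D.bigr F y.1 y.2) :
    D.pr F x v = 0 := by
  rw [pr, proj, dif_pos (hF.isCompl x.1 x.2)]
  exact (Submodule.projection_apply_eq_zero_iff _).2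
    (Submodule.mem_iSup_of_mem y.1 (Submodule.mem_iSup_of_mem y.2 (Submodule.mem_iSup_of_mem h hv)))

theorem isGradingFamily : IsGradingFamily (D.pr F) := by
  have finite_support : (Function.support (D.pr F)).Finite := by
    refine (WellFoundedGT.finite_ne_bot_of_iSupIndep hF.1).subset fun x hx h => hx ?_
    ext v
    have hv := hF.pr_mem x v
    rw [h] at hv
    simpa using hv
  refine { idem := fun x => ?_, ortho := fun x y h => ?_, finite_support, finsum_eq_one := ?_ }
  · ext v
    exact hF.pr_of_mem (hF.pr_mem x v)
  · ext v
    exact hF.pr_of_mem_ne h.symm (hF.pr_mem y v)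
  · rw [finsum_eq_sum _ finite_support]
    refine hF.ext fun x v hv => ?_
    rw [sum_apply, Finset.sum_eq_single x]
    · exact hF.pr_of_mem hv
    · exact fun y _ hy => hF.pr_of_mem_ne hy.symm hv
    · intro h
      rw [Set.Finite.mem_toFinset, Function.notMem_support] at h
      rw [h, zero_apply]

theorem mem_bigr_iff {x : ℤ × ℤ} {v : E} : v ∈ D.bigr F x.1 x.2 ↔ D.pr F x v = v :=
  ⟨hF.pr_of_mem, fun h => h ▸ hF.pr_mem x v⟩

theorem mem_bigrSum_iff {s : Set (ℤ × ℤ)} {v : E} :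
    v ∈ D.bigrSum F s ↔ ∀ x ∉ s, D.pr F x v = 0 := by
  refine ⟨fun hv x hx => ?_, fun h => ?_⟩
  · have hker : D.bigrSum F s ≤ LinearMap.ker (D.pr F x : E →ₗ[ℂ] E) :=
      iSup₂_le fun y hy u hu => hF.pr_of_mem_ne (ne_of_mem_of_not_mem hy hx) hu
    exact hker hv
  · have hsum : v = ∑ x ∈ hF.isGradingFamily.finite_support.toFinset, D.pr F x v := by
      rw [← sum_apply, hF.isGradingFamily.sum_toFinset_eq_one]
      rfl
    rw [hsum]
    refine sum_mem fun x _ => ?_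
    by_cases hx : x ∈ s
    · exact bigr_le_bigrSum (p := x.1) (q := x.2) hx (hF.pr_mem x v)
    · rw [h x hx]
      exact zero_mem _

theorem mem_Lam_iff {X : E →L[ℂ] E} : X ∈ D.Lam F ↔ X ∈ lowering ℂ (D.pr F) 1 := by
  have hprod (p q : ℤ) : (⨆ (a : ℤ) (b : ℤ) (_ : a < p ∧ b < q), D.bigr F a b) =
      D.bigrSum F {x | x.1 < p ∧ x.2 < q} := by
    rw [bigrSum, iSup_prod]
    rfl
  simp only [Lam, Set.mem_ofPred_eq, hprod, mem_lowering_one]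
  refine ⟨fun h x y hxy => ?_, fun h p q v hv => ?_⟩
  · ext v
    exact hF.mem_bigrSum_iff.1 (h y.1 y.2 _ (hF.pr_mem y v)) x hxy
  · refine hF.mem_bigrSum_iff.2 fun x hx => ?_
    have hblock := DFunLike.congr_fun (h x (p, q) hx) v
    simpa [hF.pr_of_mem (x := (p, q)) hv] using hblock

theorem isGradingFamily_prBar : IsGradingFamily (D.prBar F) :=
  (hF.isGradingFamily.map D.bar).comp_equiv (Equiv.prodComm ℤ ℤ)

theorem isSplit_iff : D.IsSplit F ↔ ∀ x, D.prBar F x = D.pr F x := by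
  constructor
  · intro h x
    refine hF.ext fun y v hv => ?_
    have hv' : D.conj v ∈ D.bigr F y.swap.1 y.swap.2 := by
      rw [h] at hv
      exact hv
    rw [prBar, bar_apply]
    obtain rfl | hxy := eq_or_ne y x
    · rw [hF.pr_of_mem hv, hF.pr_of_mem hv', D.conj_conj]
    · rw [hF.pr_of_mem_ne hxy hv,
        hF.pr_of_mem_ne (fun h => hxy (Prod.swap_injective h)) hv', map_zero]
  · intro h p q
    ext v
    rw [mem_conjSub, hF.mem_bigr_iff (x := (p, q)), hF.mem_bigr_iff (x := (q, p)), ← h (p, q),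
      prBar, bar_apply, Prod.swap_prod_mk]
    constructor
    · intro h'
      conv_rhs => rw [← h']
      rw [D.conj_conj]
    · intro h'
      rw [h', D.conj_conj]

end Decomposes

theorem bar_mem_lowering_prBar_iff {n : ℕ} {X : E →L[ℂ] E} :
    D.bar X ∈ lowering ℂ (D.prBar F) n ↔ X ∈ lowering ℂ (D.pr F) n := by
  have hswap : lowering ℂ (D.prBar F) n = lowering ℂ (fun x => D.bar (D.pr F x)) n :=
    lowering_comp_swap (fun x => D.bar (D.pr F x)) n
  rw [hswap, map_mem_lowering_iff D.bar_injective]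

namespace IsGradedPolarizedMHS

variable (hF : D.IsGradedPolarizedMHS F)
include hF

theorem conj_mem_of_mem_bigr {p q : ℤ} {v : E} (hv : v ∈ D.bigr F q p) :
    D.conj v ∈ D.bigrSum F {x | x = (p, q) ∨ x.1 < p ∧ x.2 < q} := by
  have mem_cover : D.conj v ∈ D.bigrSum F {x | x = (p, q) ∨ x.1 < p ∧ x.1 + x.2 ≤ p + q} := by
    rw [← hF.bigrCover_eq_bigrSum]
    refine le_sup_left (a := D.conjSub (F q) ⊓ D.W (p + q)) ⟨?_, ?_⟩
    · rw [SetLike.mem_coe, mem_conjSub, D.conj_conj]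
      exact bigr_le_F _ _ hv
    · exact D.W_real _ _ (add_comm q p ▸ bigr_le_W _ _ hv)
  have cover_le : D.bigrCover F q p ≤ D.conjSub (D.bigrSum F {x | p ≤ x.1 ∨ x.2 < q}) := by
    refine sup_le (inf_le_left.trans (D.conjSub_mono ?_)) (iSup₂_le fun k _ => ?_)
    · rw [hF.F_eq_bigrSum]
      exact bigrSum_mono fun x hx => Or.inl hx
    · rintro u ⟨hu, hu'⟩
      have hmem : D.conj u ∈ F (k - q + 1) ⊓ D.W k := ⟨hu, D.W_real _ _ hu'⟩
      rw [hF.F_inf_W_eq_bigrSum] at hmem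
      refine bigrSum_mono (fun x hx => Or.inr ?_) hmem
      have hx₁ := hx.1
      have hx₂ := hx.2
      omega
  have mem_conj_cover := cover_le (bigr_le_bigrCover _ _ hv)
  rw [mem_conjSub] at mem_conj_cover
  rw [hF.decomposes.mem_bigrSum_iff] at mem_cover mem_conj_cover ⊢
  intro x hx
  by_contra hne
  obtain h | h := not_imp_comm.1 (mem_cover x) hne
  · exact hx (Or.inl h)
  · exact hx (Or.inr ⟨h.1, (not_imp_comm.1 (mem_conj_cover x) hne).resolve_left h.1.not_ge⟩)

theorem pr_mul_prBar_eq_zero {x y : ℤ × ℤ} (hne : x ≠ y) (hxy : ¬ (x.1 < y.1 ∧ x.2 < y.2)) :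
    D.pr F x * D.prBar F y = 0 := by
  ext v
  have hmem := hF.conj_mem_of_mem_bigr (p := y.1) (q := y.2)
    (hF.decomposes.pr_mem y.swap (D.conj v))
  exact hF.decomposes.mem_bigrSum_iff.1 hmem x (by rintro (h | h); exacts [hne h, hxy h])

theorem prBar_mul_pr_eq_zero {x y : ℤ × ℤ} (hne : x ≠ y) (hxy : ¬ (x.1 < y.1 ∧ x.2 < y.2)) :
    D.prBar F x * D.pr F y = 0 := by
  have hswap := hF.pr_mul_prBar_eq_zero (Prod.swap_injective.ne hne) fun h => hxy h.symm
  rw [prBar, Prod.swap_swap] at hswap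
  rw [prBar, ← D.bar_bar (D.pr F y), ← map_mul, hswap, map_zero]

theorem existsUnique_exp_conj_pr_eq_prBar : ∃! X, X ∈ lowering ℂ (D.pr F) 1 ∧
    ∀ x, NormedSpace.exp X * D.pr F x * NormedSpace.exp (-X) = D.prBar F x :=
  hF.decomposes.isGradingFamily.existsUnique_exp_conj_eq hF.decomposes.isGradingFamily_prBar
    (fun _ _ => hF.pr_mul_prBar_eq_zero) fun _ _ => hF.prBar_mul_pr_eq_zero

theorem lowering_prBar (n : ℕ) : lowering ℂ (D.prBar F) n = lowering ℂ (D.pr F) n := by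
  obtain ⟨X, ⟨hX, hconj⟩, -⟩ := hF.existsUnique_exp_conj_pr_eq_prBar
  rw [← funext hconj, hF.decomposes.isGradingFamily.lowering_exp_conj hX]

theorem bar_mem_lowering_iff {n : ℕ} {X : E →L[ℂ] E} :
    D.bar X ∈ lowering ℂ (D.pr F) n ↔ X ∈ lowering ℂ (D.pr F) n := by
  rw [← hF.lowering_prBar, bar_mem_lowering_prBar_iff, ← hF.lowering_prBar]

end IsGradedPolarizedMHS

end Datum

end Conjugation

/-! ### The action on filtrations and Deligne's splitting -/

section Action

theorem inv_conj_eq_conj_iff {M : Type*} [Monoid M] (u : Mˣ) {a b : M} :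
    ↑u⁻¹ * b * ↑u = ↑u * a * ↑u⁻¹ ↔ ↑(u * u) * a * ↑(u * u)⁻¹ = b := by
  have hconj : ↑(u * u) * a * ↑(u * u)⁻¹ = ↑u * (↑u * a * ↑u⁻¹) * ↑u⁻¹ := by
    simp only [mul_inv_rev, Units.val_mul, mul_assoc]
  rw [hconj, Units.mul_inv_eq_iff_eq_mul, mul_assoc _ b, Units.inv_mul_eq_iff_eq_mul, eq_comm]

variable {E : Type*} [NormedAddCommGroup E] [NormedSpace ℂ E]

theorem act_mul (g h : E →L[ℂ] E) (F : ℤ → Submodule ℂ E) : act (g * h) F = act g (act h F) :=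
  funext fun p => Submodule.map_comp (h : E →ₗ[ℂ] E) (g : E →ₗ[ℂ] E) (F p)

theorem act_one (F : ℤ → Submodule ℂ E) : act 1 F = F :=
  funext fun p => Submodule.map_id (F p)

theorem unit_injective (g : (E →L[ℂ] E)ˣ) : Function.Injective (g : E →L[ℂ] E) :=
  (ContinuousLinearEquiv.unitsEquiv ℂ E g).injective

namespace Datum

variable {D : Datum E} {F : ℤ → Submodule ℂ E}

variable (D) in
/-- `g` maps the Deligne bigrading of `F` to that of `g.F`. -/
def MapsBigr (g : E →L[ℂ] E) (F : ℤ → Submodule ℂ E) : Prop :=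
  ∀ p q, D.bigr (act g F) p q = (D.bigr F p q).map (g : E →ₗ[ℂ] E)

theorem Decomposes.act (hF : D.Decomposes F) {g : (E →L[ℂ] E)ˣ} (hg : D.MapsBigr g F) :
    D.Decomposes (act g F) := by
  let e : E ≃ₗ[ℂ] E := (ContinuousLinearEquiv.unitsEquiv ℂ E g).toLinearEquiv
  have he (x : ℤ × ℤ) : D.bigr (MixedHodge.act g F) x.1 x.2 =
      Submodule.orderIsoMapComap e (D.bigr F x.1 x.2) := hg x.1 x.2
  refine ⟨?_, ?_⟩
  · simp_rw [he]
    exact hF.1.map_orderIso (Submodule.orderIsoMapComap e)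
  · simp_rw [he]
    rw [← OrderIso.map_iSup, hF.2, OrderIso.map_top]

variable [FiniteDimensional ℂ E]

theorem conjSub_map (g : E →L[ℂ] E) (P : Submodule ℂ E) :
    D.conjSub (P.map (g : E →ₗ[ℂ] E)) = (D.conjSub P).map (D.bar g : E →ₗ[ℂ] E) := by
  ext v
  rw [mem_conjSub, Submodule.mem_map, Submodule.mem_map]
  constructor
  · rintro ⟨u, hu, h⟩
    refine ⟨D.conj u, by rwa [mem_conjSub, D.conj_conj], ?_⟩
    change D.bar g (D.conj u) = v
    rw [bar_apply_conj]
    change D.conj ((g : E →ₗ[ℂ] E) u) = v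
    rw [h, D.conj_conj]
  · rintro ⟨u, hu, rfl⟩
    exact ⟨D.conj u, hu, (D.conj_conj _).symm⟩

theorem oppFil_act {g : E →L[ℂ] E} (hg : Function.Injective (D.bar g))
    (hW : ∀ k, (D.W k).map (D.bar g : E →ₗ[ℂ] E) = D.W k) (p w : ℤ) :
    D.oppFil (act g F) p w = (D.oppFil F p w).map (D.bar g : E →ₗ[ℂ] E) := by
  simp only [oppFil, act, Submodule.map_iSup]
  refine iSup_congr fun k => iSup_congr fun _ => ?_
  rw [conjSub_map, Submodule.map_inf _ hg, hW]

theorem bigrCover_act {g : E →L[ℂ] E} (hg : Function.Injective (D.bar g))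
    (hW : ∀ k, (D.W k).map (D.bar g : E →ₗ[ℂ] E) = D.W k) (p q : ℤ) :
    D.bigrCover (act g F) p q = (D.bigrCover F p q).map (D.bar g : E →ₗ[ℂ] E) := by
  rw [bigrCover, oppFil_act hg hW, bigrCover, Submodule.map_sup, Submodule.map_inf _ hg, hW, act,
    conjSub_map]

theorem mapsBigr_of_isReal {g : (E →L[ℂ] E)ˣ} (hr : D.IsReal g)
    (hW : ∀ k, (D.W k).map ((g : E →L[ℂ] E) : E →ₗ[ℂ] E) = D.W k) : D.MapsBigr g F := by
  have hbar := D.isReal_iff.1 hr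
  have hg := unit_injective g
  intro p q
  rw [bigr_eq_inf, bigrCover_act (by rwa [hbar]) (by rwa [hbar]), hbar, bigr_eq_inf]
  exact (Submodule.map_inf ((g : E →L[ℂ] E) : E →ₗ[ℂ] E) hg).symm

namespace Decomposes

variable (hF : D.Decomposes F)
include hF

theorem pr_act {g : (E →L[ℂ] E)ˣ} (hg : D.MapsBigr g F) (x : ℤ × ℤ) :
    D.pr (MixedHodge.act g F) x = ↑g * D.pr F x * ↑g⁻¹ := by
  have hF' := hF.act hg
  refine (Units.eq_mul_inv_iff_mul_eq g).2 (hF.ext fun y v hv => ?_)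
  have hgv : (g : E →L[ℂ] E) v ∈ D.bigr (MixedHodge.act g F) y.1 y.2 := by
    rw [hg]
    exact Submodule.mem_map_of_mem hv
  rw [mul_apply_eq_comp, mul_apply_eq_comp]
  obtain rfl | hxy := eq_or_ne y x
  · rw [hF'.pr_of_mem hgv, hF.pr_of_mem hv]
  · rw [hF'.pr_of_mem_ne hxy hgv, hF.pr_of_mem_ne hxy hv, map_zero]

theorem comp_eq_multiplier (X : E →L[ℂ] E) (p q : ℤ) :
    D.comp F X p q = multiplier (D.pr F) (Pi.single (p, q) (1 : ℂ)) X := by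
  have hπ := hF.isGradingFamily
  have hfin : (Function.support fun x : ℤ × ℤ =>
      D.pr F (x + (p, q)) * X * D.pr F x).Finite :=
    hπ.finite_support.subset fun x hx h => hx (by
      change D.pr F (x + (p, q)) * X * D.pr F x = 0
      rw [h, mul_zero])
  have hcomp : D.comp F X p q = ∑ x ∈ hfin.toFinset, D.pr F (x + (p, q)) * X * D.pr F x :=
    finsum_eq_sum _ hfin
  refine hπ.eq_multiplier fun x y => ?_
  rw [hcomp, Finset.mul_sum, Finset.sum_mul]
  simp_rw [hπ.block_block]
  obtain hxy | hxy := eq_or_ne (x - y) (p, q)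
  · obtain rfl : x = y + (p, q) := by rw [← hxy, add_sub_cancel]
    rw [hxy, Pi.single_eq_same, one_smul, Finset.sum_eq_single y]
    · rw [if_pos ⟨rfl, rfl⟩]
    · exact fun z _ hz => if_neg fun h => hz h.2.symm
    · intro hy
      rw [Set.Finite.mem_toFinset, Function.notMem_support] at hy
      rw [hy, ite_self]
  · rw [Pi.single_eq_of_ne hxy, zero_smul]
    refine Finset.sum_eq_zero fun z _ => if_neg ?_
    rintro ⟨rfl, rfl⟩
    exact hxy (add_sub_cancel_left y (p, q))

theorem qPart_eq_multiplier (X : E →L[ℂ] E) : D.qPart F X =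
    multiplier (D.pr F) (fun d => if d.1 < 0 ∧ d.1 + d.2 ≤ 0 then (1 : ℂ) else 0) X := by
  have hsum := hF.isGradingFamily.finsum_smul_multiplier_single Function.injective_id
    (fun d => if d.1 < 0 ∧ d.1 + d.2 ≤ 0 then (1 : ℂ) else 0) X
  rw [show Function.extend id (fun d : ℤ × ℤ => if d.1 < 0 ∧ d.1 + d.2 ≤ 0 then (1 : ℂ) else 0) 0 =
    _ from funext (Function.injective_id.extend_apply _ _)] at hsum
  rw [← hsum]
  refine finsum_congr fun d => ?_
  rw [finsum_eq_if, hF.comp_eq_multiplier, ite_smul, one_smul, zero_smul]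
  rfl

theorem apply_mem_bigrSum {s : Set (ℤ × ℤ)}
    (hs : ∀ x y : ℤ × ℤ, x.1 < y.1 → x.2 < y.2 → y ∈ s → x ∈ s) {X : E →L[ℂ] E}
    (hX : X ∈ lowering ℂ (D.pr F) 1) {v : E} (hv : v ∈ D.bigrSum F s) : X v ∈ D.bigrSum F s := by
  rw [hF.mem_bigrSum_iff] at hv ⊢
  intro x hx
  have hsum : D.pr F x * X =
      ∑ y ∈ hF.isGradingFamily.finite_support.toFinset, D.pr F x * X * D.pr F y := by
    rw [← Finset.mul_sum, hF.isGradingFamily.sum_toFinset_eq_one, mul_one]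
  change (D.pr F x * X) v = 0
  rw [hsum, sum_apply]
  refine Finset.sum_eq_zero fun y _ => ?_
  by_cases hy : y ∈ s
  · rw [mem_lowering_one.1 hX x y fun h => hx (hs x y h.1 h.2 hy), zero_apply]
  · rw [mul_apply_eq_comp, hv y hy, map_zero]

theorem map_exp_bigrSum {s : Set (ℤ × ℤ)}
    (hs : ∀ x y : ℤ × ℤ, x.1 < y.1 → x.2 < y.2 → y ∈ s → x ∈ s) {X : E →L[ℂ] E}
    (hX : X ∈ lowering ℂ (D.pr F) 1) :
    (D.bigrSum F s).map ((NormedSpace.exp X : E →L[ℂ] E) : E →ₗ[ℂ] E) = D.bigrSum F s := by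
  have exp_mem {Y : E →L[ℂ] E} (hY : Y ∈ lowering ℂ (D.pr F) 1) {v : E} (hv : v ∈ D.bigrSum F s) :
      (NormedSpace.exp Y : E →L[ℂ] E) v ∈ D.bigrSum F s := by
    simpa using
      add_mem (hF.apply_mem_bigrSum hs (hF.isGradingFamily.exp_sub_one_mem_lowering hY) hv) hv
  refine le_antisymm (Submodule.map_le_iff_le_comap.2 fun v hv => exp_mem hX hv) fun v hv => ?_
  exact ⟨_, exp_mem (neg_mem hX) hv, DFunLike.congr_fun (expUnit ℂ X).mul_inv v⟩

end Decomposes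

namespace IsGradedPolarizedMHS

variable (hF : D.IsGradedPolarizedMHS F)
include hF

theorem map_exp_W {X : E →L[ℂ] E} (hX : X ∈ lowering ℂ (D.pr F) 1) (k : ℤ) :
    (D.W k).map ((NormedSpace.exp X : E →L[ℂ] E) : E →ₗ[ℂ] E) = D.W k := by
  rw [hF.W_eq_bigrSum]
  refine hF.decomposes.map_exp_bigrSum (fun x y h₁ h₂ hy => ?_) hX
  simp only [Set.mem_ofPred_eq] at hy ⊢
  omega

theorem map_exp_bigrCover {X : E →L[ℂ] E} (hX : X ∈ lowering ℂ (D.pr F) 1) (p q : ℤ) :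
    (D.bigrCover F p q).map ((NormedSpace.exp X : E →L[ℂ] E) : E →ₗ[ℂ] E) =
      D.bigrCover F p q := by
  rw [hF.bigrCover_eq_bigrSum]
  refine hF.decomposes.map_exp_bigrSum (fun x y h₁ h₂ hy => Or.inr ?_) hX
  obtain rfl | ⟨h₃, h₄⟩ := hy
  · exact ⟨h₁, by omega⟩
  · exact ⟨by omega, by omega⟩

theorem mapsBigr_exp {X : E →L[ℂ] E} (hX : X ∈ lowering ℂ (D.pr F) 1) :
    D.MapsBigr (NormedSpace.exp X) F := by
  have hX' := hF.bar_mem_lowering_iff.2 hX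
  intro p q
  rw [bigr_eq_inf, bigrCover_act, D.bar_exp, hF.map_exp_bigrCover hX', ← hF.map_exp_bigrCover hX,
    bigr_eq_inf]
  · exact (Submodule.map_inf _ (unit_injective (expUnit ℂ X))).symm
  · rw [D.bar_exp]
    exact unit_injective (expUnit ℂ (D.bar X))
  · rw [D.bar_exp]
    exact hF.map_exp_W hX'

theorem decomposes_act_exp {X : E →L[ℂ] E} (hX : X ∈ lowering ℂ (D.pr F) 1) :
    D.Decomposes (act (NormedSpace.exp X) F) :=
  hF.decomposes.act (g := expUnit ℂ X) (hF.mapsBigr_exp hX)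

theorem pr_act_exp {X : E →L[ℂ] E} (hX : X ∈ lowering ℂ (D.pr F) 1) (x : ℤ × ℤ) :
    D.pr (act (NormedSpace.exp X) F) x = NormedSpace.exp X * D.pr F x * NormedSpace.exp (-X) :=
  hF.decomposes.pr_act (g := expUnit ℂ X) (hF.mapsBigr_exp hX) x

theorem isSplit_act_exp_iff {X : E →L[ℂ] E} (hX : X ∈ lowering ℂ (D.pr F) 1)
    (hbar : D.bar X = -X) : D.IsSplit (act (NormedSpace.exp X) F) ↔
      ∀ x, NormedSpace.exp ((2 : ℂ) • X) * D.pr F x * NormedSpace.exp (-((2 : ℂ) • X)) =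
        D.prBar F x := by
  have hprBar (x : ℤ × ℤ) : D.prBar (act (NormedSpace.exp X) F) x =
      NormedSpace.exp (-X) * D.prBar F x * NormedSpace.exp X := by
    rw [prBar, hF.pr_act_exp hX, map_mul, map_mul, D.bar_exp, D.bar_exp, map_neg, hbar, neg_neg,
      prBar]
  have hsq : expUnit ℂ ((2 : ℂ) • X) = expUnit ℂ X * expUnit ℂ X := by
    rw [two_smul, expUnit_add_of_commute (Commute.refl X)]
  rw [(hF.decomposes_act_exp hX).isSplit_iff]
  refine forall_congr' fun x => ?_
  rw [hprBar, hF.pr_act_exp hX]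
  refine (inv_conj_eq_conj_iff (expUnit ℂ X)).trans ?_
  rw [← hsq]
  rfl

theorem isDelta_iff {δ : E →L[ℂ] E} :
    D.IsDelta F δ ↔ δ ∈ lowering ℂ (D.pr F) 1 ∧ D.bar δ = δ ∧
      ∀ x, NormedSpace.exp ((2 : ℂ) • -(Complex.I • δ)) * D.pr F x *
        NormedSpace.exp (-((2 : ℂ) • -(Complex.I • δ))) = D.prBar F x := by
  rw [IsDelta, hF.decomposes.mem_Lam_iff, D.isReal_iff]
  refine and_congr_right fun hδ => and_congr_right fun hbar =>
    hF.isSplit_act_exp_iff (neg_mem (Submodule.smul_mem _ _ hδ)) ?_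
  rw [map_neg, D.bar_smul, hbar, Complex.conj_I, neg_smul]

theorem bar_eq_neg_of_exp_conj_pr {X : E →L[ℂ] E} (hX : X ∈ lowering ℂ (D.pr F) 1)
    (h : ∀ x, NormedSpace.exp X * D.pr F x * NormedSpace.exp (-X) = D.prBar F x) :
    D.bar X = -X := by
  have hbarX := hF.bar_mem_lowering_iff.2 hX
  refine neg_eq_iff_eq_neg.1 (hF.decomposes.isGradingFamily.eq_of_exp_conj_eq (neg_mem hbarX) hX
    fun x => ?_)
  have hbar : NormedSpace.exp (D.bar X) * D.prBar F x * NormedSpace.exp (-D.bar X) =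
      D.pr F x := by
    have hx := congrArg D.bar (h x.swap)
    rwa [map_mul, map_mul, D.bar_exp, D.bar_exp, map_neg, prBar, Prod.swap_swap, D.bar_bar] at hx
  rw [h, neg_neg, ← hbar]
  change ↑(expUnit ℂ (D.bar X))⁻¹ * (↑(expUnit ℂ (D.bar X)) * D.prBar F x *
    ↑(expUnit ℂ (D.bar X))⁻¹) * ↑(expUnit ℂ (D.bar X)) = D.prBar F x
  simp only [mul_assoc, Units.inv_mul, Units.inv_mul_cancel_left, mul_one]

theorem existsUnique_isDelta : ∃! δ, D.IsDelta F δ := by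
  obtain ⟨L, ⟨hL, hconj⟩, huniq⟩ := hF.existsUnique_exp_conj_pr_eq_prBar
  have hcoef (δ : E →L[ℂ] E) : (2 : ℂ) • -(Complex.I • δ) = L ↔ δ = (Complex.I / 2) • L := by
    rw [smul_neg, smul_smul, ← neg_smul, eq_comm (b := L), eq_comm (b := (Complex.I / 2) • L),
      ← inv_smul_eq_iff₀ (by simp)]
    congr! 2
    simp
    ring
  refine ⟨(Complex.I / 2) • L, hF.isDelta_iff.2 ⟨Submodule.smul_mem _ _ hL, ?_, ?_⟩, fun δ hδ => ?_⟩
  · rw [D.bar_smul, hF.bar_eq_neg_of_exp_conj_pr hL hconj, map_div₀, Complex.conj_I, map_ofNat,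
      neg_div, neg_smul_neg]
  · rwa [(hcoef _).2 rfl]
  · obtain ⟨hmem, -, hδ⟩ := hF.isDelta_iff.1 hδ
    exact (hcoef δ).1
      (huniq _ ⟨Submodule.smul_mem _ 2 (neg_mem (Submodule.smul_mem _ Complex.I hmem)), hδ⟩)

end IsGradedPolarizedMHS

end Datum

end Action

/-! ### The universal polynomials of Cattani, Kaplan and Schmid -/

/-- The integral `∫₀¹ (1 - x)^m (1 + x)^n dx`. It is the value of `∑_l b^l_{m,n} / (l + 1)`, and its
positivity is what makes the equation for `η` solvable. -/
def betaInt (m n : ℕ) : ℝ := ∫ x in (0 : ℝ)..1, (1 - x) ^ m * (1 + x) ^ n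

theorem betaInt_pos (m n : ℕ) : 0 < betaInt m n := by
  refine intervalIntegral.intervalIntegral_pos_of_pos_on (Continuous.intervalIntegrable
    (by fun_prop) _ _) (fun x hx => ?_) one_pos
  have h1 := hx.1
  have h2 := sub_pos.2 hx.2
  positivity

section Coefficients

open Polynomial

theorem natDegree_one_sub_X_pow_mul_one_add_X_pow_le (m n : ℕ) :
    ((1 - X) ^ m * (1 + X) ^ n : ℤ[X]).natDegree ≤ m + n :=
  natDegree_mul_le_of_le (by compute_degree) (by compute_degree)

theorem sum_coeff_div_eq_betaInt {m n N : ℕ} (h : m + n < N) :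
    ∑ k ∈ Finset.range N, (((1 - X) ^ m * (1 + X) ^ n : ℤ[X]).coeff k : ℝ) / (k + 1) =
      betaInt m n := by
  have hdeg := (natDegree_one_sub_X_pow_mul_one_add_X_pow_le m n).trans_lt h
  set p : ℤ[X] := (1 - X) ^ m * (1 + X) ^ n with hp
  have heval (x : ℝ) : (1 - x) ^ m * (1 + x) ^ n =
      ∑ k ∈ Finset.range N, (p.coeff k : ℝ) * x ^ k := by
    have hmap : (p.map (Int.castRingHom ℝ)).eval x = (1 - x) ^ m * (1 + x) ^ n := by
      simp [hp]
    rw [← hmap, eval_eq_sum_range' (natDegree_map_le.trans_lt hdeg)]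
    simp only [coeff_map, eq_intCast]
  simp only [betaInt, heval]
  rw [intervalIntegral.integral_finsetSum fun k _ =>
    Continuous.intervalIntegrable (by fun_prop) _ _]
  refine Finset.sum_congr rfl fun k _ => ?_
  rw [intervalIntegral.integral_const_mul, integral_pow, one_pow, zero_pow k.succ_ne_zero,
    sub_zero, mul_one_div]

/-- The multiplier with `C_{l+2} = i • multiplier (slCoeff l) η`: its value at `(-p, -q)` with
`p, q ≥ 1` is `b^l_{p-1,q-1}`. -/
def slCoeff (l : ℕ) : ℤ × ℤ → ℂ :=
  Function.extend (fun x : ℕ × ℕ => (-((x.1 : ℤ) + 1), -((x.2 : ℤ) + 1)))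
    (fun x => (((1 - X) ^ x.1 * (1 + X) ^ x.2 : ℤ[X]).coeff l : ℂ)) 0

theorem injective_neg_succ_prod :
    Function.Injective fun x : ℕ × ℕ => (-((x.1 : ℤ) + 1), -((x.2 : ℤ) + 1)) := by
  rintro ⟨a, b⟩ ⟨c, d⟩ h
  simpa using h

theorem slCoeff_apply (l m n : ℕ) : slCoeff l (-((m : ℤ) + 1), -((n : ℤ) + 1)) =
    (((1 - X) ^ m * (1 + X) ^ n : ℤ[X]).coeff l : ℂ) :=
  injective_neg_succ_prod.extend_apply _ _ (m, n)

end Coefficients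

theorem exists_eq_neg_succ_prod {d : ℤ × ℤ} (h₁ : d.1 < 0) (h₂ : d.2 < 0) :
    ∃ m n : ℕ, d = (-((m : ℤ) + 1), -((n : ℤ) + 1)) :=
  ⟨(-d.1 - 1).toNat, (-d.2 - 1).toNat, Prod.ext (by dsimp only; omega) (by dsimp only; omega)⟩

/-- The multiplier for which the part of `∑ P_k` that is linear in `η` is
`-i • multiplier slLinear η`. -/
def slLinear (d : ℤ × ℤ) : ℝ := betaInt (-d.1 - 1).toNat (-d.2 - 1).toNat

theorem slLinear_pos (d : ℤ × ℤ) : 0 < slLinear d := betaInt_pos _ _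

theorem sum_slCoeff_div_eq_slLinear {d : ℤ × ℤ} (h₁ : d.1 < 0) (h₂ : d.2 < 0) {N : ℕ}
    (hN : -d.1 + -d.2 ≤ N) :
    ∑ k ∈ Finset.range N, 1 / ((k : ℂ) + 1) * slCoeff k d = slLinear d := by
  obtain ⟨m, n, rfl⟩ := exists_eq_neg_succ_prod h₁ h₂
  have hm : (-(-((m : ℤ) + 1)) - 1).toNat = m := by omega
  have hn : (-(-((n : ℤ) + 1)) - 1).toNat = n := by omega
  dsimp only at hN
  rw [slLinear, hm, hn, ← sum_coeff_div_eq_betaInt (N := N) (by omega), Complex.ofReal_sum]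
  refine Finset.sum_congr rfl fun k _ => ?_
  rw [slCoeff_apply]
  push_cast
  ring

theorem slCoeff_eq_zero {d : ℤ × ℤ} (h₁ : d.1 < 0) (h₂ : d.2 < 0) {l : ℕ}
    (hl : -d.1 + -d.2 ≤ l) : slCoeff l d = 0 := by
  obtain ⟨m, n, rfl⟩ := exists_eq_neg_succ_prod h₁ h₂
  dsimp only at hl
  rw [slCoeff_apply, Polynomial.coeff_eq_zero_of_natDegree_lt
    ((natDegree_one_sub_X_pow_mul_one_add_X_pow_le m n).trans_lt (by omega)), Int.cast_zero]

namespace Datum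

variable {E : Type*} [NormedAddCommGroup E] [NormedSpace ℂ E] [FiniteDimensional ℂ E]

variable {D : Datum E} {F : ℤ → Submodule ℂ E}

theorem slP_zero (η : E →L[ℂ] E) : D.slP F η 0 = 1 := by
  rw [slP]

theorem slP_succ (η : E →L[ℂ] E) (k : ℕ) : D.slP F η (k + 1) = (-(1 / ((k : ℂ) + 1))) •
    (∑ j ∈ Finset.range k, D.slP F η (k - j) * D.slC F η j + D.slC F η k) := by
  rw [slP, Fin.sum_univ_eq_sum_range (fun j => D.slP F η (k - j) * D.slC F η j) (k + 1),
    Finset.sum_range_succ, Nat.sub_self, slP_zero, one_mul]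

theorem finsum_slP_eq_sum {η : E →L[ℂ] E} {N : ℕ} (hN : ∀ k, N ≤ k → D.slP F η (k + 1) = 0) :
    ∑ᶠ k, D.slP F η k = 1 + ∑ k ∈ Finset.range N, D.slP F η (k + 1) := by
  rw [finsum_eq_sum_of_support_subset (s := Finset.range (N + 1)), Finset.sum_range_succ',
    slP_zero, add_comm]
  intro k hk
  rw [Finset.coe_range, Set.mem_Iio]
  contrapose! hk
  obtain ⟨j, rfl⟩ : ∃ j, k = j + 1 := ⟨k - 1, by omega⟩
  exact Function.notMem_support.2 (hN j (by omega))

theorem bar_mem_lowering_of_split (hs : D.prBar F = D.pr F) {n : ℕ} {X : E →L[ℂ] E}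
    (hX : X ∈ lowering ℂ (D.pr F) n) : D.bar X ∈ lowering ℂ (D.pr F) n :=
  hs ▸ bar_mem_lowering_prBar_iff.2 hX

namespace Decomposes

variable (hF : D.Decomposes F)
include hF

theorem slC_eq_smul_multiplier (η : E →L[ℂ] E) (l : ℕ) :
    D.slC F η l = Complex.I • multiplier (D.pr F) (slCoeff l) η := by
  simp only [slC, hF.comp_eq_multiplier]
  rw [hF.isGradingFamily.finsum_smul_multiplier_single injective_neg_succ_prod
    (fun x => (((1 - Polynomial.X) ^ x.1 * (1 + Polynomial.X) ^ x.2 :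
      Polynomial ℤ).coeff l : ℂ)), slCoeff]

theorem slC_mem_lowering {n : ℕ} {η : E →L[ℂ] E} (hη : η ∈ lowering ℂ (D.pr F) n) (l : ℕ) :
    D.slC F η l ∈ lowering ℂ (D.pr F) n := by
  rw [hF.slC_eq_smul_multiplier]
  exact Submodule.smul_mem _ _ (hF.isGradingFamily.multiplier_mem_lowering _ hη)

theorem slC_sub (η η' : E →L[ℂ] E) (l : ℕ) :
    D.slC F (η - η') l = D.slC F η l - D.slC F η' l := by
  simp only [hF.slC_eq_smul_multiplier, hF.isGradingFamily.multiplier_sub, smul_sub]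

theorem exists_slC_eq_zero : ∃ L : ℕ, ∀ η ∈ lowering ℂ (D.pr F) 1, ∀ l, L ≤ l →
    D.slC F η l = 0 := by
  have hπ := hF.isGradingFamily
  obtain ⟨N, hN⟩ := hπ.exists_index_le_add
  refine ⟨N + N, fun η hη l hl => hπ.ext_blocks fun x y => ?_⟩
  rw [hF.slC_eq_smul_multiplier, mul_smul_comm, smul_mul_assoc, hπ.block_multiplier, mul_zero,
    zero_mul, smul_smul]
  by_cases hx : D.pr F x = 0
  · rw [hx, zero_mul, zero_mul, smul_zero]
  by_cases hy : D.pr F y = 0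
  · rw [hy, mul_zero, smul_zero]
  by_cases hxy : x.1 < y.1 ∧ x.2 < y.2
  · have hle := hN x y hx hy
    rw [slCoeff_eq_zero (sub_neg.2 hxy.1) (sub_neg.2 hxy.2), mul_zero, zero_smul]
    simp only [Prod.fst_sub, Prod.snd_sub]
    omega
  · rw [hη x y hxy, smul_zero]

theorem sum_slC_eq {θ : E →L[ℂ] E} (hθ : θ ∈ lowering ℂ (D.pr F) 1) {L : ℕ}
    (hL : ∀ x y, D.pr F x ≠ 0 → D.pr F y ≠ 0 → y.1 + y.2 ≤ x.1 + x.2 + L) :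
    ∑ k ∈ Finset.range L, (1 / ((k : ℂ) + 1)) • D.slC F θ k =
      Complex.I • multiplier (D.pr F) (fun d => (slLinear d : ℂ)) θ := by
  have hπ := hF.isGradingFamily
  simp only [hF.slC_eq_smul_multiplier, smul_comm _ Complex.I]
  rw [← Finset.smul_sum]
  congr 1
  refine hπ.eq_multiplier fun x y => ?_
  simp only [Finset.mul_sum, Finset.sum_mul, mul_smul_comm, smul_mul_assoc, hπ.block_multiplier,
    smul_smul, ← Finset.sum_smul]
  by_cases hx : D.pr F x = 0
  · rw [hx, zero_mul, zero_mul, smul_zero, smul_zero]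
  by_cases hy : D.pr F y = 0
  · rw [hy, mul_zero, smul_zero, smul_zero]
  by_cases hxy : x.1 < y.1 ∧ x.2 < y.2
  · have hle := hL x y hx hy
    rw [sum_slCoeff_div_eq_slLinear (sub_neg.2 hxy.1) (sub_neg.2 hxy.2)]
    simp only [Prod.fst_sub, Prod.snd_sub]
    omega
  · rw [hθ x y hxy, smul_zero, smul_zero]

/- `P_{k+1}` is a sum of products of the `C_{j+2}` with `∑ (j + 1) = k + 1`; if only `L` of the
`C_{j+2}` are nonzero, then each product has more than `k / L` factors. -/
theorem slP_succ_mem_lowering {η : E →L[ℂ] E} (hη : η ∈ lowering ℂ (D.pr F) 1) {L : ℕ}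
    (hL : ∀ l, L ≤ l → D.slC F η l = 0) (n : ℕ) {k : ℕ} (hk : n * L ≤ k) :
    D.slP F η (k + 1) ∈ lowering ℂ (D.pr F) (n + 1) := by
  induction k using Nat.strong_induction_on generalizing n with
  | _ k ih =>
    have hC := hF.slC_mem_lowering hη
    have hprod (m : ℕ) {j : ℕ} (hj : j < k) (hmj : m * L ≤ k - j - 1) :
        D.slP F η (k - j) * D.slC F η j ∈ lowering ℂ (D.pr F) (m + 1 + 1) := by
      have hP := ih (k - j - 1) (by omega) m hmj
      rw [show k - j - 1 + 1 = k - j by omega] at hP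
      exact hF.isGradingFamily.mul_mem_lowering hP (hC j)
    rw [slP_succ]
    refine Submodule.smul_mem _ _ (add_mem (sum_mem fun j hj => ?_) ?_)
    all_goals cases n with
      | zero => _
      | succ n => _
    · exact lowering_antitone _ (by omega) (hprod 0 (Finset.mem_range.1 hj) (by omega))
    · by_cases hjL : L ≤ j
      · rw [hL j hjL, mul_zero]
        exact zero_mem _
      · rw [Nat.succ_mul] at hk
        exact hprod n (Finset.mem_range.1 hj) (by omega)
    · exact hC k
    · rw [hL k (by rw [Nat.succ_mul] at hk; omega)]
      exact zero_mem _

theorem slP_succ_mem_lowering_one {η : E →L[ℂ] E} (hη : η ∈ lowering ℂ (D.pr F) 1) (k : ℕ) :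
    D.slP F η (k + 1) ∈ lowering ℂ (D.pr F) 1 := by
  obtain ⟨L, hL⟩ := hF.exists_slC_eq_zero
  exact hF.slP_succ_mem_lowering hη (hL η hη) 0 (by omega)

theorem exists_slP_eq_zero : ∃ N : ℕ, ∀ η ∈ lowering ℂ (D.pr F) 1, ∀ k, N ≤ k →
    D.slP F η (k + 1) = 0 := by
  obtain ⟨L, hL⟩ := hF.exists_slC_eq_zero
  obtain ⟨M, hM⟩ := hF.isGradingFamily.exists_lowering_eq_bot ℂ
  refine ⟨M * L, fun η hη k hk => ?_⟩
  have hmem := lowering_antitone _ M.le_succ (hF.slP_succ_mem_lowering hη (hL η hη) M hk)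
  rwa [hM, Submodule.mem_bot] at hmem

theorem finsum_slP_sub_one_mem_lowering {η : E →L[ℂ] E} (hη : η ∈ lowering ℂ (D.pr F) 1) :
    ∑ᶠ k, D.slP F η k - 1 ∈ lowering ℂ (D.pr F) 1 := by
  obtain ⟨N, hN⟩ := hF.exists_slP_eq_zero
  rw [finsum_slP_eq_sum (hN η hη), add_sub_cancel_left]
  exact sum_mem fun k _ => hF.slP_succ_mem_lowering_one hη k

theorem slP_succ_sub_mem_lowering {n : ℕ} {η η' : E →L[ℂ] E} (hη : η ∈ lowering ℂ (D.pr F) 1)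
    (hη' : η' ∈ lowering ℂ (D.pr F) 1) (h : η - η' ∈ lowering ℂ (D.pr F) n) (k : ℕ) :
    D.slP F η (k + 1) - D.slP F η' (k + 1) + (1 / ((k : ℂ) + 1)) • D.slC F (η - η') k ∈
      lowering ℂ (D.pr F) (n + 1) := by
  have hπ := hF.isGradingFamily
  induction k using Nat.strong_induction_on with
  | _ k ih =>
    have hcancel (a : ℂ) (S S' T T' : E →L[ℂ] E) :
        (-a) • (S + T) - (-a) • (S' + T') + a • (T - T') = (-a) • (S - S') := by module
    have htelescope (a a' b b' : E →L[ℂ] E) : a * b - a' * b' = a * (b - b') + (a - a') * b' := by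
      noncomm_ring
    rw [slP_succ, slP_succ, hF.slC_sub, hcancel, ← Finset.sum_sub_distrib]
    refine Submodule.smul_mem _ _ (sum_mem fun j hj => ?_)
    have hjk := Finset.mem_range.1 hj
    have hP := hF.slP_succ_mem_lowering_one hη (k - j - 1)
    have hsub := sub_mem (lowering_antitone _ n.le_succ (ih (k - j - 1) (by omega)))
      (Submodule.smul_mem _ (1 / (((k - j - 1 : ℕ) : ℂ) + 1)) (hF.slC_mem_lowering h (k - j - 1)))
    rw [add_sub_cancel_right] at hsub
    rw [show k - j - 1 + 1 = k - j by omega] at hP hsub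
    rw [htelescope, ← hF.slC_sub]
    exact add_mem (add_comm n 1 ▸ hπ.mul_mem_lowering hP (hF.slC_mem_lowering h j))
      (hπ.mul_mem_lowering hsub (hF.slC_mem_lowering hη' j))

theorem finsum_slP_sub_mem_lowering {n : ℕ} {η η' : E →L[ℂ] E}
    (hη : η ∈ lowering ℂ (D.pr F) 1) (hη' : η' ∈ lowering ℂ (D.pr F) 1)
    (h : η - η' ∈ lowering ℂ (D.pr F) n) :
    ∑ᶠ k, D.slP F η k - ∑ᶠ k, D.slP F η' k +
      Complex.I • multiplier (D.pr F) (fun d => (slLinear d : ℂ)) (η - η') ∈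
        lowering ℂ (D.pr F) (n + 1) := by
  obtain ⟨N, hN⟩ := hF.exists_slP_eq_zero
  obtain ⟨M, hM⟩ := hF.isGradingFamily.exists_index_le_add
  rw [finsum_slP_eq_sum fun k hk => hN η hη k ((le_max_left N (M + M)).trans hk),
    finsum_slP_eq_sum fun k hk => hN η' hη' k ((le_max_left N (M + M)).trans hk),
    ← hF.sum_slC_eq (sub_mem hη hη') (L := max N (M + M)) fun x y hx hy => by
      have hle := hM x y hx hy
      omega,
    add_sub_add_left_eq_sub, ← Finset.sum_sub_distrib, ← Finset.sum_add_distrib]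
  exact sum_mem fun k _ => hF.slP_succ_sub_mem_lowering hη hη' h k

theorem bar_multiplier_of_split (hs : D.prBar F = D.pr F) (m : ℤ × ℤ → ℂ) (X : E →L[ℂ] E) :
    D.bar (multiplier (D.pr F) m X) =
      multiplier (D.pr F) (fun d => starRingEnd ℂ (m d.swap)) (D.bar X) := by
  have hπ := hF.isGradingFamily
  have hpr (x : ℤ × ℤ) : D.pr F x = D.bar (D.pr F x.swap) := (congrFun hs x).symm
  refine hπ.eq_multiplier fun x y => ?_
  rw [hpr x, hpr y, ← map_mul, ← map_mul, hπ.block_multiplier, D.bar_smul, map_mul, map_mul,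
    Prod.swap_sub]

theorem smul_sub_bar_add_multiplier_mem_lowering (hs : D.prBar F = D.pr F) {b : ℤ × ℤ → ℝ}
    {n : ℕ} {A θ : E →L[ℂ] E} (hθ : D.bar θ = θ)
    (h : A + Complex.I • multiplier (D.pr F) (fun d => (b d : ℂ)) θ ∈ lowering ℂ (D.pr F) n) :
    -Complex.I • (A - D.bar A) +
      multiplier (D.pr F) (fun d => ((b d + b d.swap : ℝ) : ℂ)) θ ∈ lowering ℂ (D.pr F) n := by
  have hπ := hF.isGradingFamily
  set B := multiplier (D.pr F) (fun d => (b d : ℂ)) θ with hB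
  have hbar : D.bar B = multiplier (D.pr F) (fun d => (b d.swap : ℂ)) θ := by
    rw [hB, hF.bar_multiplier_of_split hs, hθ]
    simp only [Complex.conj_ofReal]
  have hsum : multiplier (D.pr F) (fun d => ((b d + b d.swap : ℝ) : ℂ)) θ = B + D.bar B :=
    (hπ.eq_multiplier fun x y => by
      rw [hbar, mul_add, add_mul, hπ.block_multiplier, hπ.block_multiplier, ← add_smul,
        Complex.ofReal_add]).symm
  have hmem := Submodule.smul_mem _ (-Complex.I) (sub_mem h (bar_mem_lowering_of_split hs h))
  convert hmem using 1
  rw [hsum, map_add, D.bar_smul, Complex.conj_I]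
  match_scalars <;> simp

/- For real `η`, the linear part of `-i (Y η - bar (Y η))` is `-multiplier c η` with the positive
multiplier `c d = b d + b d.swap`, so that the iteration `η ↦ η + c⁻¹ (-i (Y η - bar (Y η)))`
is contracting. -/
theorem existsUnique_real_of_linear_part (hs : D.prBar F = D.pr F) {b : ℤ × ℤ → ℝ}
    (hb : ∀ d, 0 < b d) {Y : (E →L[ℂ] E) → (E →L[ℂ] E)}
    (hY : ∀ η ∈ lowering ℂ (D.pr F) 1, Y η - 1 ∈ lowering ℂ (D.pr F) 1)
    (hlin : ∀ n, ∀ η ∈ lowering ℂ (D.pr F) 1, ∀ η' ∈ lowering ℂ (D.pr F) 1,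
      η - η' ∈ lowering ℂ (D.pr F) n → Y η - Y η' +
        Complex.I • multiplier (D.pr F) (fun d => (b d : ℂ)) (η - η') ∈
          lowering ℂ (D.pr F) (n + 1)) :
    ∃! η, (η ∈ lowering ℂ (D.pr F) 1 ∧ D.bar η = η) ∧ D.bar (Y η) = Y η := by
  have hπ := hF.isGradingFamily
  set c : ℤ × ℤ → ℂ := fun d => ((b d + b d.swap : ℝ) : ℂ) with hc
  have hc₀ (d : ℤ × ℤ) : c d ≠ 0 := Complex.ofReal_ne_zero.2 (add_pos (hb d) (hb d.swap)).ne'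
  set Z : (E →L[ℂ] E) → (E →L[ℂ] E) := fun η => -Complex.I • (Y η - D.bar (Y η)) with hZ
  have hZ_mem : ∀ η ∈ lowering ℂ (D.pr F) 1, Z η ∈ lowering ℂ (D.pr F) 1 := fun η hη => by
    have hmem := sub_mem (hY η hη) (bar_mem_lowering_of_split hs (hY η hη))
    rw [map_sub, map_one, sub_sub_sub_cancel_right] at hmem
    exact Submodule.smul_mem _ _ hmem
  have hZ_real (η : E →L[ℂ] E) : D.bar (multiplier (D.pr F) (fun d => (c d)⁻¹) (Z η)) =
      multiplier (D.pr F) (fun d => (c d)⁻¹) (Z η) := by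
    rw [hF.bar_multiplier_of_split hs]
    congr 1
    · simp only [hc, map_inv₀, Complex.conj_ofReal, Prod.swap_swap, add_comm]
    · simp only [hZ, D.bar_smul, map_sub, D.bar_bar, map_neg, Complex.conj_I, neg_neg]
      rw [← neg_sub (Y η), smul_neg, neg_smul]
  have hfix := hπ.existsUnique_fixedPoint (S := {η | η ∈ lowering ℂ (D.pr F) 1 ∧ D.bar η = η})
    ⟨0, zero_mem _, map_zero _⟩ (fun η hη => hη.1)
    (f := fun η => η + multiplier (D.pr F) (fun d => (c d)⁻¹) (Z η))
    (fun η hη => ⟨add_mem hη.1 (hπ.multiplier_mem_lowering _ (hZ_mem η hη.1)), by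
      rw [map_add, hη.2, hZ_real]⟩)
    fun n η hη η' hη' h => by
      have hmem := hπ.multiplier_mem_lowering (fun d => (c d)⁻¹)
        (hF.smul_sub_bar_add_multiplier_mem_lowering hs (by rw [map_sub, hη.2, hη'.2])
          (hlin n η hη.1 η' hη'.1 h))
      convert hmem using 1
      rw [hπ.multiplier_add, hπ.multiplier_inv_multiplier hc₀, map_sub, add_sub_add_comm,
        ← hπ.multiplier_sub, add_comm, ← smul_sub, sub_sub_sub_comm]
  have hiff (η : E →L[ℂ] E) :
      η + multiplier (D.pr F) (fun d => (c d)⁻¹) (Z η) = η ↔ D.bar (Y η) = Y η := by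
    rw [add_eq_left, hπ.multiplier_eq_zero_iff fun d => inv_ne_zero (hc₀ d), hZ, smul_eq_zero,
      or_iff_right (neg_ne_zero.2 Complex.I_ne_zero), sub_eq_zero, eq_comm]
  simpa only [Set.mem_ofPred_eq, hiff] using hfix

theorem existsUnique_real_finsum_slP_mul (hs : D.prBar F = D.pr F) {v : E →L[ℂ] E}
    (hv : v - 1 ∈ lowering ℂ (D.pr F) 1) :
    ∃! η, (η ∈ lowering ℂ (D.pr F) 1 ∧ D.bar η = η) ∧
      D.bar ((∑ᶠ k, D.slP F η k) * v) = (∑ᶠ k, D.slP F η k) * v := by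
  have hπ := hF.isGradingFamily
  refine hF.existsUnique_real_of_linear_part hs slLinear_pos
    (fun η hη => hπ.mul_sub_one_mem_lowering (hF.finsum_slP_sub_one_mem_lowering hη) hv)
    fun n η hη η' hη' h => ?_
  have hlin := hF.finsum_slP_sub_mem_lowering hη hη' h
  set P := ∑ᶠ k, D.slP F η k
  set P' := ∑ᶠ k, D.slP F η' k
  set B := Complex.I • multiplier (D.pr F) (fun d => (slLinear d : ℂ)) (η - η')
  have hsub : P - P' ∈ lowering ℂ (D.pr F) n := by
    rw [← add_sub_cancel_right (P - P') B]
    exact sub_mem (lowering_antitone _ n.le_succ hlin)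
      (Submodule.smul_mem _ Complex.I (hπ.multiplier_mem_lowering _ h))
  have hmem := add_mem hlin (hπ.mul_mem_lowering hsub hv)
  convert hmem using 1
  noncomm_ring

end Decomposes

end Datum

section Equivariance

/-- Conjugation by a unit, as an algebra automorphism. -/
def conjEquiv {A : Type*} [Ring A] [Algebra ℂ A] (u : Aˣ) : A ≃ₐ[ℂ] A :=
  MulSemiringAction.toAlgEquiv ℂ A (ConjAct.toConjAct u)

theorem conjEquiv_apply {A : Type*} [Ring A] [Algebra ℂ A] (u : Aˣ) (X : A) :
    conjEquiv u X = ↑u * X * ↑u⁻¹ := rfl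

theorem conjEquiv_mul {A : Type*} [Ring A] [Algebra ℂ A] (u v : Aˣ) (X : A) :
    conjEquiv (u * v) X = conjEquiv u (conjEquiv v X) := by
  simp only [conjEquiv_apply, mul_inv_rev, Units.val_mul, mul_assoc]

theorem conjEquiv_exp {A : Type*} [NormedRing A] [NormedAlgebra ℂ A] [CompleteSpace A] (u : Aˣ)
    (X : A) : conjEquiv u (NormedSpace.exp X) = NormedSpace.exp (conjEquiv u X) :=
  map_exp (𝕜 := ℂ) (conjEquiv u : A →+* A)
    ((continuous_const.mul continuous_id).mul continuous_const) X

variable {E : Type*} [NormedAddCommGroup E] [NormedSpace ℂ E]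

theorem act_conjEquiv (t : (E →L[ℂ] E)ˣ) (g : E →L[ℂ] E) (F : ℤ → Submodule ℂ E) :
    act (conjEquiv t g) (act t F) = act t (act g F) := by
  rw [← act_mul, ← act_mul, conjEquiv_apply, Units.inv_mul_cancel_right]

namespace Datum

variable [FiniteDimensional ℂ E] {D : Datum E} {F : ℤ → Submodule ℂ E}

/-! ### Existence and uniqueness of `ζ` and `ε` -/

namespace IsGradedPolarizedMHS

variable (hF : D.IsGradedPolarizedMHS F)
include hF

theorem lowering_pr_act_exp {X : E →L[ℂ] E} (hX : X ∈ lowering ℂ (D.pr F) 1) (n : ℕ) :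
    lowering ℂ (D.pr (act (NormedSpace.exp X) F)) n = lowering ℂ (D.pr F) n := by
  rw [funext (hF.pr_act_exp hX), hF.decomposes.isGradingFamily.lowering_exp_conj hX]

theorem isZeta_iff {δ ζ : E →L[ℂ] E} : D.IsZeta F δ ζ ↔
    ζ ∈ lowering ℂ (D.pr F) 1 ∧ D.bar ζ = ζ ∧ ∃ η, (η ∈ lowering ℂ (D.pr F) 1 ∧ D.bar η = η) ∧
      (∑ᶠ k, D.slP (act (NormedSpace.exp (-(Complex.I • δ))) F) η k) *
        NormedSpace.exp (-(Complex.I • δ)) = NormedSpace.exp (-ζ) := by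
  simp only [IsZeta, hF.decomposes.mem_Lam_iff, D.isReal_iff, and_assoc]
  refine and_congr_right fun _ => and_congr_right fun _ => exists_congr fun η =>
    and_congr_right fun _ => and_congr_right fun _ => ?_
  exact (Units.inv_mul_eq_iff_eq_mul (expUnit ℂ ζ)).symm.trans <|
    eq_comm.trans (Units.mul_inv_eq_iff_eq_mul (expUnit ℂ (Complex.I • δ))).symm

theorem existsUnique_isZeta {δ : E →L[ℂ] E} (hδ : D.IsDelta F δ) : ∃! ζ, D.IsZeta F δ ζ := by
  have hπ := hF.decomposes.isGradingFamily
  have hX : -(Complex.I • δ) ∈ lowering ℂ (D.pr F) 1 :=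
    neg_mem (Submodule.smul_mem _ _ (hF.decomposes.mem_Lam_iff.1 hδ.1))
  have hF' := hF.decomposes_act_exp hX
  have hv := hπ.exp_sub_one_mem_lowering hX
  have hP {η : E →L[ℂ] E} (hη : η ∈ lowering ℂ (D.pr F) 1) :=
    hF'.finsum_slP_sub_one_mem_lowering (by rwa [hF.lowering_pr_act_exp hX])
  obtain ⟨η, ⟨hη, hreal⟩, hη_unique⟩ := hF'.existsUnique_real_finsum_slP_mul
    (funext (hF'.isSplit_iff.1 hδ.2.2)) (by rwa [hF.lowering_pr_act_exp hX])
  simp only [hF.lowering_pr_act_exp hX] at hP hη hη_unique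
  obtain ⟨L, ⟨hL, hexp⟩, -⟩ := hπ.existsUnique_log (hπ.mul_sub_one_mem_lowering (hP hη.1) hv)
  have hL_real : D.bar L = L := by
    refine hπ.exp_injOn ℂ (hF.bar_mem_lowering_iff.2 hL) hL ?_
    rw [← D.bar_exp, hexp, hreal]
  refine ⟨-L, hF.isZeta_iff.2 ⟨neg_mem hL, by rw [map_neg, hL_real], η, hη, ?_⟩, fun ζ hζ => ?_⟩
  · rw [neg_neg, hexp]
  · obtain ⟨hζ, hζ_real, η', hη', heq⟩ := hF.isZeta_iff.1 hζ
    obtain rfl : η' = η := hη_unique η' ⟨hη', by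
      rw [heq, D.bar_exp, map_neg, hζ_real]⟩
    exact neg_eq_iff_eq_neg.1 (hπ.exp_injOn ℂ (neg_mem hζ) hL (heq.symm.trans hexp.symm))

theorem existsUnique_isEps : ∃! ε, D.IsEps F ε := by
  have hπ := hF.decomposes.isGradingFamily
  obtain ⟨δ, hδ, hδ_unique⟩ := hF.existsUnique_isDelta
  obtain ⟨ζ, hζ, hζ_unique⟩ := hF.existsUnique_isZeta hδ
  have hδ_mem := hF.decomposes.mem_Lam_iff.1 hδ.1
  have hζ_mem := hF.decomposes.mem_Lam_iff.1 hζ.1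
  obtain ⟨ε, ⟨hε, hexp⟩, hε_unique⟩ := hπ.existsUnique_log (hπ.mul_sub_one_mem_lowering
    (hπ.exp_sub_one_mem_lowering (Submodule.smul_mem _ Complex.I hδ_mem))
    (hπ.exp_sub_one_mem_lowering (neg_mem hζ_mem)))
  refine ⟨ε, ⟨hF.decomposes.mem_Lam_iff.2 hε, δ, ζ, hδ, hζ, hexp⟩, ?_⟩
  rintro ε' ⟨hε', δ', ζ', hδ', hζ', heq⟩
  obtain rfl := hδ_unique δ' hδ'
  obtain rfl := hζ_unique ζ' hζ'
  exact hε_unique ε' ⟨hF.decomposes.mem_Lam_iff.1 hε', heq⟩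

theorem isEps_eps : D.IsEps F (D.eps F) := Classical.epsilon_spec hF.existsUnique_isEps.exists

theorem eps_mem_lowering : D.eps F ∈ lowering ℂ (D.pr F) 1 :=
  hF.decomposes.mem_Lam_iff.1 hF.isEps_eps.1

/- `e^{-ε} = e^ζ e^{-iδ}` with `ζ` real, and `(e^{-iδ}.F, W)` is split over `ℝ`. -/
theorem bar_exp_eps_conj_pr (x : ℤ × ℤ) :
    D.bar (NormedSpace.exp (-D.eps F) * D.pr F x.swap * NormedSpace.exp (D.eps F)) =
      NormedSpace.exp (-D.eps F) * D.pr F x * NormedSpace.exp (D.eps F) := by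
  obtain ⟨-, δ, ζ, hδ, hζ, hexp⟩ := hF.isEps_eps
  have hX : -(Complex.I • δ) ∈ lowering ℂ (D.pr F) 1 :=
    neg_mem (Submodule.smul_mem _ _ (hF.decomposes.mem_Lam_iff.1 hδ.1))
  have hsplit := (hF.decomposes_act_exp hX).isSplit_iff.1 hδ.2.2 x
  rw [prBar] at hsplit
  have hunit : expUnit ℂ (-D.eps F) = expUnit ℂ ζ * expUnit ℂ (-(Complex.I • δ)) := by
    rw [← expUnit_inv, inv_eq_iff_eq_inv, mul_inv_rev, expUnit_inv, expUnit_inv, neg_neg]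
    exact Units.ext hexp
  have hconj (y : ℤ × ℤ) :
      NormedSpace.exp (-D.eps F) * D.pr F y * NormedSpace.exp (D.eps F) =
        NormedSpace.exp ζ * D.pr (act (NormedSpace.exp (-(Complex.I • δ))) F) y *
          NormedSpace.exp (-ζ) := by
    have hconj := conjEquiv_mul (expUnit ℂ ζ) (expUnit ℂ (-(Complex.I • δ))) (D.pr F y)
    rw [← hunit, conjEquiv_apply, expUnit_inv, neg_neg] at hconj
    rw [hF.pr_act_exp hX]
    exact hconj
  rw [hconj, hconj, map_mul, map_mul, hsplit, D.bar_exp, D.bar_exp, map_neg,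
    D.isReal_iff.1 hζ.2.1]

end IsGradedPolarizedMHS

/-! ### Equivariance under real automorphisms -/

/-- `t` is an automorphism of `E` which is defined over `ℝ` and preserves `W`. It need not be an
isometry of `Gr^W`. -/
structure IsRealAut (D : Datum E) (t : (E →L[ℂ] E)ˣ) : Prop where
  real : D.bar t = t
  map_W : ∀ k, (D.W k).map ((t : E →L[ℂ] E) : E →ₗ[ℂ] E) = D.W k

namespace IsRealAut

variable {t : (E →L[ℂ] E)ˣ} (ht : D.IsRealAut t)
include ht

theorem mapsBigr : D.MapsBigr t F := mapsBigr_of_isReal (D.isReal_iff.2 ht.real) ht.map_W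

theorem decomposes_act (hF : D.Decomposes F) : D.Decomposes (act t F) := hF.act ht.mapsBigr

theorem bar_conjEquiv (X : E →L[ℂ] E) : D.bar (conjEquiv t X) = conjEquiv t (D.bar X) := by
  have hinv : D.bar ↑t⁻¹ = ↑t⁻¹ := by
    refine (Units.inv_eq_of_mul_eq_one_right ?_).symm
    rw [← ht.real, ← map_mul, Units.mul_inv, map_one]
  simp only [conjEquiv_apply, map_mul, ht.real, hinv]

theorem pr_act (hF : D.Decomposes F) (x : ℤ × ℤ) : D.pr (act t F) x = conjEquiv t (D.pr F x) :=
  hF.pr_act ht.mapsBigr x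

theorem multiplier_act (hF : D.Decomposes F) (m : ℤ × ℤ → ℂ) (X : E →L[ℂ] E) :
    multiplier (D.pr (act t F)) m (conjEquiv t X) = conjEquiv t (multiplier (D.pr F) m X) := by
  rw [funext (ht.pr_act hF)]
  exact hF.isGradingFamily.multiplier_conj t m X

theorem comp_act (hF : D.Decomposes F) (X : E →L[ℂ] E) (p q : ℤ) :
    D.comp (act t F) (conjEquiv t X) p q = conjEquiv t (D.comp F X p q) := by
  rw [(ht.decomposes_act hF).comp_eq_multiplier, hF.comp_eq_multiplier, ht.multiplier_act hF]

theorem qPart_act (hF : D.Decomposes F) (X : E →L[ℂ] E) :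
    D.qPart (act t F) (conjEquiv t X) = conjEquiv t (D.qPart F X) := by
  rw [(ht.decomposes_act hF).qPart_eq_multiplier, hF.qPart_eq_multiplier, ht.multiplier_act hF]

theorem slC_act (hF : D.Decomposes F) (η : E →L[ℂ] E) (l : ℕ) :
    D.slC (act t F) (conjEquiv t η) l = conjEquiv t (D.slC F η l) := by
  rw [(ht.decomposes_act hF).slC_eq_smul_multiplier, hF.slC_eq_smul_multiplier,
    ht.multiplier_act hF, map_smul]

theorem slP_act (hF : D.Decomposes F) (η : E →L[ℂ] E) (k : ℕ) :
    D.slP (act t F) (conjEquiv t η) k = conjEquiv t (D.slP F η k) := by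
  induction k using Nat.strong_induction_on with
  | _ k ih =>
    rcases k with _ | k
    · rw [slP_zero, slP_zero, map_one]
    · rw [slP_succ, slP_succ, map_smul, map_add, map_sum, ht.slC_act hF]
      congr! 3 with j
      rw [ih _ (by omega), ht.slC_act hF, map_mul]

theorem finsum_slP_act (hF : D.Decomposes F) (η : E →L[ℂ] E) :
    ∑ᶠ k, D.slP (act t F) (conjEquiv t η) k = conjEquiv t (∑ᶠ k, D.slP F η k) := by
  rw [finsum_congr (ht.slP_act hF η)]
  exact ((conjEquiv t).toRingEquiv.toAddEquiv.map_finsum _).symm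

theorem conjEquiv_mem_Lam (hF : D.Decomposes F) {X : E →L[ℂ] E} (hX : X ∈ D.Lam F) :
    conjEquiv t X ∈ D.Lam (act t F) := by
  rw [(ht.decomposes_act hF).mem_Lam_iff, funext (ht.pr_act hF)]
  exact (conj_mem_lowering_conj_iff t).2 (hF.mem_Lam_iff.1 hX)

theorem isReal_conjEquiv {X : E →L[ℂ] E} (hX : D.IsReal X) : D.IsReal (conjEquiv t X) := by
  rw [D.isReal_iff] at hX ⊢
  rw [ht.bar_conjEquiv, hX]

theorem isSplit_act (hF : D.IsSplit F) : D.IsSplit (act t F) := fun p q => by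
  rw [ht.mapsBigr, ht.mapsBigr, conjSub_map, ht.real, hF]

theorem isDelta_act (hF : D.Decomposes F) {δ : E →L[ℂ] E} (hδ : D.IsDelta F δ) :
    D.IsDelta (act t F) (conjEquiv t δ) := by
  refine ⟨ht.conjEquiv_mem_Lam hF hδ.1, ht.isReal_conjEquiv hδ.2.1, ?_⟩
  rw [← map_smul, ← map_neg, ← conjEquiv_exp, act_conjEquiv]
  exact ht.isSplit_act hδ.2.2

theorem isZeta_act (hF : D.IsGradedPolarizedMHS F) {δ ζ : E →L[ℂ] E} (hδ : D.IsDelta F δ)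
    (hζ : D.IsZeta F δ ζ) : D.IsZeta (act t F) (conjEquiv t δ) (conjEquiv t ζ) := by
  obtain ⟨hζ_mem, hζ_real, η, hη_mem, hη_real, hexp⟩ := hζ
  have hF' := hF.decomposes_act_exp (X := -(Complex.I • δ))
    (neg_mem (Submodule.smul_mem _ _ (hF.decomposes.mem_Lam_iff.1 hδ.1)))
  refine ⟨ht.conjEquiv_mem_Lam hF.decomposes hζ_mem, ht.isReal_conjEquiv hζ_real, conjEquiv t η,
    ht.conjEquiv_mem_Lam hF.decomposes hη_mem, ht.isReal_conjEquiv hη_real, ?_⟩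
  rw [← map_smul, ← map_neg, ← conjEquiv_exp, ← conjEquiv_exp, ← conjEquiv_exp, act_conjEquiv,
    ht.finsum_slP_act hF', ← map_mul, hexp]

theorem eps_act (hF : D.IsGradedPolarizedMHS F) (htF : D.IsGradedPolarizedMHS (act t F)) :
    D.eps (act t F) = conjEquiv t (D.eps F) := by
  refine htF.existsUnique_isEps.unique htF.isEps_eps ?_
  obtain ⟨hε, δ, ζ, hδ, hζ, hexp⟩ := hF.isEps_eps
  refine ⟨ht.conjEquiv_mem_Lam hF.decomposes hε, conjEquiv t δ, conjEquiv t ζ,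
    ht.isDelta_act hF.decomposes hδ, ht.isZeta_act hF hδ hζ, ?_⟩
  rw [← map_smul, ← map_neg, ← conjEquiv_exp, ← conjEquiv_exp, ← conjEquiv_exp, ← map_mul, hexp]

end IsRealAut

end Datum

end Equivariance

/-! ### Hermitian forms diagonal in a basis -/

section Hermitian

theorem exists_basis_orthonormal {V : Type*} [AddCommGroup V] [Module ℂ V] [FiniteDimensional ℂ V]
    (h : V →ₗ[ℂ] V →ₗ⋆[ℂ] ℂ) (hsymm : ∀ u v, starRingEnd ℂ (h u v) = h v u)
    (hpos : ∀ v, v ≠ 0 → 0 < (h v v).re) :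
    ∃ (n : ℕ) (b : Module.Basis (Fin n) ℂ V), ∀ i j, h (b i) (b j) = if i = j then 1 else 0 := by
  let core : InnerProductSpace.Core ℂ V :=
    { inner := fun u v => h v u
      conj_inner_symm := fun u v => hsymm u v
      re_inner_nonneg := fun v => by
        by_cases hv : v = 0
        · simp [hv]
        · exact (hpos v hv).le
      add_left := fun u u' v => (h v).map_add u u'
      smul_left := fun u v c => (h v).map_smulₛₗ c u
      definite := fun v hv => by
        by_contra hne
        exact (hpos v hne).ne' (congrArg Complex.re hv) }
  let _ : NormedAddCommGroup V := core.toNormedAddCommGroup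
  let _ : InnerProductSpace ℂ V := InnerProductSpace.ofCore core.toCore
  refine ⟨_, (stdOrthonormalBasis ℂ V).toBasis, fun i j => ?_⟩
  simp only [OrthonormalBasis.coe_toBasis, @eq_comm _ i j]
  exact orthonormal_iff_ite.1 (stdOrthonormalBasis ℂ V).orthonormal j i

variable {E ι : Type*} [NormedAddCommGroup E] [NormedSpace ℂ E]

section weightedForm

variable [Fintype ι]

theorem repr_apply_eq_sum (b : Module.Basis ι ℂ E) (X : E →L[ℂ] E) (u : E) (k : ι) :
    b.repr (X u) k = ∑ i, b.repr (X (b i)) k * b.repr u i := by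
  conv_lhs => rw [← b.sum_repr u, map_sum, map_sum, Finsupp.finsetSum_apply]
  refine Finset.sum_congr rfl fun i _ => ?_
  rw [map_smul, map_smul, Finsupp.smul_apply, smul_eq_mul, mul_comm]

/-- The sesquilinear form for which the basis `b` is orthogonal and `b i` has square length
`w i`. -/
def weightedForm (b : Module.Basis ι ℂ E) (w : ι → ℝ) (u v : E) : ℂ :=
  ∑ i, w i * (b.repr u i * starRingEnd ℂ (b.repr v i))

variable {b : Module.Basis ι ℂ E} {w : ι → ℝ}

theorem weightedForm_basis_right (u : E) (i : ι) :
    weightedForm b w u (b i) = w i * b.repr u i := by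
  classical
  simp [weightedForm, Finsupp.single_apply]

theorem weightedForm_basis_left (u : E) (i : ι) :
    weightedForm b w (b i) u = w i * starRingEnd ℂ (b.repr u i) := by
  classical
  simp [weightedForm, Finsupp.single_apply]

theorem re_weightedForm_self (u : E) :
    (weightedForm b w u u).re = ∑ i, w i * ‖b.repr u i‖ ^ 2 := by
  rw [weightedForm, Complex.re_sum]
  refine Finset.sum_congr rfl fun i _ => ?_
  rw [Complex.mul_conj, Complex.normSq_eq_norm_sq, ← Complex.ofReal_mul, Complex.ofReal_re]

theorem repr_of_weightedForm_adjoint (hw : ∀ i, w i ≠ 0) {β β' : E →L[ℂ] E}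
    (h : ∀ u v, weightedForm b w (β u) v = weightedForm b w u (β' v)) (i k : ι) :
    b.repr (β' (b k)) i = w k / w i * starRingEnd ℂ (b.repr (β (b i)) k) := by
  have hik := congrArg (starRingEnd ℂ) (h (b i) (b k))
  rw [weightedForm_basis_right, weightedForm_basis_left, map_mul, map_mul, Complex.conj_conj,
    Complex.conj_ofReal, Complex.conj_ofReal] at hik
  rw [div_mul_eq_mul_div, hik, mul_div_cancel_left₀ _ (Complex.ofReal_ne_zero.2 (hw i))]

theorem weightedForm_adjoint_unique (hw : ∀ i, w i ≠ 0) {β β₁ β₂ : E →L[ℂ] E}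
    (h₁ : ∀ u v, weightedForm b w (β u) v = weightedForm b w u (β₁ v))
    (h₂ : ∀ u v, weightedForm b w (β u) v = weightedForm b w u (β₂ v)) : β₁ = β₂ := by
  refine ContinuousLinearMap.coe_injective
    (b.ext fun k => b.repr.injective (Finsupp.ext fun i => ?_))
  exact (repr_of_weightedForm_adjoint hw h₁ i k).trans (repr_of_weightedForm_adjoint hw h₂ i k).symm

variable [FiniteDimensional ℂ E]

theorem exists_weightedForm_adjoint (hw : ∀ i, w i ≠ 0) (β : E →L[ℂ] E) :
    ∃ β' : E →L[ℂ] E, ∀ u v, weightedForm b w (β u) v = weightedForm b w u (β' v) := by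
  classical
  let M : Matrix ι ι ℂ := Matrix.of fun i k => w k / w i * starRingEnd ℂ (b.repr (β (b i)) k)
  refine ⟨LinearMap.toContinuousLinearMap (Matrix.toLin b b M), fun u v => ?_⟩
  have hM (i : ι) : b.repr (Matrix.toLin b b M v) i = ∑ k, M i k * b.repr v k := by
    rw [Matrix.repr_toLin]
    rfl
  simp only [weightedForm, LinearMap.coe_toContinuousLinearMap', hM, repr_apply_eq_sum b β u,
    map_sum, Finset.mul_sum, Finset.sum_mul]
  rw [Finset.sum_comm]
  refine Finset.sum_congr rfl fun i _ => Finset.sum_congr rfl fun k _ => ?_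
  have hwi : (w i : ℂ) ≠ 0 := Complex.ofReal_ne_zero.2 (hw i)
  simp only [M, Matrix.of_apply, map_mul, map_div₀, Complex.conj_ofReal, Complex.conj_conj]
  field_simp

theorem weightedForm_adjointWrt (hw : ∀ i, w i ≠ 0) (β : E →L[ℂ] E) (u v : E) :
    weightedForm b w (β u) v = weightedForm b w u (adjointWrt (weightedForm b w) β v) :=
  Classical.epsilon_spec (exists_weightedForm_adjoint hw β) u v

theorem trace_mul_adjointWrt_weightedForm (hw : ∀ i, w i ≠ 0) (α : E →L[ℂ] E) :
    LinearMap.trace ℂ E ((α * adjointWrt (weightedForm b w) α : E →L[ℂ] E) : E →ₗ[ℂ] E) =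
      ((∑ k, ∑ i, w k / w i * ‖b.repr (α (b i)) k‖ ^ 2 : ℝ) : ℂ) := by
  classical
  rw [LinearMap.trace_eq_matrix_trace ℂ b, Matrix.trace]
  push_cast
  refine Finset.sum_congr rfl fun k _ => ?_
  rw [Matrix.diag_apply, LinearMap.toMatrix_apply]
  change b.repr (α (adjointWrt (weightedForm b w) α (b k))) k = _
  rw [repr_apply_eq_sum]
  refine Finset.sum_congr rfl fun i _ => ?_
  rw [repr_of_weightedForm_adjoint hw (weightedForm_adjointWrt hw α), mul_left_comm,
    Complex.mul_conj, Complex.normSq_eq_norm_sq, Complex.ofReal_pow]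

end weightedForm

namespace Datum

/-! ### The mixed Hodge metric -/

variable {D : Datum E} {F : ℤ → Submodule ℂ E}

variable (D) in
/-- The sesquilinear form `i^{p-q} S_{p+q}(u, conj v)` attached to `x = (p, q)`; the Weil operator
is multiplication by `i^{p-q}` on the component of type `(p, q)`. -/
def weilForm (x : ℤ × ℤ) : E →ₗ[ℂ] E →ₗ⋆[ℂ] ℂ :=
  Complex.I ^ (x.1 - x.2) • (D.S (x.1 + x.2)).compl₂ D.conj

theorem weilForm_apply (x : ℤ × ℤ) (u v : E) :
    D.weilForm x u v = Complex.I ^ (x.1 - x.2) * D.S (x.1 + x.2) u (D.conj v) := rfl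

theorem weilForm_symm {x : ℤ × ℤ} {u v : E} (hu : u ∈ D.W (x.1 + x.2))
    (hv : v ∈ D.W (x.1 + x.2)) : starRingEnd ℂ (D.weilForm x u v) = D.weilForm x v u := by
  have hI : (-Complex.I) ^ (x.1 - x.2) * (-1) ^ (x.1 + x.2) = Complex.I ^ (x.1 - x.2) := by
    rw [← neg_one_mul, mul_zpow, mul_right_comm, ← zpow_add₀ (neg_ne_zero.2 one_ne_zero),
      show x.1 - x.2 + (x.1 + x.2) = 2 * x.1 by ring, zpow_mul]
    simp
  rw [weilForm_apply, weilForm_apply, map_mul, ← D.S_real _ _ hu _ (D.W_real _ _ hv), D.conj_conj,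
    D.S_symm _ _ (D.W_real _ _ hu) _ hv, map_zpow₀, Complex.conj_I, ← mul_assoc, hI]

theorem bigr_le_grHodge (p q : ℤ) : D.bigr F p q ≤ D.grHodge F p q := by
  intro v hv
  refine ⟨le_sup_left (a := F p ⊓ D.W (p + q)) ⟨bigr_le_F p q hv, bigr_le_W p q hv⟩, ?_⟩
  obtain ⟨a, ha, b, hb, rfl⟩ := Submodule.mem_sup.1 (bigr_le_bigrCover p q hv)
  rw [SetLike.mem_coe, mem_conjSub, map_add]
  exact Submodule.add_mem_sup ⟨ha.1, D.W_real _ _ ha.2⟩ (D.W_real _ _ (oppFil_le_W _ _ hb))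

theorem IsGradedPolarizedMHS.weilForm_self_pos (hF : D.IsGradedPolarizedMHS F) {x : ℤ × ℤ}
    {v : E} (hv : v ∈ D.bigr F x.1 x.2) (h0 : v ≠ 0) :
    0 < (D.weilForm x v v).re :=
  hF.pos x.1 x.2 v (bigr_le_grHodge _ _ hv)
    fun hW => h0 (hF.eq_zero_of_mem_bigr_of_mem_W hv hW)

variable [FiniteDimensional ℂ E]

theorem hodgeForm_eq_finsum (s : ℝ) (u v : E) : D.hodgeForm s F u v =
    ∑ᶠ x : ℤ × ℤ, (s : ℂ) ^ (x.1 + x.2) * D.weilForm x (D.pr F x u) (D.pr F x v) := rfl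

/-- A basis of vectors `b i` of type `x i` in the Deligne bigrading, orthonormal for the mixed Hodge
metric. -/
structure IsAdapted (D : Datum E) (F : ℤ → Submodule ℂ E) (b : Module.Basis ι ℂ E)
    (x : ι → ℤ × ℤ) : Prop where
  mem : ∀ i, b i ∈ D.bigr F (x i).1 (x i).2
  weilForm_self : ∀ i, D.weilForm (x i) (b i) (b i) = 1
  weilForm_eq_zero : ∀ i j, i ≠ j → x i = x j → D.weilForm (x i) (b i) (b j) = 0

theorem IsGradedPolarizedMHS.exists_isAdapted (hF : D.IsGradedPolarizedMHS F) :
    ∃ (ι : Type) (_ : Fintype ι) (b : Module.Basis ι ℂ E) (x : ι → ℤ × ℤ), D.IsAdapted F b x := by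
  have hint : DirectSum.IsInternal fun x : ℤ × ℤ => D.bigr F x.1 x.2 :=
    DirectSum.isInternal_submodule_of_iSupIndep_of_iSup_eq_top hF.decomposes.1 hF.decomposes.2
  choose n b hb using fun x : ℤ × ℤ =>
    exists_basis_orthonormal
      ((D.weilForm x).domRestrict₁₂ (D.bigr F x.1 x.2) (D.bigr F x.1 x.2))
      (fun u v => weilForm_symm (bigr_le_W _ _ u.2) (bigr_le_W _ _ v.2))
      (fun v hv => hF.weilForm_self_pos v.2 fun h => hv (Subtype.ext h))
  have hB (i : Σ x, Fin (n x)) : hint.collectedBasis b i = b i.1 i.2 := by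
    rw [hint.collectedBasis_coe b]
  have _ : Finite (Σ x, Fin (n x)) := Module.Finite.finite_basis (hint.collectedBasis b)
  refine ⟨Σ x, Fin (n x), Fintype.ofFinite _, hint.collectedBasis b, Sigma.fst,
    hint.collectedBasis_mem b, fun i => ?_, ?_⟩
  · rw [hB]
    exact (hb i.1 i.2 i.2).trans (if_pos rfl)
  · rintro ⟨x, i⟩ ⟨_, j⟩ hne rfl
    rw [hB, hB]
    exact (hb x i j).trans (if_neg fun hij => hne (by rw [hij]))

namespace IsAdapted

variable {b : Module.Basis ι ℂ E} {x : ι → ℤ × ℤ} (hb : D.IsAdapted F b x) (hF : D.Decomposes F)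

include hb hF

theorem pr_basis (i : ι) (y : ℤ × ℤ) : D.pr F y (b i) = if x i = y then b i else 0 := by
  split_ifs with h
  · exact hF.pr_of_mem (h ▸ hb.mem i)
  · exact hF.pr_of_mem_ne h (hb.mem i)

theorem repr_pr (y : ℤ × ℤ) (u : E) (i : ι) :
    b.repr (D.pr F y u) i = if x i = y then b.repr u i else 0 := by
  have hcoord : b.coord i ∘ₗ (D.pr F y : E →ₗ[ℂ] E) = if x i = y then b.coord i else 0 :=
    b.ext fun j => by
      rw [LinearMap.comp_apply, ContinuousLinearMap.coe_coe, hb.pr_basis hF]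
      by_cases hij : j = i
      · subst hij
        split_ifs <;> simp
      · split_ifs <;> simp [hij]
  have hu := LinearMap.congr_fun hcoord u
  split_ifs at hu ⊢ <;> exact hu

theorem weilForm_pr [Fintype ι] (y : ℤ × ℤ) (u v : E) : D.weilForm y (D.pr F y u) (D.pr F y v) =
    ∑ i, if x i = y then b.repr u i * starRingEnd ℂ (b.repr v i) else 0 := by
  conv_lhs => rw [← b.sum_repr (D.pr F y u), ← b.sum_repr (D.pr F y v)]
  rw [LinearMap.map_sum₂]
  refine Finset.sum_congr rfl fun i _ => ?_
  rw [hb.repr_pr hF]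
  split_ifs with hi
  · rw [map_sum, Finset.sum_eq_single i _ (by simp)]
    · rw [hb.repr_pr hF, if_pos hi, LinearMap.map_smulₛₗ₂, LinearMap.map_smulₛₗ, ← hi,
        hb.weilForm_self, smul_eq_mul, smul_eq_mul, mul_one, RingHom.id_apply]
    · intro j _ hj
      rw [hb.repr_pr hF]
      split_ifs with hj'
      · rw [LinearMap.map_smulₛₗ₂, LinearMap.map_smulₛₗ, ← hi,
          hb.weilForm_eq_zero i j hj.symm (hi.trans hj'.symm), smul_zero, smul_zero]
      · simp
  · simp

theorem hodgeForm_eq_weightedForm [Fintype ι] (s : ℝ) :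
    D.hodgeForm s F = weightedForm b fun i => s ^ ((x i).1 + (x i).2) := by
  funext u v
  simp only [hodgeForm_eq_finsum, hb.weilForm_pr hF, Finset.mul_sum, weightedForm]
  rw [finsum_sum_comm]
  · refine Finset.sum_congr rfl fun i _ => ?_
    rw [finsum_eq_single _ (x i) fun y hy => by rw [if_neg hy.symm, mul_zero], if_pos rfl,
      Complex.ofReal_zpow]
  · refine fun i _ => (Set.finite_singleton (x i)).subset fun y hy => ?_
    by_contra hne
    exact hy (by simp [Ne.symm hne])

theorem endNorm_eq [Fintype ι] {s : ℝ} (hs : 0 < s) (α : E →L[ℂ] E) : D.endNorm s F α =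
    √(∑ k, ∑ i, s ^ ((x k).1 + (x k).2 - ((x i).1 + (x i).2)) * ‖b.repr (α (b i)) k‖ ^ 2) := by
  rw [endNorm, endForm, hb.hodgeForm_eq_weightedForm hF,
    trace_mul_adjointWrt_weightedForm fun i => (zpow_pos hs _).ne', Complex.ofReal_re]
  simp only [zpow_sub₀ hs.ne']

theorem repr_multiplier (m : ℤ × ℤ → ℂ) (X : E →L[ℂ] E) (i k : ι) :
    b.repr (multiplier (D.pr F) m X (b i)) k = m (x k - x i) * b.repr (X (b i)) k := by
  have hblock (Z : E →L[ℂ] E) :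
      b.repr ((D.pr F (x k) * Z * D.pr F (x i)) (b i)) k = b.repr (Z (b i)) k := by
    simp only [mul_apply_eq_comp, hb.repr_pr hF, hb.pr_basis hF, if_pos]
  rw [← hblock, hF.isGradingFamily.block_multiplier, ← hblock X]
  simp

theorem endNorm_comp {s : ℝ} (hs : 0 < s) (X : E →L[ℂ] E) (p q : ℤ) :
    D.endNorm s F (D.comp F X p q) = √(s ^ (p + q)) * D.endNorm 1 F (D.comp F X p q) := by
  let _ := FiniteDimensional.fintypeBasisIndex b
  rw [hb.endNorm_eq hF hs, hb.endNorm_eq hF one_pos, ← Real.sqrt_mul (zpow_nonneg hs.le _)]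
  congr 1
  simp only [Finset.mul_sum, hF.comp_eq_multiplier, hb.repr_multiplier hF, one_zpow, one_mul]
  refine Finset.sum_congr rfl fun k _ => Finset.sum_congr rfl fun i _ => ?_
  by_cases h : x k - x i = (p, q)
  · have hp : (x k).1 - (x i).1 = p := congrArg Prod.fst h
    have hq : (x k).2 - (x i).2 = q := congrArg Prod.snd h
    rw [show (x k).1 + (x k).2 - ((x i).1 + (x i).2) = p + q by lia]
  · simp [h]

theorem hodgeForm_apply_le (X : E →L[ℂ] E) (u : E) :
    (D.hodgeForm 1 F (X u) (X u)).re ≤ D.endNorm 1 F X ^ 2 * (D.hodgeForm 1 F u u).re := by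
  let _ := FiniteDimensional.fintypeBasisIndex b
  rw [hb.endNorm_eq hF one_pos, Real.sq_sqrt (by positivity), hb.hodgeForm_eq_weightedForm hF,
    re_weightedForm_self, re_weightedForm_self]
  simp only [one_zpow, one_mul]
  rw [Finset.sum_mul]
  refine Finset.sum_le_sum fun k _ => ?_
  calc ‖b.repr (X u) k‖ ^ 2
      ≤ (∑ i, ‖b.repr (X (b i)) k‖ * ‖b.repr u i‖) ^ 2 := by
        gcongr
        rw [repr_apply_eq_sum]
        exact (norm_sum_le _ _).trans_eq (Finset.sum_congr rfl fun i _ => norm_mul _ _)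
    _ ≤ (∑ i, ‖b.repr (X (b i)) k‖ ^ 2) * ∑ i, ‖b.repr u i‖ ^ 2 :=
        Finset.sum_mul_sq_le_sq_mul_sq _ _ _

end IsAdapted

end Datum

end Hermitian

/-! ### Real similitudes -/

section Similitude

variable {E : Type*} [NormedAddCommGroup E] [NormedSpace ℂ E]

theorem map_inf_unit (t : (E →L[ℂ] E)ˣ) (P Q : Submodule ℂ E) :
    (P ⊓ Q).map ((t : E →L[ℂ] E) : E →ₗ[ℂ] E) =
      P.map ((t : E →L[ℂ] E) : E →ₗ[ℂ] E) ⊓ Q.map ((t : E →L[ℂ] E) : E →ₗ[ℂ] E) :=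
  Submodule.map_inf _ (unit_injective t)

theorem trace_conjEquiv (t : (E →L[ℂ] E)ˣ) (X : E →L[ℂ] E) :
    LinearMap.trace ℂ E ((conjEquiv t X : E →L[ℂ] E) : E →ₗ[ℂ] E) =
      LinearMap.trace ℂ E (X : E →ₗ[ℂ] E) :=
  LinearMap.trace_conj ℂ (X : E →ₗ[ℂ] E)
    (Units.map (ContinuousLinearMap.toLinearMapRingHom : (E →L[ℂ] E) →+* _).toMonoidHom t)

namespace Datum

variable {D : Datum E} {F : ℤ → Submodule ℂ E}

theorem grFil_le_W (w p : ℤ) : D.grFil F w p ≤ D.W w :=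
  sup_le inf_le_right (D.W_mono (by lia))

theorem lt_of_W_eq_bot {k : ℤ} (hk : D.W k = ⊥) {x : ℤ × ℤ} (hx : D.bigr F x.1 x.2 ≠ ⊥) :
    k < x.1 + x.2 := by
  by_contra! hle
  exact hx (eq_bot_iff.2 ((bigr_le_W _ _).trans ((D.W_mono hle).trans hk.le)))

theorem IsGradedPolarizedMHS.le_of_W_eq_top (hF : D.IsGradedPolarizedMHS F) {l : ℤ}
    (hl : D.W l = ⊤) {x : ℤ × ℤ} (hx : D.bigr F x.1 x.2 ≠ ⊥) : x.1 + x.2 ≤ l := by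
  by_contra! hlt
  refine hx ((Submodule.eq_bot_iff _).2 fun v hv => hF.eq_zero_of_mem_bigr_of_mem_W hv ?_)
  exact D.W_mono (show l ≤ _ by lia) (hl ▸ Submodule.mem_top)

variable [FiniteDimensional ℂ E]

/-- A real automorphism that preserves `W` and multiplies the form on `Gr^W_w` by `c ^ w`, so that
it acts on the classifying space. -/
structure IsSimilitude (D : Datum E) (c : ℝ) (t : (E →L[ℂ] E)ˣ) : Prop extends
    D.IsRealAut t where
  pos : 0 < c
  scale : ∀ w, ∀ u ∈ D.W w, ∀ v ∈ D.W w,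
    D.S w ((t : E →L[ℂ] E) u) ((t : E →L[ℂ] E) v) = (c : ℂ) ^ w * D.S w u v

namespace IsRealAut

variable {t : (E →L[ℂ] E)ˣ} (ht : D.IsRealAut t)
include ht

theorem conj_apply (v : E) : D.conj ((t : E →L[ℂ] E) v) = (t : E →L[ℂ] E) (D.conj v) := by
  rw [← bar_apply_conj, ht.real]

theorem apply_mem_W {k : ℤ} {v : E} : (t : E →L[ℂ] E) v ∈ D.W k ↔ v ∈ D.W k := by
  conv_lhs => rw [← ht.map_W]
  exact (unit_injective t).mem_set_image (s := D.W k)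

theorem grFil_act (w p : ℤ) :
    D.grFil (act t F) w p = (D.grFil F w p).map ((t : E →L[ℂ] E) : E →ₗ[ℂ] E) := by
  rw [grFil, grFil, Submodule.map_sup, map_inf_unit, ht.map_W, ht.map_W, act]

theorem conjSub_grFil_act (w p : ℤ) : D.conjSub (D.grFil (act t F) w p) =
    (D.conjSub (D.grFil F w p)).map ((t : E →L[ℂ] E) : E →ₗ[ℂ] E) := by
  rw [ht.grFil_act, Datum.conjSub_map, ht.real]

theorem grHodge_act (p q : ℤ) :
    D.grHodge (act t F) p q = (D.grHodge F p q).map ((t : E →L[ℂ] E) : E →ₗ[ℂ] E) := by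
  rw [grHodge, grHodge, ht.grFil_act, ht.conjSub_grFil_act, map_inf_unit]

end IsRealAut

namespace IsSimilitude

variable {c : ℝ} {t : (E →L[ℂ] E)ˣ} (ht : D.IsSimilitude c t)
include ht

theorem isGradedPolarizedMHS_act (hF : D.IsGradedPolarizedMHS F) :
    D.IsGradedPolarizedMHS (act t F) where
  anti p q h := Submodule.map_mono (hF.anti h)
  eq_top := by
    obtain ⟨p, hp⟩ := hF.eq_top
    refine ⟨p, eq_top_iff.2 fun v _ => ⟨(↑t⁻¹ : E →L[ℂ] E) v, by simp [hp], ?_⟩⟩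
    exact DFunLike.congr_fun t.mul_inv v
  eq_bot := by
    obtain ⟨p, hp⟩ := hF.eq_bot
    exact ⟨p, by rw [act, hp, Submodule.map_bot]⟩
  sup_eq w p := by
    rw [ht.grFil_act, ht.conjSub_grFil_act, ← Submodule.map_sup, hF.sup_eq, ht.map_W]
  inf_eq w p := by
    rw [ht.grFil_act, ht.conjSub_grFil_act, ← map_inf_unit, hF.inf_eq, ht.map_W]
  orth w p q h u hu v hv := by
    rw [ht.grFil_act] at hu hv
    obtain ⟨u, hu, rfl⟩ := hu
    obtain ⟨v, hv, rfl⟩ := hv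
    refine (ht.scale w u (grFil_le_W _ _ hu) v (grFil_le_W _ _ hv)).trans ?_
    rw [hF.orth w p q h u hu v hv, mul_zero]
  pos p q u hu hne := by
    rw [ht.grHodge_act] at hu
    obtain ⟨u, hu, rfl⟩ := hu
    have hW := grFil_le_W _ _ hu.1
    rw [ContinuousLinearMap.coe_coe, ht.conj_apply, ht.scale _ u hW _ (D.W_real _ _ hW),
      mul_left_comm, ← Complex.ofReal_zpow, Complex.re_ofReal_mul]
    exact mul_pos (zpow_pos ht.pos _) (hF.pos p q u hu fun h => hne (ht.apply_mem_W.2 h))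
  hodge_number p q := by
    rw [ht.grHodge_act, ← hF.hodge_number]
    exact (Submodule.equivMapOfInjective _ (unit_injective t) _).finrank_eq.symm

theorem hodgeForm_act (hF : D.Decomposes F) (s : ℝ) (u v : E) :
    D.hodgeForm s (act t F) ((t : E →L[ℂ] E) u) ((t : E →L[ℂ] E) v) =
      D.hodgeForm (s * c) F u v := by
  have hpr (x : ℤ × ℤ) (u : E) :
      D.pr (act t F) x ((t : E →L[ℂ] E) u) = (t : E →L[ℂ] E) (D.pr F x u) := by
    rw [ht.pr_act hF, conjEquiv_apply, ← mul_apply_eq_comp, Units.inv_mul_cancel_right]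
    rfl
  rw [hodgeForm_eq_finsum, hodgeForm_eq_finsum]
  refine finsum_congr fun x => ?_
  have hu := bigr_le_W _ _ (hF.pr_mem x u)
  have hv := bigr_le_W _ _ (hF.pr_mem x v)
  rw [hpr, hpr, weilForm_apply, weilForm_apply, ht.conj_apply,
    ht.scale _ _ hu _ (D.W_real _ _ hv), Complex.ofReal_mul, mul_zpow]
  ring

theorem adjointWrt_hodgeForm_act (hF : D.IsGradedPolarizedMHS F) {s : ℝ} (hs : 0 < s)
    (X : E →L[ℂ] E) : adjointWrt (D.hodgeForm s (act t F)) (conjEquiv t X) =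
      conjEquiv t (adjointWrt (D.hodgeForm (s * c) F) X) := by
  have hF' := ht.isGradedPolarizedMHS_act hF
  obtain ⟨ι, _, b, x, hb⟩ := hF.exists_isAdapted
  obtain ⟨ι', _, b', x', hb'⟩ := hF'.exists_isAdapted
  have hform := hb.hodgeForm_eq_weightedForm hF.decomposes (s * c)
  have hform' := hb'.hodgeForm_eq_weightedForm hF'.decomposes s
  have hadj (u v : E) : D.hodgeForm s (act t F) (conjEquiv t X u) v = D.hodgeForm s (act t F) u
      (conjEquiv t (adjointWrt (D.hodgeForm (s * c) F) X) v) := by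
    obtain ⟨u, rfl⟩ : ∃ u', (t : E →L[ℂ] E) u' = u := ⟨_, DFunLike.congr_fun t.mul_inv u⟩
    obtain ⟨v, rfl⟩ : ∃ v', (t : E →L[ℂ] E) v' = v := ⟨_, DFunLike.congr_fun t.mul_inv v⟩
    simp only [conjEquiv_apply, ← mul_apply_eq_comp, Units.inv_mul_cancel_right]
    simp only [mul_apply_eq_comp, ht.hodgeForm_act hF.decomposes]
    rw [hform]
    exact weightedForm_adjointWrt (fun i => (zpow_pos (mul_pos hs ht.pos) _).ne') X u v
  rw [hform'] at hadj ⊢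
  have hw (i : ι') : s ^ ((x' i).1 + (x' i).2) ≠ 0 := (zpow_pos hs _).ne'
  exact weightedForm_adjoint_unique hw (weightedForm_adjointWrt hw _) hadj

theorem endNorm_act (hF : D.IsGradedPolarizedMHS F) {s : ℝ} (hs : 0 < s) (X : E →L[ℂ] E) :
    D.endNorm s (act t F) (conjEquiv t X) = D.endNorm (s * c) F X := by
  rw [endNorm, endNorm, endForm, endForm, ht.adjointWrt_hodgeForm_act hF hs, ← map_mul,
    trace_conjEquiv]

end IsSimilitude

/-! ### The twisting function and the twisted norm -/

theorem tau_eq (F : ℤ → Submodule ℂ E) : D.tau F = 1 + ∑ᶠ (x : ℤ × ℤ) (_ : x.1 < 0 ∧ x.2 < 0),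
    D.endNorm 1 F (D.comp F (D.eps F) x.1 x.2) ^ (-2 / ((x.1 : ℝ) + (x.2 : ℝ))) := rfl

theorem endNorm_nonneg (s : ℝ) (F : ℤ → Submodule ℂ E) (X : E →L[ℂ] E) : 0 ≤ D.endNorm s F X :=
  Real.sqrt_nonneg _

theorem one_le_tau (F : ℤ → Submodule ℂ E) : 1 ≤ D.tau F := by
  rw [tau_eq, le_add_iff_nonneg_right]
  exact finsum_nonneg fun x => finsum_nonneg fun _ => Real.rpow_nonneg (endNorm_nonneg _ _ _) _

namespace IsSimilitude

variable {c : ℝ} {t : (E →L[ℂ] E)ˣ} (ht : D.IsSimilitude c t)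
include ht

theorem endNorm_comp_eps_act (hF : D.IsGradedPolarizedMHS F) {p q : ℤ} (hpq : p < 0 ∧ q < 0) :
    D.endNorm 1 (act t F) (D.comp (act t F) (D.eps (act t F)) p q) ^ (-2 / ((p : ℝ) + q)) =
      c⁻¹ * D.endNorm 1 F (D.comp F (D.eps F) p q) ^ (-2 / ((p : ℝ) + q)) := by
  obtain ⟨ι, _, b, x, hb⟩ := hF.exists_isAdapted
  have hne : (p : ℝ) + q ≠ 0 := by
    have hlt : p + q < 0 := by lia
    exact_mod_cast hlt.ne
  have hexp : ((p + q : ℤ) : ℝ) * (1 / 2) * (-2 / ((p : ℝ) + q)) = -1 := by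
    push_cast
    field_simp
  rw [ht.eps_act hF (ht.isGradedPolarizedMHS_act hF), ht.comp_act hF.decomposes,
    ht.endNorm_act hF one_pos, one_mul, hb.endNorm_comp hF.decomposes ht.pos,
    Real.mul_rpow (Real.sqrt_nonneg _) (endNorm_nonneg _ _ _), Real.sqrt_eq_rpow,
    ← Real.rpow_intCast, ← Real.rpow_mul ht.pos.le, ← Real.rpow_mul ht.pos.le, hexp,
    Real.rpow_neg_one]

theorem tau_act_mul (hF : D.IsGradedPolarizedMHS F) :
    D.tau (act t F) * c = c + (D.tau F - 1) := by
  have hterm (y : ℤ × ℤ) : (∑ᶠ (_ : y.1 < 0 ∧ y.2 < 0),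
      D.endNorm 1 (act t F) (D.comp (act t F) (D.eps (act t F)) y.1 y.2) ^
        (-2 / ((y.1 : ℝ) + (y.2 : ℝ)))) = c⁻¹ • ∑ᶠ (_ : y.1 < 0 ∧ y.2 < 0),
        D.endNorm 1 F (D.comp F (D.eps F) y.1 y.2) ^ (-2 / ((y.1 : ℝ) + (y.2 : ℝ))) := by
    rw [smul_finsum]
    exact finsum_congr fun hy => ht.endNorm_comp_eps_act hF hy
  simp only [tau_eq, hterm]
  rw [← smul_finsum, smul_eq_mul, add_mul, one_mul, mul_right_comm, inv_mul_cancel₀ ht.pos.ne',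
    one_mul, add_sub_cancel_left]

theorem twistedNorm_act (hF : D.IsGradedPolarizedMHS F) (X : E →L[ℂ] E) :
    D.twistedNorm (act t F) (conjEquiv t X) =
      D.endNorm (c + (D.tau F - 1)) F (D.qPart F X) := by
  rw [twistedNorm, ht.qPart_act hF.decomposes, ht.endNorm_act hF
    (one_pos.trans_le (one_le_tau _)), ht.tau_act_mul hF]

end IsSimilitude

theorem IsAdapted.endNorm_qPart_le {ι : Type*} {b : Module.Basis ι ℂ E} {x : ι → ℤ × ℤ}
    (hb : D.IsAdapted F b x) (hF : D.Decomposes F) {M : ℕ}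
    (hM : ∀ i k, (x i).1 + (x i).2 - ((x k).1 + (x k).2) ≤ M) {κ s s' : ℝ} (hκ : 1 ≤ κ)
    (hs : 0 < s) (hs' : 0 < s') (hle : s ≤ κ * s') (X : E →L[ℂ] E) :
    D.endNorm s' F (D.qPart F X) ≤ κ ^ M * D.endNorm s F (D.qPart F X) := by
  let _ := FiniteDimensional.fintypeBasisIndex b
  rw [hb.endNorm_eq hF hs', hb.endNorm_eq hF hs, ← Real.sqrt_sq (by positivity : 0 ≤ κ ^ M),
    ← Real.sqrt_mul (sq_nonneg _)]
  refine Real.sqrt_le_sqrt ?_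
  simp only [Finset.mul_sum, ← mul_assoc, hF.qPart_eq_multiplier, hb.repr_multiplier hF]
  refine Finset.sum_le_sum fun k _ => Finset.sum_le_sum fun i _ => ?_
  split_ifs with hd
  · gcongr ?_ * _
    obtain ⟨n, hn⟩ : ∃ n : ℕ, (x k).1 + (x k).2 - ((x i).1 + (x i).2) = -(n : ℤ) := by
      obtain ⟨n, hn⟩ := Int.eq_ofNat_of_zero_le (sub_nonneg.2 hd.2)
      simp only [Prod.fst_sub, Prod.snd_sub] at hn
      exact ⟨n, by lia⟩
    have hnM : n ≤ M := by
      have := hM i k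
      lia
    rw [hn, zpow_neg, zpow_neg, zpow_natCast, zpow_natCast, ← div_eq_mul_inv,
      le_div_iff₀ (pow_pos hs n), inv_mul_le_iff₀ (pow_pos hs' n)]
    calc s ^ n ≤ (κ * s') ^ n := by gcongr
      _ = s' ^ n * κ ^ n := by rw [mul_pow, mul_comm]
      _ ≤ s' ^ n * (κ ^ M) ^ 2 := by
        gcongr
        rw [← pow_mul]
        exact pow_le_pow_right₀ hκ (by lia)
  · simp

variable (D) in
theorem exists_endNorm_qPart_le : ∃ M : ℕ, ∀ F, D.IsGradedPolarizedMHS F →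
    ∀ κ s s' : ℝ, 1 ≤ κ → 0 < s → 0 < s' → s ≤ κ * s' → ∀ X : E →L[ℂ] E,
      D.endNorm s' F (D.qPart F X) ≤ κ ^ M * D.endNorm s F (D.qPart F X) := by
  obtain ⟨k, hk⟩ := D.W_bot
  obtain ⟨l, hl⟩ := D.W_top
  refine ⟨(l - k).toNat, fun F hF κ s s' hκ hs hs' hle X => ?_⟩
  obtain ⟨ι, _, b, x, hb⟩ := hF.exists_isAdapted
  refine hb.endNorm_qPart_le hF.decomposes (fun i j => ?_) hκ hs hs' hle X
  have hne (i : ι) : D.bigr F (x i).1 (x i).2 ≠ ⊥ := (Submodule.ne_bot_iff _).2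
    ⟨b i, hb.mem i, b.ne_zero i⟩
  have hi := hF.le_of_W_eq_top hl (hne i)
  have hj := lt_of_W_eq_bot hk (hne j)
  lia

end Datum

end Similitude

section Twist

variable {E : Type*} [NormedAddCommGroup E] [NormedSpace ℂ E]

theorem powEnd_neg_half (y : ℝ) (X : E →L[ℂ] E) :
    powEnd y (-((1 / 2 : ℂ) • X)) = NormedSpace.exp (((-(Real.log y / 2) : ℝ) : ℂ) • X) := by
  rw [powEnd, smul_neg, smul_smul, ← neg_smul]
  congr 2
  push_cast
  ring

namespace Datum

variable {D : Datum E}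

theorem IsRealGrading.apply_sub_mem {Y : E →L[ℂ] E} (hY : D.IsRealGrading Y) (w : ℤ) :
    ∀ v ∈ D.W w, Y v - (w : ℂ) • v ∈ D.W (w - 1) := by
  revert w
  refine W_induction (D := D) (fun w hw v hv => ?_) fun w ih v hv => ?_
  · rw [hw, Submodule.mem_bot] at hv
    simp [hv]
  · rw [← hY.sup_eq] at hv
    obtain ⟨a, ha, e, he, rfl⟩ := Submodule.mem_sup.1 hv
    have hYe : Y e = (w : ℂ) • e := Module.End.mem_eigenspace_iff.1 he
    have hYa : Y a ∈ D.W (w - 1) := by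
      have hsub := D.W_mono (show w - 1 - 1 ≤ w - 1 by lia) (ih a ha)
      simpa using add_mem hsub ((D.W (w - 1)).smul_mem ((w - 1 : ℤ) : ℂ) ha)
    rw [map_add, hYe, smul_add, add_sub_add_right_eq_sub]
    exact sub_mem hYa ((D.W (w - 1)).smul_mem _ ha)

theorem S_left_eq_zero {w : ℤ} {u v : E} (hu : u ∈ D.W (w - 1)) (hv : v ∈ D.W w) :
    D.S w u v = 0 :=
  (D.S_nondeg w u (D.W_mono (by lia) hu)).2 hu v hv

theorem S_right_eq_zero {w : ℤ} {u v : E} (hu : u ∈ D.W w) (hv : v ∈ D.W (w - 1)) :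
    D.S w u v = 0 := by
  rw [D.S_symm w u hu v (D.W_mono (by lia) hv), S_left_eq_zero hv hu, mul_zero]

end Datum

variable [FiniteDimensional ℂ E]

theorem exp_apply_mem {P : Submodule ℂ E} {X : E →L[ℂ] E} (hX : ∀ v ∈ P, X v ∈ P) {v : E}
    (hv : v ∈ P) : (NormedSpace.exp X : E →L[ℂ] E) v ∈ P := by
  have hs := (NormedSpace.exp_series_hasSum_exp' (𝕂 := ℂ) X).mapL (ContinuousLinearMap.apply ℂ E v)
  refine P.closed_of_finiteDimensional.mem_of_tendsto hs (Filter.Eventually.of_forall fun s => ?_)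
  have hpow (n : ℕ) : (X ^ n) v ∈ P := by
    induction n with
    | zero => exact hv
    | succ n ih => rw [pow_succ']; exact hX _ ih
  exact sum_mem fun n _ => P.smul_mem _ (hpow n)

/- The right-hand side moved to the left is constant along the flow, having derivative zero. -/
theorem apply_exp_exp_of_infinitesimal (B : E →ₗ[ℂ] E →ₗ[ℂ] ℂ) {P : Submodule ℂ E} {a : ℂ}
    {X : E →L[ℂ] E} (hP : ∀ v ∈ P, X v ∈ P)
    (hX : ∀ u ∈ P, ∀ v ∈ P, B (X u) v + B u (X v) = a * B u v) {u v : E} (hu : u ∈ P)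
    (hv : v ∈ P) (z : ℂ) :
    B (NormedSpace.exp (z • X) u) (NormedSpace.exp (z • X) v) = Complex.exp (z * a) * B u v := by
  let B' : E →L[ℂ] E →L[ℂ] ℂ := B.toContinuousBilinearMap
  let flow (z : ℂ) : E →L[ℂ] E := NormedSpace.exp (z • X)
  let f (z : ℂ) : ℂ := Complex.exp (-(z * a)) * B' (flow z u) (flow z v)
  have hmem (z : ℂ) {v : E} (hv : v ∈ P) : flow z v ∈ P :=
    exp_apply_mem (fun v hv => P.smul_mem z (hP v hv)) hv
  have hflow (v : E) (z : ℂ) : HasDerivAt (fun z => flow z v) (X (flow z v)) z :=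
    (ContinuousLinearMap.apply ℂ E v).hasFDerivAt.comp_hasDerivAt z (hasDerivAt_exp_smul_const' X z)
  have hf (z : ℂ) : HasDerivAt f 0 z := by
    have hexp : HasDerivAt (fun z : ℂ => Complex.exp (-(z * a)))
        (Complex.exp (-(z * a)) * -a) z := by
      simpa using ((hasDerivAt_id z).mul_const a).neg.cexp
    refine (hexp.mul (ContinuousLinearMap.hasDerivAt_of_bilinear (B := B') (fun _ => hflow u z)
      (fun _ => hflow v z))).congr_deriv ?_
    have hinf : B' (X (flow z u)) (flow z v) + B' (flow z u) (X (flow z v)) =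
        a * B' (flow z u) (flow z v) := hX _ (hmem z hu) _ (hmem z hv)
    rw [add_comm (B' _ (X _)), hinf]
    ring
  have hconst : f z = f 0 :=
    is_const_of_deriv_eq_zero (fun z => (hf z).differentiableAt) (fun z => (hf z).deriv) z 0
  have hf0 : f 0 = B u v := by simp [f, flow, B']
  change B' (flow z u) (flow z v) = _
  rw [← hf0, ← hconst, ← mul_assoc, ← Complex.exp_add, add_neg_cancel, Complex.exp_zero, one_mul]

namespace Datum

variable {D : Datum E}

theorem isSimilitude_expUnit {a : ℝ} {X : E →L[ℂ] E} (hr : D.IsReal X)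
    (hW : ∀ k, ∀ v ∈ D.W k, X v ∈ D.W k)
    (hX : ∀ w, ∀ u ∈ D.W w, ∀ v ∈ D.W w,
      D.S w (X u) v + D.S w u (X v) = ((a * w : ℝ) : ℂ) * D.S w u v) (r : ℝ) :
    D.IsSimilitude (Real.exp (r * a)) (expUnit ℂ ((r : ℂ) • X)) where
  real := by
    rw [val_expUnit, D.bar_exp, D.bar_smul, Complex.conj_ofReal, D.isReal_iff.1 hr]
  map_W k := by
    have hflow (z : ℂ) {v : E} (hv : v ∈ D.W k) :
        (NormedSpace.exp (z • X) : E →L[ℂ] E) v ∈ D.W k :=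
      exp_apply_mem (fun v hv => (D.W k).smul_mem z (hW k v hv)) hv
    refine le_antisymm (Submodule.map_le_iff_le_comap.2 fun v hv => hflow r hv) fun v hv => ?_
    refine ⟨_, hflow (-r) hv, ?_⟩
    rw [neg_smul]
    exact DFunLike.congr_fun (expUnit ℂ ((r : ℂ) • X)).mul_inv v
  pos := Real.exp_pos _
  scale w u hu v hv := by
    rw [val_expUnit, apply_exp_exp_of_infinitesimal (D.S w) (hW w) (hX w) hu hv, Complex.ofReal_exp,
      ← Complex.exp_int_mul]
    congr 2
    push_cast
    ring

theorem IsSimilitude.mul {c d : ℝ} {t u : (E →L[ℂ] E)ˣ} (ht : D.IsSimilitude c t)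
    (hu : D.IsSimilitude d u) : D.IsSimilitude (c * d) (t * u) where
  real := by rw [Units.val_mul, map_mul, ht.real, hu.real]
  map_W k := by
    have hmap := Submodule.map_comp ((u : E →L[ℂ] E) : E →ₗ[ℂ] E) ((t : E →L[ℂ] E) : E →ₗ[ℂ] E)
      (D.W k)
    rwa [hu.map_W, ht.map_W] at hmap
  pos := mul_pos ht.pos hu.pos
  scale w x hx y hy := by
    rw [Units.val_mul, mul_apply_eq_comp, mul_apply_eq_comp,
      ht.scale w _ (hu.apply_mem_W.2 hx) _ (hu.apply_mem_W.2 hy), hu.scale w x hx y hy,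
      Complex.ofReal_mul, mul_zpow, mul_assoc]

theorem isSimilitude_one : D.IsSimilitude 1 1 where
  real := map_one _
  map_W k := Submodule.map_id _
  pos := one_pos
  scale w u _ v _ := by simp

theorem isSimilitude_one_list_prod (l : List (E →L[ℂ] E)ˣ) (hl : ∀ t ∈ l, D.IsSimilitude 1 t) :
    D.IsSimilitude 1 l.prod :=
  List.prod_induction (D.IsSimilitude 1) (fun _ _ ht hu => one_mul (1 : ℝ) ▸ ht.mul hu)
    isSimilitude_one hl

theorem IsRealGrading.isSimilitude_expUnit {Y : E →L[ℂ] E} (hY : D.IsRealGrading Y) (r : ℝ) :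
    D.IsSimilitude (Real.exp (r * 2)) (expUnit ℂ ((r : ℂ) • Y)) := by
  refine Datum.isSimilitude_expUnit hY.real (fun k v hv => ?_) (fun w u hu v hv => ?_) r
  · simpa using add_mem (D.W_mono (show k - 1 ≤ k by lia) (hY.apply_sub_mem k v hv))
      ((D.W k).smul_mem (k : ℂ) hv)
  · have hleft : D.S w (Y u) v = w * D.S w u v := by
      have hzero := S_left_eq_zero (hY.apply_sub_mem w u hu) hv
      rwa [map_sub, map_smul, LinearMap.sub_apply, sub_eq_zero] at hzero
    have hright : D.S w u (Y v) = w * D.S w u v := by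
      have hzero := S_right_eq_zero hu (hY.apply_sub_mem w v hv)
      rwa [map_sub, map_smul, sub_eq_zero] at hzero
    rw [hleft, hright]
    push_cast
    ring

theorem isSimilitude_one_expUnit {X : E →L[ℂ] E} (hX : X ∈ D.gR) (r : ℝ) :
    D.IsSimilitude 1 (expUnit ℂ ((r : ℂ) • X)) := by
  have h := isSimilitude_expUnit (a := 0) hX.1 hX.2.1 (fun w u hu v hv => by
    simp [hX.2.2 w u hu v hv]) r
  rwa [mul_zero, Real.exp_zero] at h

theorem TwistDatum.exists_isSimilitude_t {r : ℕ} [NeZero r] (T : D.TwistDatum r) {y : Fin r → ℝ}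
    (hy : 0 < y 0) : ∃ t : (E →L[ℂ] E)ˣ, (t : E →L[ℂ] E) = T.t y ∧ D.IsSimilitude (y 0)⁻¹ t := by
  let gradingPart := expUnit ℂ (((-(Real.log (y 0) / 2) : ℝ) : ℂ) • T.Y₀)
  let isometries := List.ofFn fun j => expUnit ℂ (((-(Real.log (y j) / 2) : ℝ) : ℂ) • T.H j)
  have hgrading : D.IsSimilitude (y 0)⁻¹ gradingPart := by
    have h := T.grading.isSimilitude_expUnit (-(Real.log (y 0) / 2))
    rwa [neg_mul, div_mul_cancel₀ _ two_ne_zero, Real.exp_neg, Real.exp_log hy] at h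
  have hisometries : D.IsSimilitude 1 isometries.prod :=
    isSimilitude_one_list_prod _ fun t ht => by
      obtain ⟨j, rfl⟩ := (List.mem_ofFn' _ _).1 ht
      exact isSimilitude_one_expUnit (T.H_mem j) _
  refine ⟨gradingPart * isometries.prod, ?_, mul_one (y 0)⁻¹ ▸ hgrading.mul hisometries⟩
  have hcoe : (isometries.prod : E →L[ℂ] E) =
      (List.ofFn fun j => powEnd (y j) (-((1 / 2 : ℂ) • T.H j))).prod := by
    rw [← Units.coeHom_apply, map_list_prod, List.map_ofFn]
    simp only [powEnd_neg_half]
    rfl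
  rw [TwistDatum.t, powEnd_neg_half, Units.val_mul, hcoe, val_expUnit]

end Datum

end Twist

/-! ### Continuity of the Deligne splitting -/

section Continuity

section PartialSum

variable {ι A : Type*} [Ring A]

/-- The projection onto the sum of the summands whose index lies in `s`. -/
def partialSum (π : ι → A) (s : Set ι) : A := ∑ᶠ x ∈ s, π x

/-- The sum of the blocks `π' x * X * π x`: the part of `X` that preserves the index. -/
def diagonalPart (π' π : ι → A) (X : A) : A := ∑ᶠ x, π' x * X * π x

theorem partialSum_singleton (π : ι → A) (x : ι) : partialSum π {x} = π x :=
  finsum_mem_singleton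

variable {π π' : ι → A}

namespace IsGradingFamily

theorem partialSum_sdiff (hπ : IsGradingFamily π) {s t : Set ι} (h : s ⊆ t) :
    partialSum π (t \ s) = partialSum π t - partialSum π s :=
  eq_sub_of_add_eq' (finsum_mem_add_sdiff' h (hπ.finite_support.inter_of_right t))

theorem partialSum_compl (hπ : IsGradingFamily π) (s : Set ι) :
    partialSum π sᶜ = 1 - partialSum π s := by
  rw [Set.compl_eq_univ_sdiff, hπ.partialSum_sdiff s.subset_univ, partialSum, finsum_mem_univ,
    hπ.finsum_eq_one]

theorem partialSum_mul_mul_partialSum_eq_zero (hπ : IsGradingFamily π) (hπ' : IsGradingFamily π')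
    {X : A} {s t : Set ι} (h : ∀ x ∈ s, ∀ y ∈ t, π' x * X * π y = 0) :
    partialSum π' s * X * partialSum π t = 0 := by
  rw [partialSum, partialSum, ← finsum_mem_inter_support, ← finsum_mem_inter_support _ t,
    finsum_mem_eq_finite_toFinset_sum _ (hπ'.finite_support.inter_of_right s),
    finsum_mem_eq_finite_toFinset_sum _ (hπ.finite_support.inter_of_right t), Finset.sum_mul,
    Finset.sum_mul_sum]
  refine Finset.sum_eq_zero fun x hx => Finset.sum_eq_zero fun y hy => ?_
  rw [Set.Finite.mem_toFinset] at hx hy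
  exact h x hx.1 y hy.1

theorem diagonalPart_eq_sum (hπ : IsGradingFamily π) (π' : ι → A) (X : A) :
    diagonalPart π' π X = ∑ x ∈ hπ.finite_support.toFinset, π' x * X * π x :=
  finsum_eq_sum_of_support_subset _ fun x hx => by
    rw [Set.Finite.coe_toFinset]
    exact right_ne_zero_of_mul hx

theorem diagonalPart_mul (hπ : IsGradingFamily π) (π' : ι → A) (X : A) (x : ι) :
    diagonalPart π' π X * π x = π' x * X * π x := by
  rw [hπ.diagonalPart_eq_sum, Finset.sum_mul, Finset.sum_eq_single x]
  · rw [mul_assoc, (hπ.idem x).eq]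
  · intro y _ hy
    rw [mul_assoc, hπ.ortho hy, mul_zero]
  · intro hx
    rw [Set.Finite.mem_toFinset, Function.notMem_support] at hx
    rw [hx, mul_zero]

theorem mul_diagonalPart (hπ : IsGradingFamily π) (hπ' : IsGradingFamily π') (X : A) (x : ι) :
    π' x * diagonalPart π' π X = π' x * X * π x := by
  rw [hπ.diagonalPart_eq_sum, Finset.mul_sum, Finset.sum_eq_single x]
  · rw [← mul_assoc, ← mul_assoc, (hπ'.idem x).eq]
  · intro y _ hy
    rw [← mul_assoc, ← mul_assoc, hπ'.ortho hy.symm, zero_mul, zero_mul]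
  · intro hx
    rw [Set.Finite.mem_toFinset, Function.notMem_support] at hx
    rw [hx, mul_zero, mul_zero]

theorem diagonalPart_mul_diagonalPart (hπ : IsGradingFamily π) (hπ' : IsGradingFamily π')
    {r : ι → ι → Prop} (hr : ∀ x y, r x y → r y x → x = y) {X Y : A} (hXY : Y * X = 1)
    (hX : ∀ x y, ¬ r x y → π' x * X * π y = 0) (hY : ∀ x y, ¬ r x y → π x * Y * π' y = 0) :
    diagonalPart π π' Y * diagonalPart π' π X = 1 := by
  refine hπ.ext_right fun x => ?_
  calc diagonalPart π π' Y * diagonalPart π' π X * π x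
      = π x * Y * π' x * (X * π x) := by
        rw [mul_assoc, hπ.diagonalPart_mul, mul_assoc (π' x), ← mul_assoc,
          hπ'.diagonalPart_mul]
    _ = ∑ y ∈ hπ'.finite_support.toFinset, π x * Y * π' y * (X * π x) := by
        symm
        refine Finset.sum_eq_single x (fun y _ hy => ?_) fun hx => ?_
        · by_cases hxy : r x y
          · have hyx : ¬ r y x := fun h => hy (hr y x h hxy)
            rw [← (hπ'.idem y).eq, ← mul_assoc (π x * Y), mul_assoc _ (π' y) (X * π x),
              ← mul_assoc (π' y) X, hX y x hyx, mul_zero]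
          · rw [hY x y hxy, zero_mul]
        · rw [Set.Finite.mem_toFinset, Function.notMem_support] at hx
          rw [hx, mul_zero, zero_mul]
    _ = 1 * π x := by
        rw [← Finset.sum_mul, ← Finset.mul_sum, hπ'.sum_toFinset_eq_one, mul_one, mul_assoc,
          ← mul_assoc Y, hXY, one_mul, (hπ.idem x).eq]

theorem exists_unit_eq_diagonalPart (hπ : IsGradingFamily π) (hπ' : IsGradingFamily π')
    {r : ι → ι → Prop} (hr : ∀ x y, r x y → r y x → x = y) (h : Aˣ)
    (hh : ∀ x y, ¬ r x y → π' x * h * π y = 0) (hh' : ∀ x y, ¬ r x y → π x * ↑h⁻¹ * π' y = 0) :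
    ∃ u : Aˣ, (u : A) = diagonalPart π' π h ∧ ∀ x, π' x = u * π x * ↑u⁻¹ := by
  refine ⟨⟨diagonalPart π' π h, diagonalPart π π' ↑h⁻¹,
    hπ'.diagonalPart_mul_diagonalPart hπ hr h.mul_inv hh' hh,
    hπ.diagonalPart_mul_diagonalPart hπ' hr h.inv_mul hh hh'⟩, rfl, fun x => ?_⟩
  rw [Units.eq_mul_inv_iff_mul_eq]
  exact (hπ.mul_diagonalPart hπ' _ x).trans (hπ.diagonalPart_mul π' _ x).symm

end IsGradingFamily

end PartialSum

/- If `g` carries the range of `P` to that of `P'` and `h` carries the kernel of `P` to that of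
`P'`, then `g * P + h * (1 - P)` carries `P` to `P'`. -/
theorem exists_unit_of_range_of_ker {A : Type*} [Ring A] {P P' : A} {g h : Aˣ}
    (hg : (1 - P') * g * P = 0) (hg' : (1 - P) * ↑g⁻¹ * P' = 0) (hh : P' * h * (1 - P) = 0)
    (hh' : P * ↑h⁻¹ * (1 - P') = 0) :
    ∃ u : Aˣ, (u : A) = g * P + h * (1 - P) ∧ P' = g * P * ↑u⁻¹ := by
  have intertwines {P P' : A} {g h : Aˣ} (hg : (1 - P') * g * P = 0) (hh : P' * h * (1 - P) = 0) :
      P' * (g * P + h * (1 - P)) = g * P := by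
    rw [mul_add, ← mul_assoc, ← mul_assoc, hh, add_zero]
    simpa [sub_mul, sub_eq_zero, eq_comm] using hg
  have inv_mul {P P' : A} {g h : Aˣ} (hg : (1 - P') * g * P = 0) (hh : P' * h * (1 - P) = 0) :
      (↑g⁻¹ * P' + ↑h⁻¹ * (1 - P')) * (g * P + h * (1 - P)) = 1 := by
    rw [add_mul, mul_assoc, mul_assoc, sub_mul, intertwines hg hh, one_mul, add_sub_cancel_left,
      Units.inv_mul_cancel_left, Units.inv_mul_cancel_left, add_sub_cancel]
  refine ⟨⟨g * P + h * (1 - P), ↑g⁻¹ * P' + ↑h⁻¹ * (1 - P'), ?_, inv_mul hg hh⟩, rfl, ?_⟩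
  · exact inv_mul (g := g⁻¹) (h := h⁻¹) hg' hh'
  · rw [Units.eq_mul_inv_iff_mul_eq]
    exact intertwines hg hh

theorem continuous_val_inv {X R : Type*} [TopologicalSpace X] [NormedRing R]
    [HasSummableGeomSeries R] {f : X → Rˣ} (hf : Continuous fun x => (f x : R)) :
    Continuous fun x => (↑(f x)⁻¹ : R) :=
  Units.continuous_val.comp (Units.isOpenEmbedding_val.isInducing.continuous_iff.2 hf).inv

variable {E : Type*} [NormedAddCommGroup E] [NormedSpace ℂ E]

theorem map_inv_eq_self {P : Submodule ℂ E} {g : (E →L[ℂ] E)ˣ}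
    (hg : P.map ((g : E →L[ℂ] E) : E →ₗ[ℂ] E) = P) :
    P.map ((↑g⁻¹ : E →L[ℂ] E) : E →ₗ[ℂ] E) = P := by
  conv_lhs => rw [← hg]
  rw [← Submodule.map_comp]
  exact (congrArg (fun X : E →L[ℂ] E => P.map (X : E →ₗ[ℂ] E)) g.inv_mul).trans P.map_id

theorem act_inv_act (g : (E →L[ℂ] E)ˣ) (F : ℤ → Submodule ℂ E) : act ↑g⁻¹ (act g F) = F := by
  rw [← act_mul, g.inv_mul, act_one]

namespace Datum

variable [FiniteDimensional ℂ E] {D : Datum E} {F F' : ℤ → Submodule ℂ E}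

theorem Decomposes.pr_mul_mul_pr_eq_zero (hF : D.Decomposes F) (hF' : D.Decomposes F')
    {X : E →L[ℂ] E} {s : Set (ℤ × ℤ)} {x y : ℤ × ℤ}
    (hX : ∀ v ∈ D.bigr F y.1 y.2, X v ∈ D.bigrSum F' s) (hx : x ∉ s) :
    D.pr F' x * X * D.pr F y = 0 := by
  ext v
  exact hF'.mem_bigrSum_iff.1 (hX _ (hF.pr_mem y v)) x hx

namespace IsGradedPolarizedMHS

variable (hF : D.IsGradedPolarizedMHS F) (hF' : D.IsGradedPolarizedMHS F')
include hF hF'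

theorem pr_mul_mul_pr_eq_zero_of_lt {g : E →L[ℂ] E} (hg : act g F = F') {x y : ℤ × ℤ}
    (hxy : x.1 < y.1) : D.pr F' x * g * D.pr F y = 0 := by
  refine hF.decomposes.pr_mul_mul_pr_eq_zero hF'.decomposes (s := {x | y.1 ≤ x.1})
    (fun v hv => ?_) (not_le.2 hxy)
  rw [← hF'.F_eq_bigrSum, ← hg]
  exact ⟨v, bigr_le_F _ _ hv, rfl⟩

variable {g : (E →L[ℂ] E)ˣ} (hW : ∀ k, (D.W k).map ((g : E →L[ℂ] E) : E →ₗ[ℂ] E) = D.W k)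
  (hg : act g F = F')
include hW hg

theorem pr_mul_bar_mul_pr_eq_zero {x y : ℤ × ℤ} (hxy : ¬ (x = y ∨ x.1 < y.1)) :
    D.pr F' x * D.bar g * D.pr F y = 0 := by
  refine hF.decomposes.pr_mul_mul_pr_eq_zero hF'.decomposes
    (s := {x | x = (y.1, y.2) ∨ x.1 < y.1 ∧ x.1 + x.2 ≤ y.1 + y.2}) (fun v hv => ?_)
    fun hx => hxy (hx.imp_right And.left)
  have hinj : Function.Injective (D.bar g) :=
    unit_injective (Units.map (D.bar : (E →L[ℂ] E) →* E →L[ℂ] E) g)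
  have hWbar (k : ℤ) : (D.W k).map (D.bar g : E →ₗ[ℂ] E) = D.W k := by
    have hconj : D.conjSub (D.W k) = D.W k := Submodule.ext fun _ => D.conj_mem_W
    rw [← hconj, ← conjSub_map, hW]
  rw [← hF'.bigrCover_eq_bigrSum, ← hg,
    bigrCover_act hinj hWbar]
  exact ⟨v, bigr_le_bigrCover _ _ hv, rfl⟩

theorem exists_unit_partialSum_pr (p : ℤ) : ∃ u : (E →L[ℂ] E)ˣ,
    (u : E →L[ℂ] E) = g * partialSum (D.pr F) {x | p ≤ x.1} +
      D.bar g * (1 - partialSum (D.pr F) {x | p ≤ x.1}) ∧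
    partialSum (D.pr F') {x | p ≤ x.1} = g * partialSum (D.pr F) {x | p ≤ x.1} * ↑u⁻¹ := by
  have hπ := hF.decomposes.isGradingFamily
  have hπ' := hF'.decomposes.isGradingFamily
  have hg' : act ↑g⁻¹ F' = F := hg ▸ act_inv_act g F
  have hW' (k : ℤ) := map_inv_eq_self (hW k)
  have hlt {x : ℤ × ℤ} (hx : x ∈ {x : ℤ × ℤ | p ≤ x.1}ᶜ) : x.1 < p := not_le.1 hx
  let h : (E →L[ℂ] E)ˣ := Units.map (D.bar : (E →L[ℂ] E) →* E →L[ℂ] E) g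
  refine exists_unit_of_range_of_ker (h := h) ?_ ?_ ?_ ?_ <;>
    rw [← IsGradingFamily.partialSum_compl ‹_›]
  · exact hπ.partialSum_mul_mul_partialSum_eq_zero hπ' fun x hx y hy =>
      hF.pr_mul_mul_pr_eq_zero_of_lt hF' hg ((hlt hx).trans_le hy)
  · exact hπ'.partialSum_mul_mul_partialSum_eq_zero hπ fun x hx y hy =>
      hF'.pr_mul_mul_pr_eq_zero_of_lt hF hg' ((hlt hx).trans_le hy)
  · exact hπ.partialSum_mul_mul_partialSum_eq_zero hπ' fun x hx y hy =>
      hF.pr_mul_bar_mul_pr_eq_zero hF' hW hg fun h => by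
        rcases h with rfl | h
        exacts [hy hx, ((hlt hy).trans_le hx).not_gt h]
  · exact hπ'.partialSum_mul_mul_partialSum_eq_zero hπ fun x hx y hy =>
      hF'.pr_mul_bar_mul_pr_eq_zero hF hW' hg' fun h => by
        rcases h with rfl | h
        exacts [hy hx, ((hlt hy).trans_le hx).not_gt h]

/- The diagonal part of `D.bar g` depends on the target only through the coarser decomposition by
the first index, whose projections come from the two filtrations. -/
theorem exists_unit_conj_pr : ∃ u : (E →L[ℂ] E)ˣ,
    (u : E →L[ℂ] E) = ∑ x ∈ hF.decomposes.isGradingFamily.finite_support.toFinset,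
      (partialSum (D.pr F') {y | x.1 ≤ y.1} - partialSum (D.pr F') {y | x.1 + 1 ≤ y.1}) *
        D.bar g * D.pr F x ∧
    ∀ x, D.pr F' x = u * D.pr F x * ↑u⁻¹ := by
  have hπ := hF.decomposes.isGradingFamily
  have hπ' := hF'.decomposes.isGradingFamily
  have hg' : act ↑g⁻¹ F' = F := hg ▸ act_inv_act g F
  obtain ⟨u, hu, hconj⟩ := hπ.exists_unit_eq_diagonalPart hπ' (r := fun x y => x = y ∨ x.1 < y.1)
    (fun x y h h' => h.elim id fun h => h'.elim Eq.symm fun h' => absurd h' h.not_gt)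
    (Units.map (D.bar : (E →L[ℂ] E) →* E →L[ℂ] E) g)
    (fun x y => hF.pr_mul_bar_mul_pr_eq_zero hF' hW hg)
    (fun x y => hF'.pr_mul_bar_mul_pr_eq_zero hF (fun k => map_inv_eq_self (hW k)) hg')
  refine ⟨u, ?_, hconj⟩
  rw [hu, hπ.diagonalPart_eq_sum]
  refine Finset.sum_congr rfl fun x _ => ?_
  have hsub : {y : ℤ × ℤ | x.1 + 1 ≤ y.1} ⊆ {y | x.1 ≤ y.1} := fun y hy =>
    (Int.le_add_one le_rfl).trans hy
  have hrow : {x} ⊆ {y : ℤ × ℤ | x.1 ≤ y.1} \ {y | x.1 + 1 ≤ y.1} := by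
    simp
  have hzero : partialSum (D.pr F') (({y | x.1 ≤ y.1} \ {y | x.1 + 1 ≤ y.1}) \ {x}) * D.bar g *
      partialSum (D.pr F) {x} = 0 := by
    refine hπ.partialSum_mul_mul_partialSum_eq_zero hπ' fun y hy z hz => ?_
    obtain rfl : z = x := hz
    exact hF.pr_mul_bar_mul_pr_eq_zero hF' hW hg (not_or.2 ⟨hy.2, not_lt.2 hy.1.1⟩)
  rw [hπ'.partialSum_sdiff hrow, hπ'.partialSum_sdiff hsub, partialSum_singleton,
    partialSum_singleton, sub_mul, sub_mul, sub_eq_zero] at hzero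
  exact hzero.symm

end IsGradedPolarizedMHS

theorem continuous_pr (x : ℤ × ℤ) : Continuous fun F : D.ClassifyingSpace => D.pr F.fil x := by
  refine continuous_iSup_dom.2 fun F => continuous_coinduced_dom.2 ?_
  let Z := {g : E →L[ℂ] E // g ∈ D.GC ∧ D.IsGradedPolarizedMHS (act g F.fil)}
  change Continuous fun g : Z => D.pr (act g.1 F.fil) x
  have hcont : Continuous fun g : Z => g.1 := continuous_subtype_val
  have hbar : Continuous fun g : Z => D.bar g.1 := D.continuous_bar.comp hcont
  have hpartial (p : ℤ) : Continuous fun g : Z =>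
      partialSum (D.pr (act g.1 F.fil)) {x | p ≤ x.1} := by
    choose u hu hconj using fun g : Z =>
      F.prop.exists_unit_partialSum_pr g.2.2 (g := g.2.1.1.unit) g.2.1.2.1 rfl p
    have hcont_u : Continuous fun g : Z => (u g : E →L[ℂ] E) := by
      refine Continuous.congr ?_ fun g => (hu g).symm
      exact (hcont.mul continuous_const).add (hbar.mul continuous_const)
    exact ((hcont.mul continuous_const).mul (continuous_val_inv hcont_u)).congr fun g =>
      (hconj g).symm
  choose u hu hconj using fun g : Z =>
    F.prop.exists_unit_conj_pr g.2.2 (g := g.2.1.1.unit) g.2.1.2.1 rfl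
  have hcont_u : Continuous fun g : Z => (u g : E →L[ℂ] E) := by
    refine Continuous.congr ?_ fun g => (hu g).symm
    exact continuous_finsetSum _ fun y _ =>
      (((hpartial y.1).sub (hpartial (y.1 + 1))).mul hbar).mul continuous_const
  exact ((hcont_u.mul continuous_const).mul (continuous_val_inv hcont_u)).congr fun g =>
    (hconj g x).symm

end Datum

end Continuity

/-! ### Distance from the split locus -/

section Distance

open Filter Topology

theorem exists_eventually_quadratic_bounds {X E : Type*} [TopologicalSpace X]
    [NormedAddCommGroup E] [NormedSpace ℂ E] [FiniteDimensional ℂ E] {Q : X → E → ℝ}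
    (hQ : Continuous fun z : X × E => Q z.1 z.2)
    (hsmul : ∀ x (a : ℝ) u, Q x ((a : ℂ) • u) = a ^ 2 * Q x u) {x₀ : X}
    (hpos : ∀ u, u ≠ 0 → 0 < Q x₀ u) :
    ∃ a b : ℝ, 0 < a ∧ 0 < b ∧ ∀ᶠ x in 𝓝 x₀, ∀ u, a * ‖u‖ ^ 2 ≤ Q x u ∧ Q x u ≤ b * ‖u‖ ^ 2 := by
  have hS : IsCompact (Metric.sphere (0 : E) 1) :=
    have := FiniteDimensional.proper ℂ E
    isCompact_sphere _ _
  have hcont : ContinuousOn (Q x₀) (Metric.sphere 0 1) :=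
    (hQ.comp (continuous_const.prodMk continuous_id)).continuousOn
  obtain ⟨a, ha, ha'⟩ := hS.exists_forall_le' hcont (a := 0)
    fun u hu => hpos u (by rintro rfl; simp at hu)
  obtain ⟨b, hb⟩ := hS.bddAbove_image hcont
  have hsphere : ∀ᶠ x in 𝓝 x₀, ∀ u ∈ Metric.sphere (0 : E) 1,
      Q x u ∈ Set.Ioo (a / 2) (max b 0 + 1) := by
    refine hS.eventually_forall_of_forall_eventually fun u hu => ?_
    refine (hQ.tendsto (x₀, u)).eventually (isOpen_Ioo.mem_nhds ⟨?_, ?_⟩)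
    · exact (half_lt_self ha).trans_le (ha' u hu)
    · exact ((hb ⟨u, hu, rfl⟩).trans (le_max_left b 0)).trans_lt (lt_add_one _)
  refine ⟨a / 2, max b 0 + 1, half_pos ha, by positivity, ?_⟩
  filter_upwards [hsphere] with x hx u
  obtain rfl | hu := eq_or_ne u 0
  · have hzero : Q x 0 = 0 := by simpa using hsmul x 0 0
    simp [hzero]
  · have hnorm : 0 < ‖u‖ := norm_pos_iff.2 hu
    have hbounds := hx (((‖u‖⁻¹ : ℝ) : ℂ) • u) (by
      rw [mem_sphere_zero_iff_norm, norm_smul, Complex.norm_real, norm_inv, norm_norm,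
        inv_mul_cancel₀ hnorm.ne'])
    rw [hsmul, inv_pow, inv_mul_eq_div, Set.mem_Ioo, lt_div_iff₀ (by positivity),
      div_lt_iff₀ (by positivity)] at hbounds
    exact ⟨hbounds.1.le, hbounds.2.le⟩

namespace Datum

variable {E : Type*} [NormedAddCommGroup E] [NormedSpace ℂ E] {D : Datum E}
  {F : ℤ → Submodule ℂ E}

theorem IsGradedPolarizedMHS.hodge_number_ne_zero [FiniteDimensional ℂ E]
    (hF : D.IsGradedPolarizedMHS F) {x : ℤ × ℤ} (hx : D.bigr F x.1 x.2 ≠ ⊥) :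
    D.h x.1 x.2 ≠ 0 := by
  intro h0
  have hfinrank := hF.hodge_number x.1 x.2
  rw [h0, add_zero] at hfinrank
  have hle : D.W (x.1 + x.2 - 1) ≤ D.grHodge F x.1 x.2 := fun v hv =>
    ⟨le_sup_right (a := F x.1 ⊓ D.W (x.1 + x.2)) hv,
      le_sup_right (a := F x.2 ⊓ D.W (x.1 + x.2)) (D.W_real _ _ hv)⟩
  refine hx ((Submodule.eq_bot_iff _).2 fun v hv => hF.eq_zero_of_mem_bigr_of_mem_W hv ?_)
  rw [Submodule.eq_of_le_of_finrank_eq hle hfinrank.symm]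
  exact bigr_le_grHodge _ _ hv

variable [FiniteDimensional ℂ E]

variable (D) in
theorem exists_finset_forall_pr_eq_zero : ∃ J : Finset (ℤ × ℤ),
    ∀ F, D.IsGradedPolarizedMHS F → ∀ x ∉ J, D.pr F x = 0 := by
  obtain ⟨k, hk⟩ := D.W_bot
  obtain ⟨l, hl⟩ := D.W_top
  refine ⟨(Finset.Ioc k l).biUnion fun w => (D.h_finite w).toFinset.image fun p => (p, w - p),
    fun F hF x hx => ?_⟩
  have hbot : D.bigr F x.1 x.2 = ⊥ := by
    by_contra hne
    refine hx (Finset.mem_biUnion.2 ⟨x.1 + x.2, ?_, Finset.mem_image.2 ⟨x.1, ?_, by ext <;> simp⟩⟩)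
    · exact Finset.mem_Ioc.2 ⟨lt_of_W_eq_bot hk hne, hF.le_of_W_eq_top hl hne⟩
    · rw [Set.Finite.mem_toFinset, Function.mem_support, add_sub_cancel_left]
      exact hF.hodge_number_ne_zero hne
  ext v
  exact (Submodule.mem_bot ℂ).1 (hbot ▸ hF.decomposes.pr_mem x v)

/-! ### Hodge components -/

theorem comp_eq_zero_of_notMem {J : Finset (ℤ × ℤ)} (hJ : ∀ x ∉ J, D.pr F x = 0)
    (X : E →L[ℂ] E) {d : ℤ × ℤ} (hd : d ∉ (J ×ˢ J).image fun z => z.1 - z.2) :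
    D.comp F X d.1 d.2 = 0 := by
  refine finsum_eq_zero_of_forall_eq_zero fun x => ?_
  change D.pr F (x + d) * X * D.pr F x = 0
  by_cases hx : x ∈ J
  · rw [hJ (x + d), zero_mul, zero_mul]
    exact fun hxd => hd (Finset.mem_image.2
      ⟨(x + d, x), Finset.mk_mem_product hxd hx, add_sub_cancel_left x d⟩)
  · rw [hJ x hx, mul_zero]

namespace Decomposes

variable (hF : D.Decomposes F)
include hF

theorem finite_support_comp (X : E →L[ℂ] E) :
    (Function.support fun d : ℤ × ℤ => D.comp F X d.1 d.2).Finite := by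
  simp only [hF.comp_eq_multiplier]
  exact hF.isGradingFamily.finite_support_multiplier_single X

theorem finsum_comp (X : E →L[ℂ] E) : ∑ᶠ d : ℤ × ℤ, D.comp F X d.1 d.2 = X := by
  have hsum := hF.isGradingFamily.finsum_smul_multiplier_single Function.injective_id
    (fun _ => (1 : ℂ)) X
  rw [show Function.extend id (fun _ : ℤ × ℤ => (1 : ℂ)) 0 = _ from
    funext (Function.injective_id.extend_apply _ _), hF.isGradingFamily.multiplier_one] at hsum
  simpa only [hF.comp_eq_multiplier, one_smul, id_eq, Prod.mk.eta] using hsum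

theorem comp_eq_zero_of_mem_lowering {X : E →L[ℂ] E} (hX : X ∈ lowering ℂ (D.pr F) 1)
    {d : ℤ × ℤ} (hd : ¬ (d.1 < 0 ∧ d.2 < 0)) : D.comp F X d.1 d.2 = 0 := by
  rw [hF.comp_eq_multiplier]
  refine hF.isGradingFamily.ext_blocks fun x y => ?_
  rw [hF.isGradingFamily.block_multiplier, mul_zero, zero_mul]
  obtain hxy | hxy := eq_or_ne (x - y) (d.1, d.2)
  · have h₁ : x.1 - y.1 = d.1 := congrArg Prod.fst hxy
    have h₂ : x.2 - y.2 = d.2 := congrArg Prod.snd hxy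
    rw [mem_lowering_one.1 hX x y fun h => hd ⟨by lia, by lia⟩, smul_zero]
  · rw [Pi.single_eq_of_ne hxy, zero_smul]

end Decomposes

theorem neg_two_div_add_pos {d : ℤ × ℤ} (hd : d.1 < 0 ∧ d.2 < 0) :
    0 < -2 / ((d.1 : ℝ) + (d.2 : ℝ)) :=
  div_pos_of_neg_of_neg (by simp) (add_neg (Int.cast_lt_zero.2 hd.1) (Int.cast_lt_zero.2 hd.2))

namespace IsGradedPolarizedMHS

variable (hF : D.IsGradedPolarizedMHS F)
include hF

theorem endNorm_zero : D.endNorm 1 F 0 = 0 := by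
  obtain ⟨ι, _, b, x, hb⟩ := hF.exists_isAdapted
  simp [hb.endNorm_eq hF.decomposes one_pos]

theorem endNorm_comp_eps_le {d : ℤ × ℤ} (hd : d.1 < 0 ∧ d.2 < 0) :
    D.endNorm 1 F (D.comp F (D.eps F) d.1 d.2) ≤
      (D.tau F - 1) ^ (-2 / ((d.1 : ℝ) + (d.2 : ℝ)))⁻¹ := by
  have hfin : (Function.support fun x : ℤ × ℤ => ∑ᶠ _ : x.1 < 0 ∧ x.2 < 0,
      D.endNorm 1 F (D.comp F (D.eps F) x.1 x.2) ^ (-2 / ((x.1 : ℝ) + (x.2 : ℝ)))).Finite := by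
    refine (hF.decomposes.finite_support_comp (D.eps F)).subset
      (Function.support_subset_iff'.2 fun x hx => ?_)
    rw [finsum_eq_if, ite_eq_right_iff]
    intro hneg
    rw [Function.notMem_support.1 hx, hF.endNorm_zero,
      Real.zero_rpow (neg_two_div_add_pos hneg).ne']
  have hterm := single_le_finsum (M := ℝ) d hfin fun x => finsum_nonneg fun _ =>
    Real.rpow_nonneg (endNorm_nonneg _ _ _) _
  rw [finsum_eq_if, if_pos hd, ← sub_eq_iff_eq_add'.2 (tau_eq F)] at hterm
  exact (Real.le_rpow_inv_iff_of_pos (endNorm_nonneg _ _ _) (sub_nonneg.2 (one_le_tau F))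
    (neg_two_div_add_pos hd)).2 hterm

theorem re_hodgeForm_smul (a : ℝ) (u : E) :
    (D.hodgeForm 1 F ((a : ℂ) • u) ((a : ℂ) • u)).re = a ^ 2 * (D.hodgeForm 1 F u u).re := by
  obtain ⟨ι, _, b, x, hb⟩ := hF.exists_isAdapted
  simp only [hb.hodgeForm_eq_weightedForm hF.decomposes, re_weightedForm_self, one_zpow, one_mul,
    map_smul, Finsupp.smul_apply, norm_smul, Complex.norm_real, mul_pow, Real.norm_eq_abs,
    sq_abs, Finset.mul_sum]

theorem re_hodgeForm_self_pos {u : E} (hu : u ≠ 0) : 0 < (D.hodgeForm 1 F u u).re := by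
  obtain ⟨ι, _, b, x, hb⟩ := hF.exists_isAdapted
  rw [hb.hodgeForm_eq_weightedForm hF.decomposes, re_weightedForm_self]
  obtain ⟨i, hi⟩ : ∃ i, b.repr u i ≠ 0 := by
    by_contra! hzero
    exact hu (b.repr.map_eq_zero_iff.1 (Finsupp.ext hzero))
  simp only [one_zpow, one_mul]
  exact Finset.sum_pos' (fun _ _ => sq_nonneg _) ⟨i, Finset.mem_univ i, by positivity⟩

theorem norm_le_endNorm {a b : ℝ} (ha : 0 < a) (hb : 0 < b)
    (hbounds : ∀ u, a * ‖u‖ ^ 2 ≤ (D.hodgeForm 1 F u u).re ∧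
      (D.hodgeForm 1 F u u).re ≤ b * ‖u‖ ^ 2) (X : E →L[ℂ] E) :
    ‖X‖ ≤ √(b / a) * D.endNorm 1 F X := by
  obtain ⟨ι, _, _, _, hadapted⟩ := hF.exists_isAdapted
  refine X.opNorm_le_bound (mul_nonneg (Real.sqrt_nonneg _) (endNorm_nonneg _ _ _)) fun u => ?_
  have hle : a * ‖X u‖ ^ 2 ≤ D.endNorm 1 F X ^ 2 * (b * ‖u‖ ^ 2) :=
    calc a * ‖X u‖ ^ 2 ≤ (D.hodgeForm 1 F (X u) (X u)).re := (hbounds _).1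
      _ ≤ D.endNorm 1 F X ^ 2 * (D.hodgeForm 1 F u u).re :=
        hadapted.hodgeForm_apply_le hF.decomposes X u
      _ ≤ D.endNorm 1 F X ^ 2 * (b * ‖u‖ ^ 2) := by gcongr; exact (hbounds u).2
  refine le_of_sq_le_sq ?_ (mul_nonneg (mul_nonneg (Real.sqrt_nonneg _)
    (endNorm_nonneg _ _ _)) (norm_nonneg _))
  rw [mul_pow, mul_pow, Real.sq_sqrt (by positivity), div_mul_eq_mul_div, div_mul_eq_mul_div,
    le_div_iff₀ ha]
  linarith

end IsGradedPolarizedMHS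

theorem continuous_weilForm {X : Type*} [TopologicalSpace X] {f g : X → E} (hf : Continuous f)
    (hg : Continuous g) (x : ℤ × ℤ) : Continuous fun z => D.weilForm x (f z) (g z) :=
  continuous_const.mul ((D.S (x.1 + x.2)).toContinuousBilinearMap.continuous₂.comp
    (hf.prodMk (D.continuous_conj.comp hg)))

theorem continuous_re_hodgeForm : Continuous fun z : D.ClassifyingSpace × E =>
    (D.hodgeForm 1 z.1.fil z.2 z.2).re := by
  obtain ⟨J, hJ⟩ := D.exists_finset_forall_pr_eq_zero
  have hsum (z : D.ClassifyingSpace × E) : D.hodgeForm 1 z.1.fil z.2 z.2 =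
      ∑ x ∈ J, D.weilForm x (D.pr z.1.fil x z.2) (D.pr z.1.fil x z.2) := by
    rw [hodgeForm_eq_finsum, finsum_eq_sum_of_support_subset (s := J)]
    · simp
    · intro x hx
      by_contra hxJ
      exact hx (by simp [hJ _ z.1.prop x hxJ])
  simp only [hsum]
  have hpr (x : ℤ × ℤ) : Continuous fun z : D.ClassifyingSpace × E => D.pr z.1.fil x z.2 :=
    ((continuous_pr x).comp continuous_fst).clm_apply continuous_snd
  exact Complex.continuous_re.comp (continuous_finsetSum _ fun x _ =>
    continuous_weilForm (hpr x) (hpr x) x)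

theorem exists_eventually_norm_le_endNorm (F : D.ClassifyingSpace) :
    ∃ K : ℝ, 0 ≤ K ∧ ∀ᶠ G in 𝓝 F, ∀ X : E →L[ℂ] E, ‖X‖ ≤ K * D.endNorm 1 G.fil X := by
  obtain ⟨a, b, ha, hb, hbounds⟩ := exists_eventually_quadratic_bounds
    (Q := fun (G : D.ClassifyingSpace) u => (D.hodgeForm 1 G.fil u u).re)
    continuous_re_hodgeForm (fun G => G.prop.re_hodgeForm_smul)
    (x₀ := F) fun u => F.prop.re_hodgeForm_self_pos
  exact ⟨√(b / a), Real.sqrt_nonneg _,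
    hbounds.mono fun G hG => G.prop.norm_le_endNorm ha hb hG⟩

section Limits

variable {l : Filter D.ClassifyingSpace} {F : D.ClassifyingSpace} (hl : l ≤ 𝓝 F)
  (hτ : Tendsto (fun G : D.ClassifyingSpace => D.tau G.fil) l (𝓝 1))
include hl hτ

theorem tendsto_comp_eps {d : ℤ × ℤ} (hd : d.1 < 0 ∧ d.2 < 0) :
    Tendsto (fun G : D.ClassifyingSpace => D.comp G.fil (D.eps G.fil) d.1 d.2) l (𝓝 0) := by
  obtain ⟨K, hK, hbound⟩ := exists_eventually_norm_le_endNorm F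
  have hpos := inv_pos.2 (neg_two_div_add_pos hd)
  have hlim : Tendsto (fun G : D.ClassifyingSpace =>
      K * (D.tau G.fil - 1) ^ (-2 / ((d.1 : ℝ) + (d.2 : ℝ)))⁻¹) l (𝓝 0) := by
    simpa only [sub_self, Real.zero_rpow hpos.ne', mul_zero] using
      ((hτ.sub_const 1).rpow_const (Or.inr hpos.le)).const_mul K
  refine squeeze_zero_norm' ?_ hlim
  filter_upwards [hl hbound] with G hG
  exact (hG _).trans (mul_le_mul_of_nonneg_left (G.prop.endNorm_comp_eps_le hd) hK)

theorem tendsto_eps : Tendsto (fun G : D.ClassifyingSpace => D.eps G.fil) l (𝓝 0) := by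
  obtain ⟨J, hJ⟩ := D.exists_finset_forall_pr_eq_zero
  have hsum (G : D.ClassifyingSpace) : ∑ d ∈ (J ×ˢ J).image fun z => z.1 - z.2,
      D.comp G.fil (D.eps G.fil) d.1 d.2 = D.eps G.fil := by
    conv_rhs => rw [← G.prop.decomposes.finsum_comp (D.eps G.fil)]
    refine (finsum_eq_sum_of_support_subset _ fun d hd => ?_).symm
    by_contra hnot
    exact hd (comp_eq_zero_of_notMem (hJ _ G.prop) _ hnot)
  have hlim := tendsto_finsetSum ((J ×ˢ J).image fun z => z.1 - z.2) fun d _ => by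
    by_cases hd : d.1 < 0 ∧ d.2 < 0
    · exact tendsto_comp_eps hl hτ hd
    · exact tendsto_const_nhds.congr fun G => (G.prop.decomposes.comp_eq_zero_of_mem_lowering
        G.prop.eps_mem_lowering hd).symm
  rw [Finset.sum_const_zero] at hlim
  exact hlim.congr hsum

theorem mem_splitLocus_of_tendsto_tau [l.NeBot] : F ∈ D.splitLocus := by
  have hε := tendsto_eps hl hτ
  have hpr (x : ℤ × ℤ) : Tendsto (fun G : D.ClassifyingSpace => D.pr G.fil x) l
      (𝓝 (D.pr F.fil x)) := ((continuous_pr x).tendsto F).mono_left hl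
  have hexp {f : D.ClassifyingSpace → E →L[ℂ] E} (hf : Tendsto f l (𝓝 0)) :
      Tendsto (fun G => NormedSpace.exp (f G)) l (𝓝 1) := by
    let _ := NormedAlgebra.restrictScalars ℚ ℂ (E →L[ℂ] E)
    simpa [Function.comp_def] using (NormedSpace.exp_continuous.tendsto (0 : E →L[ℂ] E)).comp hf
  have hexp_neg := hexp (by simpa using hε.neg)
  refine F.prop.decomposes.isSplit_iff.2 fun x => ?_
  have hbar := (D.continuous_bar.tendsto _).comp ((hexp_neg.mul (hpr x.swap)).mul (hexp hε))
  have hlim := (hexp_neg.mul (hpr x)).mul (hexp hε)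
  have heq := tendsto_nhds_unique hbar
    (hlim.congr fun G => (G.prop.bar_exp_eps_conj_pr x).symm)
  rw [prBar]
  simpa only [one_mul, mul_one] using heq

end Limits

theorem exists_forall_le_tau_sub_one {C : Set D.ClassifyingSpace} (hC : IsCompact C)
    (hsplit : Disjoint C D.splitLocus) : ∃ c : ℝ, 0 < c ∧ ∀ F ∈ C, c ≤ D.tau F.fil - 1 := by
  by_contra! hcon
  let l : Filter D.ClassifyingSpace := comap (fun G => D.tau G.fil) (𝓝 1) ⊓ 𝓟 C
  have hl : l.NeBot := by
    refine (inf_principal_neBot_iff).2 fun U ⟨V, hV, hVU⟩ => ?_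
    obtain ⟨c, hc, hcV⟩ := Metric.mem_nhds_iff.1 hV
    obtain ⟨G, hG, hGc⟩ := hcon c hc
    refine ⟨G, hVU (hcV ?_), hG⟩
    rwa [Metric.mem_ball, Real.dist_eq, abs_of_nonneg (sub_nonneg.2 (one_le_tau _))]
  obtain ⟨F, hFC, hF⟩ := hC (f := l) inf_le_right
  have hne : (𝓝 F ⊓ l).NeBot := hF
  exact Set.disjoint_left.1 hsplit hFC (mem_splitLocus_of_tendsto_tau (l := 𝓝 F ⊓ l) inf_le_left
    (tendsto_comap.mono_left (inf_le_right.trans inf_le_left)))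

end Datum

end Distance

/-! ### Lengths of paths -/

theorem ring_inverse_conjEquiv {A : Type*} [Ring A] [Algebra ℂ A] (t : Aˣ) (g : A) :
    Ring.inverse (conjEquiv t g) = conjEquiv t (Ring.inverse g) := by
  by_cases hg : IsUnit g
  · obtain ⟨u, rfl⟩ := hg
    rw [Ring.inverse_unit]
    exact Ring.inverse_unit (Units.map (conjEquiv t : A →* A) u)
  · rw [Ring.inverse_non_unit _ hg, Ring.inverse_non_unit _ ((MulEquiv.isUnit_map _).not.2 hg),
      map_zero]

namespace Datum

open MeasureTheory

variable {E : Type*} [NormedAddCommGroup E] [NormedSpace ℂ E] [FiniteDimensional ℂ E]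
  {D : Datum E}

namespace IsSimilitude

variable {c : ℝ} {t : (E →L[ℂ] E)ˣ} (ht : D.IsSimilitude c t)
include ht

theorem inv_apply_mem_W {k : ℤ} {v : E} : (↑t⁻¹ : E →L[ℂ] E) v ∈ D.W k ↔ v ∈ D.W k := by
  rw [← ht.toIsRealAut.apply_mem_W, ← mul_apply_eq_comp, t.mul_inv]
  rfl

theorem conjEquiv_mem_GC {g : E →L[ℂ] E} (hg : g ∈ D.GC) : conjEquiv t g ∈ D.GC := by
  obtain ⟨hunit, hW, hS⟩ := hg
  refine ⟨hunit.map (conjEquiv t), fun k => ?_, fun w u hu v hv => ?_⟩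
  · calc (D.W k).map ((conjEquiv t g : E →L[ℂ] E) : E →ₗ[ℂ] E)
        = (((D.W k).map ((↑t⁻¹ : E →L[ℂ] E) : E →ₗ[ℂ] E)).map (g : E →ₗ[ℂ] E)).map
            ((t : E →L[ℂ] E) : E →ₗ[ℂ] E) := by
          rw [← Submodule.map_comp, ← Submodule.map_comp]
          rfl
      _ = D.W k := by rw [map_inv_eq_self (ht.map_W k), hW, ht.map_W]
  · have hgW {v : E} (hv : v ∈ D.W w) : g v ∈ D.W w := hW w ▸ ⟨v, hv, rfl⟩
    have hu' := ht.inv_apply_mem_W.2 hu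
    have hv' := ht.inv_apply_mem_W.2 hv
    have hinv (v : E) : (t : E →L[ℂ] E) ((↑t⁻¹ : E →L[ℂ] E) v) = v :=
      DFunLike.congr_fun t.mul_inv v
    calc D.S w (conjEquiv t g u) (conjEquiv t g v)
        = c ^ w * D.S w ((↑t⁻¹ : E →L[ℂ] E) u) ((↑t⁻¹ : E →L[ℂ] E) v) := by
          rw [← hS w _ hu' _ hv', ← ht.scale w _ (hgW hu') _ (hgW hv')]
          rfl
      _ = D.S w u v := by rw [← ht.scale w _ hu' _ hv', hinv, hinv]

/-- The action of a similitude on the classifying space. -/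
def actPoint (F : D.ClassifyingSpace) : D.ClassifyingSpace :=
  ⟨act t F.fil, ht.isGradedPolarizedMHS_act F.prop⟩

theorem eq_actPoint {F G : D.ClassifyingSpace} (h : G.fil = act ↑t⁻¹ F.fil) :
    F = ht.actPoint G := by
  have hfil : F.fil = act t G.fil := by rw [h, ← act_mul, t.mul_inv, act_one]
  exact ClassifyingSpace.ext hfil

theorem isLift_act {γ : ℝ → D.ClassifyingSpace} {g : ℝ → E →L[ℂ] E} (hg : D.IsLift γ g) :
    D.IsLift (fun s => ht.actPoint (γ s)) fun s => conjEquiv t (g s) := by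
  refine ⟨(contDiffOn_const.mul hg.1).mul contDiffOn_const, fun s hs =>
    ⟨ht.conjEquiv_mem_GC (hg.2 s hs).1, ?_⟩⟩
  change act t (γ s).fil = act (conjEquiv t (g s)) (act t (γ 0).fil)
  rw [act_conjEquiv, (hg.2 s hs).2]

theorem speed_act {γ : ℝ → D.ClassifyingSpace} {g : ℝ → E →L[ℂ] E} (hg : D.IsLift γ g)
    {s : ℝ} (hs : s ∈ Set.Icc (0 : ℝ) 1) :
    D.speed (fun s => ht.actPoint (γ s)) (fun s => conjEquiv t (g s)) s =
      ENNReal.ofReal (D.endNorm (c + (D.tau (γ s).fil - 1)) (γ s).fil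
        (D.qPart (γ s).fil (derivWithin g (Set.Icc 0 1) s * Ring.inverse (g s)))) := by
  have hderiv : derivWithin (fun s => conjEquiv t (g s)) (Set.Icc 0 1) s =
      conjEquiv t (derivWithin g (Set.Icc 0 1) s) := by
    have hdiff : DifferentiableWithinAt ℝ g (Set.Icc 0 1) s :=
      hg.1.differentiableOn one_ne_zero s hs
    simp only [conjEquiv_apply]
    rw [derivWithin_mul_const (hdiff.const_mul _), derivWithin_const_mul _ hdiff]
  rw [speed, hderiv, ring_inverse_conjEquiv, ← map_mul]
  exact congrArg ENNReal.ofReal (ht.twistedNorm_act (γ s).prop _)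

theorem twistedDist_act_le {K : ℝ} {γ : ℝ → D.ClassifyingSpace} {P Q : D.ClassifyingSpace}
    (hγ : D.IsShortestGeodesic γ P Q)
    (hK : ∀ s ∈ Set.Icc (0 : ℝ) 1, ∀ X : E →L[ℂ] E,
      D.endNorm (c + (D.tau (γ s).fil - 1)) (γ s).fil (D.qPart (γ s).fil X) ≤
        K * D.twistedNorm (γ s).fil X) :
    D.twistedDist (ht.actPoint P) (ht.actPoint Q) ≤ ENNReal.ofReal K * D.twistedDist P Q := by
  obtain ⟨h0, h1, g, hg, hspeed⟩ := hγ
  calc D.twistedDist (ht.actPoint P) (ht.actPoint Q)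
      ≤ ∫⁻ s in Set.Icc (0 : ℝ) 1,
          D.speed (fun s => ht.actPoint (γ s)) (fun s => conjEquiv t (g s)) s :=
        iInf_le_of_le _ (iInf_le_of_le _ (iInf_le_of_le
          ⟨ht.isLift_act hg, congrArg ht.actPoint h0, congrArg ht.actPoint h1⟩ le_rfl))
    _ ≤ ∫⁻ _ in Set.Icc (0 : ℝ) 1, ENNReal.ofReal K * D.twistedDist P Q :=
        setLIntegral_mono' measurableSet_Icc fun s hs => by
          rw [← hspeed s hs, ht.speed_act hg hs, speed,
            ← ENNReal.ofReal_mul' (q := D.twistedNorm _ _) (endNorm_nonneg _ _ _)]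
          exact ENNReal.ofReal_le_ofReal (hK s hs _)
    _ = ENNReal.ofReal K * D.twistedDist P Q := by simp

end IsSimilitude

end Datum

end MixedHodge

end

theorem mainTheorem9_general {E : Type*} [NormedAddCommGroup E] [NormedSpace ℂ E]
    [FiniteDimensional ℂ E] (D : MixedHodge.Datum E) {C : Set D.ClassifyingSpace}
    (hC : IsCompact C) (hsplit : Disjoint C D.splitLocus) :
    ∃ K : ℝ≥0, ∀ (c : ℝ) (t : (E →L[ℂ] E)ˣ), D.IsSimilitude c t →
      ∀ F₁ F₂ G₁ G₂ : D.ClassifyingSpace,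
        G₁.fil = MixedHodge.act ↑t⁻¹ F₁.fil → G₂.fil = MixedHodge.act ↑t⁻¹ F₂.fil →
        (∃ γ, D.IsShortestGeodesic γ G₁ G₂ ∧ ∀ s ∈ Set.Icc (0 : ℝ) 1, γ s ∈ C) →
        D.twistedDist F₁ F₂ ≤ (K : ℝ≥0∞) * D.twistedDist G₁ G₂ := by
  obtain ⟨c₀, hc₀, htau⟩ := MixedHodge.Datum.exists_forall_le_tau_sub_one hC hsplit
  obtain ⟨M, hM⟩ := D.exists_endNorm_qPart_le
  refine ⟨((1 + 1 / c₀) ^ M).toNNReal, fun c t ht F₁ F₂ G₁ G₂ h₁ h₂ ⟨γ, hγ, hmem⟩ => ?_⟩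
  rw [ht.eq_actPoint h₁, ht.eq_actPoint h₂]
  refine ht.twistedDist_act_le hγ fun s hs X => ?_
  have hle := htau (γ s) (hmem s hs)
  have hratio : 1 ≤ 1 / c₀ * (D.tau (γ s).fil - 1) := by rwa [one_div_mul_eq_div, one_le_div hc₀]
  refine hM _ (γ s).prop _ _ _ (by simp [hc₀.le]) (by linarith) (by linarith [ht.pos]) ?_ X
  nlinarith [mul_pos (one_div_pos.2 hc₀) ht.pos, ht.pos]

theorem mainTheorem9 {E : Type*} [NormedAddCommGroup E] [NormedSpace ℂ E]
    [FiniteDimensional ℂ E] (D : MixedHodge.Datum E)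
    {r : ℕ} [NeZero r] (T : D.TwistDatum r)
    (C : Set D.ClassifyingSpace) (hC : IsCompact C) (hsplit : Disjoint C D.splitLocus) :
    ∃ K : ℝ≥0, ∀ y : Fin r → ℝ, (∀ j, 0 < y j) →
      ∀ F₁ F₂ G₁ G₂ : D.ClassifyingSpace,
        G₁.fil = MixedHodge.act (Ring.inverse (T.t y)) F₁.fil →
        G₂.fil = MixedHodge.act (Ring.inverse (T.t y)) F₂.fil →
        (∃ U : Set D.ClassifyingSpace, D.GeodesicallyConvex U ∧ U ⊆ C ∧ G₁ ∈ U ∧ G₂ ∈ U) →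
        D.twistedDist F₁ F₂ ≤ (K : ℝ≥0∞) * D.twistedDist G₁ G₂ := by
  obtain ⟨K, hK⟩ := mainTheorem9_general D hC hsplit
  refine ⟨K, fun y hy F₁ F₂ G₁ G₂ h₁ h₂ ⟨U, hU, hUC, hG₁, hG₂⟩ => ?_⟩
  obtain ⟨t, ht, hsim⟩ := T.exists_isSimilitude_t (hy 0)
  rw [← ht, Ring.inverse_unit] at h₁ h₂
  obtain ⟨γ, hγ, hmem, -⟩ := hU G₁ hG₁ G₂ hG₂
  exact hK _ t hsim F₁ F₂ G₁ G₂ h₁ h₂ ⟨γ, hγ, fun s hs => hUC (hmem s hs)⟩
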